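/- Let $Q$ be a probability distribution on $\mathbb{R}$ with $\int x\,Q(dx)=0$, $\int x^2\,Q(dx)=\tfrac12$ and $b:=\int x^4\,Q(dx)<\infty$. Let $X_{ii}/\sqrt2$ $(i\in\mathbb{N})$, $X^{\mathrm{Re}}_{ij}$ and $X^{\mathrm{Im}}_{ij}$ $(i<j,\ i,j\in\mathbb{N})$ be real random variables on a probability space, all independent and all with distribution $Q$. Put $X_{ij}:=X^{\mathrm{Re}}_{ij}+\mathbf{i}\,X^{\mathrm{Im}}_{ij}$ and $X_{ji}:=X^{\mathrm{Re}}_{ij}-\mathbf{i}\,X^{\mathrm{Im}}_{ij}$ for $i<j$, let $X_N:=(X_{ij})_{1\le i,j\le N}$, and for real $s,t$ let $$f(N;s,t):=\mathbb{E}\bigl(\det(X_N-sI_N)\cdot\det(X_N-tI_N)\bigr),$$ where $I_N$ is the $N\times N$ identity matrix. Let $\xi\in(-2,2)$, let $\varrho(\xi):=\frac{1}{2\pi}\sqrt{4-\xi^2}$, and let $\mu,\nu\in\mathbb{R}$. Then the expectations $f(N;s,t)$ exist (the products of determinants are integrable), and $$\lim_{N\to\infty}\sqrt{\frac{1}{2\pi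 N}}\cdot\frac1{N!}\cdot e^{-N\xi^2/2}\cdot f\Bigl(N;\sqrt N\,\xi+\frac{\mu}{\sqrt N\,\varrho(\xi)},\ \sqrt N\,\xi+\frac{\nu}{\sqrt N\,\varrho(\xi)}\Bigr)=\exp\bigl(b-\tfrac34\bigr)\cdot e^{\xi(\mu+\nu)/(2\varrho(\xi))}\cdot\varrho(\xi)\cdot\frac{\sin\pi(\mu-\nu)}{\pi(\mu-\nu)},$$ where $\sin 0/0:=1$. -/

import Mathlib

open MeasureTheory ProbabilityTheory Filter Topology

/-- Index set of the entries strictly above the diagonal. -/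
abbrev UpperIndex : Type := {p : ℕ × ℕ // p.1 < p.2}

/-- The data from which Hermitian Wigner matrices are built: the (real) diagonal entries `Xd i`
and the real and imaginary parts `Xre`, `Xim` of the entries above the diagonal, such that all the
random variables `Xd i / √2`, `Xre p`, `Xim p` are independent with distribution `Q`. -/
structure IsWignerFamily {Ω : Type*} [MeasurableSpace Ω] (P : Measure Ω) (Q : Measure ℝ)
    (Xd : ℕ → Ω → ℝ) (Xre Xim : UpperIndex → Ω → ℝ) : Prop where
  measurable_diag : ∀ i, Measurable (Xd i)
  measurable_re : ∀ p, Measurable (Xre p)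
  measurable_im : ∀ p, Measurable (Xim p)
  law_diag : ∀ i, P.map (fun ω => Xd i ω / √2) = Q
  law_re : ∀ p, P.map (Xre p) = Q
  law_im : ∀ p, P.map (Xim p) = Q
  indep : iIndepFun
    (Sum.elim (fun i ω => Xd i ω / √2) (Sum.elim Xre Xim) :
      ℕ ⊕ (UpperIndex ⊕ UpperIndex) → Ω → ℝ) P

/-- The Hermitian `N × N` Wigner matrix `X_N` (rows and columns are numbered from `0`). -/
noncomputable def wignerMatrix {Ω : Type*} (Xd : ℕ → Ω → ℝ) (Xre Xim : UpperIndex → Ω → ℝ)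
    (N : ℕ) (ω : Ω) : Matrix (Fin N) (Fin N) ℂ :=
  Matrix.of fun i j =>
    if h : (i : ℕ) < (j : ℕ) then
      (Xre ⟨((i : ℕ), (j : ℕ)), h⟩ ω : ℂ) + Complex.I * (Xim ⟨((i : ℕ), (j : ℕ)), h⟩ ω : ℂ)
    else if h : (j : ℕ) < (i : ℕ) then
      (Xre ⟨((j : ℕ), (i : ℕ)), h⟩ ω : ℂ) - Complex.I * (Xim ⟨((j : ℕ), (i : ℕ)), h⟩ ω : ℂ)
    else (Xd i ω : ℂ)

/-- The product `det (X_N - μ) * det (X_N - ν)` of two values of the characteristic polynomial. -/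
noncomputable def charProd {Ω : Type*} (Xd : ℕ → Ω → ℝ) (Xre Xim : UpperIndex → Ω → ℝ)
    (N : ℕ) (μ ν : ℝ) (ω : Ω) : ℂ :=
  (wignerMatrix Xd Xre Xim N ω - (μ : ℂ) • (1 : Matrix (Fin N) (Fin N) ℂ)).det *
    (wignerMatrix Xd Xre Xim N ω - (ν : ℂ) • (1 : Matrix (Fin N) (Fin N) ℂ)).det

/-- The second-order correlation function `f(N; μ, ν)` of the characteristic polynomial. -/
noncomputable def corrFun {Ω : Type*} [MeasurableSpace Ω] (P : Measure Ω)
    (Xd : ℕ → Ω → ℝ) (Xre Xim : UpperIndex → Ω → ℝ) (N : ℕ) (μ ν : ℝ) : ℂ :=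
  ∫ ω, charProd Xd Xre Xim N μ ν ω ∂P

/-- The density of the semi-circle law on `(-2, 2)`. -/
noncomputable def semicircleDensity (ξ : ℝ) : ℝ := 1 / (2 * Real.pi) * √(4 - ξ ^ 2)

/-! The correlation function is computed exactly for every N, and its asymptotics are then read off
from a contour integral.

Exact formula. Expanding both determinants along the last row and column, and averaging over that
row and column (independent of the remaining minor), expresses f(N+1; s, t) through expectations of
determinants and adjugates of the N × N matrix. Every term is determined by earlier correlation
functions: tr adj(X - s) is -d/ds det(X - s), so the traces become partial derivatives of f(N; ·,
·); the trace of a product of adjugates, multiplied by s - t, follows from a resolvent identity; the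
products of diagonal cofactors are characteristic polynomials of principal minors, hence give f(N-1;
s, t). The fourth moment enters only through this last term, with coefficient 2c, c = b - 3/4, which
is the excess of E|X_ij|⁴ over the Gaussian value 2. For c = 0 the solution is N! times the Hermite
Christoffel-Darboux sum, by `kernelSum_hermiteFun_recursion`; for general c that sum is convolved
with the Taylor coefficients of exp(c z²). The result is `integral_charProd_eq_corrKernel`.

Generating function. By Mehler's formula, f(N; s, t) / N! is the N-th Taylor coefficient at 0 of
`corrGenFun`, which is exp(c z²) times an explicit function with singularities at z = 1 and z = -1
(`corrKernel_eq_iteratedDeriv`).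

Asymptotics. Cauchy's formula is applied on the circle of radius exp(-1/N). There the factor exp(-N
ξ²/2) compensates the growth of the integrand uniformly in the angle. Around z = 1 the singularity
(1 - z)^(-3/2), rescaled by φ = u/N, gives in the limit an inverse Laplace integral whose value is a
sinc (`integral_cexp_mul_cpow_mul_cexp_inv`). Around z = -1 the singularity (1 + z)^(-1/2) is
integrable, and that arc contributes only O(N^(-1/2)). -/

/-! ### Determinants, adjugates and the characteristic polynomial -/

section LinearAlgebra

variable {n : Type*} [Fintype n] [DecidableEq n]

lemma eventually_det_add_smul_one_ne_zero (A : Matrix n n ℂ) :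
    ∀ᶠ x : ℂ in 𝓝[≠] 0, (A + x • (1 : Matrix n n ℂ)).det ≠ 0 := by
  have h : ∀ x : ℂ, (A + x • (1 : Matrix n n ℂ)).det = (-A).charpoly.eval x := by
    intro x
    rw [Matrix.eval_charpoly]
    congr 1
    rw [sub_neg_eq_add, add_comm, Matrix.scalar_apply, Matrix.smul_one_eq_diagonal]
  have hfin : {x : ℂ | (-A).charpoly.IsRoot x}.Finite :=
    Polynomial.finite_setOfPred_isRoot (Matrix.charpoly_monic _).ne_zero
  have h2 : ({x : ℂ | (-A).charpoly.IsRoot x} \ {0}).Finite := hfin.subset Set.sdiff_subset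
  have h3 : ({x : ℂ | (-A).charpoly.IsRoot x} \ {0})ᶜ ∈ 𝓝 (0 : ℂ) :=
    h2.isClosed.isOpen_compl.mem_nhds (by simp)
  rw [eventually_nhdsWithin_iff]
  filter_upwards [h3] with x hx hx0
  rw [h]
  intro hroot
  exact hx ⟨hroot, hx0⟩

/-- Schur complement formula, with the inverse written as adjugate over determinant so that the
division cancels. -/
lemma det_fromBlocks_unit_of_det_ne_zero (A : Matrix n n ℂ) (hA : A.det ≠ 0)
    (B : Matrix n (Fin 1) ℂ) (C : Matrix (Fin 1) n ℂ) (D : Matrix (Fin 1) (Fin 1) ℂ) :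
    (Matrix.fromBlocks A B C D).det =
      D 0 0 * A.det - (C * A.adjugate * B) 0 0 := by
  have hu : IsUnit A.det := isUnit_iff_ne_zero.mpr hA
  let _ := Matrix.invertibleOfIsUnitDet A hu
  rw [Matrix.det_fromBlocks₁₁, Matrix.det_fin_one, Matrix.sub_apply, mul_sub, mul_comm]
  congr 1
  rw [Matrix.invOf_eq_nonsing_inv, Matrix.inv_def, Ring.inverse_eq_inv']
  rw [Matrix.mul_smul, Matrix.smul_mul, Matrix.smul_apply, smul_eq_mul, ← mul_assoc,
    mul_inv_cancel₀ hA, one_mul]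

/-- Both sides depend continuously on `A`, and `A + x • 1` is invertible for all small nonzero `x`;
letting `x` tend to 0 removes the invertibility assumption. -/
lemma det_fromBlocks_unit (A : Matrix n n ℂ)
    (B : Matrix n (Fin 1) ℂ) (C : Matrix (Fin 1) n ℂ) (D : Matrix (Fin 1) (Fin 1) ℂ) :
    (Matrix.fromBlocks A B C D).det =
      D 0 0 * A.det - (C * A.adjugate * B) 0 0 := by
  have hcA : Continuous fun x : ℂ => A + x • (1 : Matrix n n ℂ) := by fun_prop
  have hc1 : Continuous fun x : ℂ => (Matrix.fromBlocks (A + x • (1 : Matrix n n ℂ)) B C D).det :=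
    (hcA.matrix_fromBlocks continuous_const continuous_const continuous_const).matrix_det
  have hc2 : Continuous fun x : ℂ => D 0 0 * (A + x • (1 : Matrix n n ℂ)).det -
      (C * (A + x • (1 : Matrix n n ℂ)).adjugate * B) 0 0 := by
    refine (continuous_const.mul hcA.matrix_det).sub ?_
    exact ((continuous_const.matrix_mul hcA.matrix_adjugate).matrix_mul
      continuous_const).matrix_elem 0 0
  have h := tendsto_nhds_unique_of_eventuallyEq
    ((hc1.tendsto 0).mono_left nhdsWithin_le_nhds) ((hc2.tendsto 0).mono_left nhdsWithin_le_nhds)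
    (l := 𝓝[≠] (0 : ℂ)) (by
      filter_upwards [eventually_det_add_smul_one_ne_zero A] with x hx
      exact det_fromBlocks_unit_of_det_ne_zero _ hx B C D)
  simpa using h

/-- Expansion of a determinant along its last row and its last column. -/
lemma det_eq_last_sub_sum_adjugate {N : ℕ} (M : Matrix (Fin (N + 1)) (Fin (N + 1)) ℂ) :
    M.det = M (Fin.last N) (Fin.last N) * (M.submatrix Fin.castSucc Fin.castSucc).det -
      ∑ i, ∑ j, M (Fin.last N) (Fin.castSucc i) * M (Fin.castSucc j) (Fin.last N) *
        (M.submatrix Fin.castSucc Fin.castSucc).adjugate i j := by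
  have h : M.submatrix (finSumFinEquiv (m := N) (n := 1)) finSumFinEquiv = Matrix.fromBlocks
      (M.submatrix Fin.castSucc Fin.castSucc) (Matrix.of fun i _ => M (Fin.castSucc i) (Fin.last N))
      (Matrix.of fun _ j => M (Fin.last N) (Fin.castSucc j))
      (Matrix.of fun _ _ => M (Fin.last N) (Fin.last N)) := by
    have h1 : ∀ i : Fin N, Fin.castAdd 1 i = Fin.castSucc i := fun i => rfl
    have h2 : ∀ i : Fin 1, Fin.natAdd N i = Fin.last N := fun i => by
      rw [Subsingleton.elim i 0]; rfl
    ext i j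
    rcases i with i | i <;> rcases j with j | j <;> simp [h1, h2]
  rw [← Matrix.det_submatrix_equiv_self (finSumFinEquiv (m := N) (n := 1)) M, h,
    det_fromBlocks_unit]
  simp only [Matrix.of_apply, Matrix.mul_apply, Finset.sum_mul]
  rw [Finset.sum_comm]
  congr 1
  refine Finset.sum_congr rfl fun i _ => Finset.sum_congr rfl fun j _ => ?_
  ring

lemma det_updateCol_single (A : Matrix n n ℂ) (i : n) :
    (A.updateCol i (Pi.single i 1)).det = A.adjugate i i := by
  rw [← Matrix.det_transpose, ← Matrix.updateRow_transpose, ← Matrix.adjugate_apply,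
    ← Matrix.adjugate_transpose, Matrix.transpose_apply]

/-- Jacobi's formula for this pencil. Differentiating the Leibniz expansion one column at a time
replaces column `j` by minus the `j`-th unit vector, which leaves minus the diagonal cofactor. -/
lemma hasDerivAt_det_sub_smul_one (A : Matrix n n ℂ) (s : ℝ) :
    HasDerivAt (fun s : ℝ => (A - (s : ℂ) • (1 : Matrix n n ℂ)).det)
      (-(A - (s : ℂ) • (1 : Matrix n n ℂ)).adjugate.trace) s := by
  have hentry : ∀ i j : n, HasDerivAt (fun s : ℝ => (A - (s : ℂ) • (1 : Matrix n n ℂ)) i j)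
      (-(Pi.single j 1 : n → ℂ) i) s := by
    intro i j
    have h1 : HasDerivAt (fun s : ℝ => (s : ℂ)) 1 s := Complex.ofRealCLM.hasDerivAt
    have := (h1.mul_const ((1 : Matrix n n ℂ) i j)).const_sub (A i j)
    simpa [Matrix.one_apply, Pi.single_apply] using this
  simp only [Matrix.det_apply]
  refine (HasDerivAt.fun_sum (u := Finset.univ) fun σ _ => (HasDerivAt.fun_finsetProd
    (u := Finset.univ) fun i _ => hentry (σ i) i).const_smul (Equiv.Perm.sign σ)).congr_deriv ?_
  set P := A - (s : ℂ) • (1 : Matrix n n ℂ)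
  simp only [Matrix.trace, Matrix.diag_apply, ← det_updateCol_single, Matrix.det_apply,
    Finset.smul_sum]
  rw [Finset.sum_comm, ← Finset.sum_neg_distrib]
  refine Finset.sum_congr rfl fun j _ => ?_
  rw [← Finset.sum_neg_distrib]
  refine Finset.sum_congr rfl fun σ _ => ?_
  rw [← Finset.prod_erase_mul _ _ (Finset.mem_univ j), ← smul_neg]
  congr 1
  rw [smul_eq_mul, mul_neg, Matrix.updateCol_self]
  congr 2
  refine Finset.prod_congr rfl fun i hi => ?_
  rw [Matrix.updateCol_ne (Finset.ne_of_mem_erase hi)]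

/-- A resolvent identity for adjugates. -/
lemma sub_mul_trace_adjugate_mul_adjugate (A : Matrix n n ℂ) (s t : ℂ) :
    (s - t) * ((A - s • (1 : Matrix n n ℂ)).adjugate * (A - t • (1 : Matrix n n ℂ)).adjugate).trace =
      (A - s • (1 : Matrix n n ℂ)).adjugate.trace * (A - t • (1 : Matrix n n ℂ)).det -
      (A - s • (1 : Matrix n n ℂ)).det * (A - t • (1 : Matrix n n ℂ)).adjugate.trace := by
  set P := A - s • (1 : Matrix n n ℂ) with hP
  set R := A - t • (1 : Matrix n n ℂ) with hR
  have h : (s - t) • (1 : Matrix n n ℂ) = R - P := by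
    rw [hP, hR, sub_smul]; abel
  -- Multiply `R - P = (s - t) • 1` by the adjugates from both sides; no invertibility is needed.
  have h2 : (s - t) • (P.adjugate * R.adjugate) =
      R.det • P.adjugate - P.det • R.adjugate := by
    calc (s - t) • (P.adjugate * R.adjugate)
        = P.adjugate * ((s - t) • (1 : Matrix n n ℂ)) * R.adjugate := by
          simp
      _ = P.adjugate * (R * R.adjugate) - (P.adjugate * P) * R.adjugate := by
          rw [h, mul_sub, sub_mul]; simp only [mul_assoc]
      _ = _ := by
          rw [Matrix.mul_adjugate, Matrix.adjugate_mul]; simp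
  have := congrArg Matrix.trace h2
  rw [Matrix.trace_smul, Matrix.trace_sub, Matrix.trace_smul, Matrix.trace_smul] at this
  simpa [mul_comm] using this

end LinearAlgebra

/-! ### Hermite polynomials and the closed-form solution of the recursion -/

section HermiteKernel

/-- The probabilists' Hermite polynomials, as functions on `ℝ`. -/
noncomputable def hermiteFun : ℕ → ℝ → ℝ
  | 0, _ => 1
  | 1, x => x
  | n + 2, x => x * hermiteFun (n + 1) x - (n + 1) * hermiteFun n x

/-- The derivative of `hermiteFun n`. -/
noncomputable def hermiteFunDeriv (n : ℕ) (x : ℝ) : ℝ := n * hermiteFun (n - 1) x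

/-- The three-term recurrence as a raising operator, x - d/dx. It also covers `n = 0`, where the
truncated index in `hermiteFunDeriv` is multiplied by 0. -/
lemma hermiteFun_succ (n : ℕ) (x : ℝ) :
    hermiteFun (n + 1) x = x * hermiteFun n x - hermiteFunDeriv n x := by
  cases n with
  | zero => simp [hermiteFun, hermiteFunDeriv]
  | succ n => simp [hermiteFun, hermiteFunDeriv]

lemma hasDerivAt_hermiteFun (n : ℕ) (x : ℝ) :
    HasDerivAt (hermiteFun n) (hermiteFunDeriv n x) x := by
  induction n using Nat.strong_induction_on with
  | _ n ih =>
    match n with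
    | 0 => simpa [hermiteFunDeriv, hermiteFun, funext_iff] using hasDerivAt_const x (1 : ℝ)
    | 1 => simpa [hermiteFunDeriv, hermiteFun] using hasDerivAt_id' x
    | n + 2 =>
      have h := ((hasDerivAt_id x).mul (ih (n + 1) (by omega))).sub
        ((ih n (by omega)).const_mul ((n : ℝ) + 1))
      have h2 : HasDerivAt (hermiteFun (n + 2)) _ x := h
      refine h2.congr_deriv ?_
      have h3 := hermiteFun_succ n x
      simp only [hermiteFunDeriv, id, add_tsub_cancel_right, Nat.cast_add, Nat.cast_one,
        Nat.cast_ofNat, Nat.add_succ_sub_one] at h3 ⊢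
      rw [h3]
      ring

/-- Partial sums of a bilinear series with factorial weights. -/
noncomputable def kernelSum (n : ℕ) (u v : ℕ → ℝ) : ℝ :=
  ∑ k ∈ Finset.range (n + 1), u k * v k / k.factorial

lemma kernelSum_succ (n : ℕ) (u v : ℕ → ℝ) :
    kernelSum (n + 1) u v = kernelSum n u v + u (n + 1) * v (n + 1) / (n + 1).factorial :=
  Finset.sum_range_succ _ _

/-- The Christoffel-Darboux formula. -/
lemma sub_mul_kernelSum_hermiteFun (n : ℕ) (s t : ℝ) :
    (s - t) * kernelSum n (hermiteFun · s) (hermiteFun · t) =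
      (hermiteFun (n + 1) s * hermiteFun n t - hermiteFun n s * hermiteFun (n + 1) t)
        / n.factorial := by
  induction n with
  | zero => simp [kernelSum, hermiteFun]
  | succ n ih =>
    rw [kernelSum_succ, mul_add, ih]
    have hf : (n.factorial : ℝ) ≠ 0 := by positivity
    rw [Nat.factorial_succ]
    simp only [hermiteFun]
    push_cast
    field_simp
    ring

/-- This is the Gaussian case of the recursion for the correlation functions, multiplied by s - t to
avoid a quotient. Since s - ∂_s and t - ∂_t raise the Hermite index, (s - ∂_s)(t - ∂_t) turns the
kernel into the same sum up to n + 1 with the k-th term weighted by k. The remaining terms supply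
the weights n + 1 - k; in the induction this is done by the Christoffel-Darboux formula. -/
lemma kernelSum_hermiteFun_recursion (n : ℕ) (s t : ℝ) :
    (s - t) * ((1 + s * t) * kernelSum n (hermiteFun · s) (hermiteFun · t)
        - s * kernelSum n (hermiteFun · s) (hermiteFunDeriv · t)
        - t * kernelSum n (hermiteFunDeriv · s) (hermiteFun · t)
        + kernelSum n (hermiteFunDeriv · s) (hermiteFunDeriv · t))
      + (kernelSum n (hermiteFun · s) (hermiteFunDeriv · t)
        - kernelSum n (hermiteFunDeriv · s) (hermiteFun · t)) =
    (s - t) * ((n + 1) * kernelSum (n + 1) (hermiteFun · s) (hermiteFun · t)) := by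
  induction n with
  | zero => simp [kernelSum, hermiteFun, hermiteFunDeriv, Finset.sum_range_succ]
  | succ n ih =>
    have hcd := sub_mul_kernelSum_hermiteFun n s t
    rw [kernelSum_succ (n + 1) (hermiteFun · s) (hermiteFun · t), kernelSum_succ n,
      kernelSum_succ n, kernelSum_succ n, kernelSum_succ n]
    rw [kernelSum_succ n] at ih
    have hf : (n.factorial : ℝ) ≠ 0 := by positivity
    have h1 := hermiteFun_succ (n + 1) s
    have h2 := hermiteFun_succ (n + 1) t
    rw [hermiteFunDeriv] at h1 h2
    simp only [Nat.factorial_succ, hermiteFunDeriv, Nat.add_sub_cancel] at *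
    rw [h1, h2]
    push_cast at *
    field_simp at *
    linear_combination (n + 1) * ih - (n + 1) * hcd
  
/-- The Taylor coefficients of `x ↦ exp (c * x ^ 2)`. -/
noncomputable def expSqCoeff (c : ℝ) : ℕ → ℝ
  | 0 => 1
  | 1 => 0
  | n + 2 => 2 * c / (n + 2) * expSqCoeff c n

/-- The polynomials describing the correlation functions of the characteristic polynomials,
as a bilinear expression in two sequences. -/
noncomputable def corrKernel (c : ℝ) (N : ℕ) (u v : ℕ → ℝ) : ℝ :=
  N.factorial * ∑ p ∈ Finset.HasAntidiagonal.antidiagonal N, expSqCoeff c p.1 * kernelSum p.2 u v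

/-- The product rule for power series, in coefficients: the weight N + 1 is split as the sum of the
two indices. -/
lemma succ_mul_sum_antidiagonal (e f : ℕ → ℝ) (N : ℕ) :
    ((N : ℝ) + 1) * ∑ p ∈ Finset.HasAntidiagonal.antidiagonal (N + 1), e p.1 * f p.2 =
      ∑ p ∈ Finset.HasAntidiagonal.antidiagonal N, ((p.1 + 1) * e (p.1 + 1)) * f p.2 +
      ∑ p ∈ Finset.HasAntidiagonal.antidiagonal N, e p.1 * ((p.2 + 1) * f (p.2 + 1)) := by
  have h : ((N : ℝ) + 1) * ∑ p ∈ Finset.HasAntidiagonal.antidiagonal (N + 1), e p.1 * f p.2 =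
      ∑ p ∈ Finset.HasAntidiagonal.antidiagonal (N + 1), (p.1 * e p.1) * f p.2 +
      ∑ p ∈ Finset.HasAntidiagonal.antidiagonal (N + 1), e p.1 * (p.2 * f p.2) := by
    rw [Finset.mul_sum, ← Finset.sum_add_distrib]
    refine Finset.sum_congr rfl fun p hp => ?_
    have : (p.1 : ℝ) + p.2 = N + 1 := by exact_mod_cast Finset.HasAntidiagonal.mem_antidiagonal.mp hp
    rw [← this]; ring
  rw [h, Finset.Nat.sum_antidiagonal_succ, Finset.Nat.sum_antidiagonal_succ']
  simp

/-- In the product rule, differentiating the kernel factor reproduces the Gaussian recursion, while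
differentiating exp(c z²) multiplies it by 2 c z. The latter is the fourth-moment term; its index `N
- 1` at `N = 0` is harmless because of the factor `N`. -/
lemma corrKernel_hermiteFun_recursion (c : ℝ) (N : ℕ) (s t : ℝ) :
    (s - t) * ((1 + s * t) * corrKernel c N (hermiteFun · s) (hermiteFun · t)
        - s * corrKernel c N (hermiteFun · s) (hermiteFunDeriv · t)
        - t * corrKernel c N (hermiteFunDeriv · s) (hermiteFun · t)
        + corrKernel c N (hermiteFunDeriv · s) (hermiteFunDeriv · t)
        + 2 * c * N * corrKernel c (N - 1) (hermiteFun · s) (hermiteFun · t))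
      + (corrKernel c N (hermiteFun · s) (hermiteFunDeriv · t)
        - corrKernel c N (hermiteFunDeriv · s) (hermiteFun · t)) =
    (s - t) * corrKernel c (N + 1) (hermiteFun · s) (hermiteFun · t) := by
  have hrec : (s - t) * ((N.factorial : ℝ) * ∑ p ∈ Finset.HasAntidiagonal.antidiagonal N,
        expSqCoeff c p.1 * ((p.2 + 1) *
          kernelSum (p.2 + 1) (hermiteFun · s) (hermiteFun · t))) =
      (s - t) * ((1 + s * t) * corrKernel c N (hermiteFun · s) (hermiteFun · t)
        - s * corrKernel c N (hermiteFun · s) (hermiteFunDeriv · t)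
        - t * corrKernel c N (hermiteFunDeriv · s) (hermiteFun · t)
        + corrKernel c N (hermiteFunDeriv · s) (hermiteFunDeriv · t))
      + (corrKernel c N (hermiteFun · s) (hermiteFunDeriv · t)
        - corrKernel c N (hermiteFunDeriv · s) (hermiteFun · t)) := by
    simp only [corrKernel, Finset.mul_sum, ← Finset.sum_add_distrib, ← Finset.sum_sub_distrib]
    refine Finset.sum_congr rfl fun p _ => ?_
    linear_combination (-(N.factorial : ℝ) * expSqCoeff c p.1) *
      kernelSum_hermiteFun_recursion p.2 s t
  have hexp : (N.factorial : ℝ) * ∑ p ∈ Finset.HasAntidiagonal.antidiagonal N,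
        ((p.1 + 1) * expSqCoeff c (p.1 + 1)) * kernelSum p.2 (hermiteFun · s) (hermiteFun · t) =
      2 * c * N * corrKernel c (N - 1) (hermiteFun · s) (hermiteFun · t) := by
    cases N with
    | zero => simp [expSqCoeff]
    | succ N =>
      rw [Finset.Nat.sum_antidiagonal_succ]
      simp only [corrKernel, Nat.add_sub_cancel, Nat.factorial_succ, Nat.cast_mul, expSqCoeff]
      simp only [Finset.mul_sum, CharP.cast_eq_zero, zero_add, mul_zero, zero_mul]
      refine Finset.sum_congr rfl fun p _ => ?_
      have : (p.1 : ℝ) + 2 ≠ 0 := by positivity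
      push_cast
      field_simp
      ring
  have hfac : corrKernel c (N + 1) (hermiteFun · s) (hermiteFun · t) =
      (N.factorial : ℝ) * (((N : ℝ) + 1) * ∑ p ∈ Finset.HasAntidiagonal.antidiagonal (N + 1), expSqCoeff c p.1 *
        kernelSum p.2 (hermiteFun · s) (hermiteFun · t)) := by
    rw [corrKernel, Nat.factorial_succ]; push_cast; ring
  rw [hfac, succ_mul_sum_antidiagonal (expSqCoeff c)
    (fun n => kernelSum n (hermiteFun · s) (hermiteFun · t))]
  linear_combination -hrec - (s - t) * hexp

lemma hasDerivAt_corrKernel_left (c : ℝ) (N : ℕ) (v : ℕ → ℝ) (s : ℝ) :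
    HasDerivAt (fun s => corrKernel c N (hermiteFun · s) v)
      (corrKernel c N (hermiteFunDeriv · s) v) s := by
  unfold corrKernel kernelSum
  refine (HasDerivAt.fun_sum fun p _ => (HasDerivAt.fun_sum fun k _ => ?_).const_mul _).const_mul _
  exact ((hasDerivAt_hermiteFun k s).mul_const _).div_const _

lemma corrKernel_comm (c : ℝ) (N : ℕ) (u v : ℕ → ℝ) : corrKernel c N u v = corrKernel c N v u := by
  simp only [corrKernel, kernelSum, mul_comm]

end HermiteKernel

/-! ### Mehler's formula and the generating function -/

section GeneratingFunction

/-- The Taylor series at `0` of a function of a complex variable. -/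
noncomputable def taylorAtZero (f : ℂ → ℂ) : PowerSeries ℂ :=
  PowerSeries.mk fun n => iteratedDeriv n f 0 / n.factorial

lemma taylorAtZero_mul {f g : ℂ → ℂ} (hf : AnalyticAt ℂ f 0) (hg : AnalyticAt ℂ g 0) :
    taylorAtZero (fun z => f z * g z) = taylorAtZero f * taylorAtZero g := by
  ext n
  rw [PowerSeries.coeff_mul, taylorAtZero, PowerSeries.coeff_mk,
    iteratedDeriv_fun_mul hf.contDiffAt hg.contDiffAt,
    Finset.Nat.sum_antidiagonal_eq_sum_range_succ_mk, Finset.sum_div]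
  refine Finset.sum_congr rfl fun i hi => ?_
  have hi' : i ≤ n := Nat.lt_succ_iff.mp (Finset.mem_range.mp hi)
  simp only [taylorAtZero, PowerSeries.coeff_mk]
  rw [Nat.cast_choose ℂ hi']
  have h1 : (n.factorial : ℂ) ≠ 0 := by exact_mod_cast n.factorial_ne_zero
  have h2 : (i.factorial : ℂ) ≠ 0 := by exact_mod_cast i.factorial_ne_zero
  have h3 : ((n - i).factorial : ℂ) ≠ 0 := by exact_mod_cast (n - i).factorial_ne_zero
  field_simp

lemma taylorAtZero_congr {f g : ℂ → ℂ} (h : f =ᶠ[𝓝 0] g) : taylorAtZero f = taylorAtZero g := by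
  ext n
  simp only [taylorAtZero, PowerSeries.coeff_mk, h.iteratedDeriv_eq n]

lemma taylorAtZero_deriv (f : ℂ → ℂ) :
    taylorAtZero (deriv f) = PowerSeries.derivative ℂ (taylorAtZero f) := by
  ext n
  simp only [PowerSeries.coeff_derivative, taylorAtZero, PowerSeries.coeff_mk,
    ← iteratedDeriv_succ', Nat.factorial_succ]
  have h1 : (n.factorial : ℂ) ≠ 0 := by exact_mod_cast n.factorial_ne_zero
  have h2 : (n : ℂ) + 1 ≠ 0 := by exact_mod_cast n.succ_ne_zero
  push_cast
  field_simp

lemma hasDerivAt_polynomial_aux (p : Polynomial ℂ) : deriv (fun z => p.eval z) =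
    fun z => p.derivative.eval z := by
  ext z; exact p.deriv

lemma iteratedDeriv_polynomial_eval (p : Polynomial ℂ) (n : ℕ) :
    iteratedDeriv n (fun z => p.eval z) = fun z => ((Polynomial.derivative^[n]) p).eval z := by
  induction n generalizing p with
  | zero => simp
  | succ n ih =>
    rw [iteratedDeriv_succ', hasDerivAt_polynomial_aux, ih, Function.iterate_succ_apply]

lemma taylorAtZero_polynomial (p : Polynomial ℂ) :
    taylorAtZero (fun z => p.eval z) = (p : PowerSeries ℂ) := by
  ext n
  rw [taylorAtZero, PowerSeries.coeff_mk, iteratedDeriv_polynomial_eval, Polynomial.coeff_coe]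
  beta_reduce
  rw [← Polynomial.coeff_zero_eq_eval_zero, Polynomial.coeff_iterate_derivative]
  have h1 : (n.factorial : ℂ) ≠ 0 := by exact_mod_cast n.factorial_ne_zero
  simp [Nat.descFactorial_self]
  field_simp

/-- Uniqueness of power series solutions of first order linear differential equations. -/
lemma powerSeries_eq_of_linear_ode {q r f g : PowerSeries ℂ}
    (hq : PowerSeries.constantCoeff q = 1)
    (hf : q * PowerSeries.derivative ℂ f = r * f) (hg : q * PowerSeries.derivative ℂ g = r * g)
    (h0 : PowerSeries.constantCoeff f = PowerSeries.constantCoeff g) : f = g := by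
  set d := f - g with hd
  have hq' : q⁻¹ * q = 1 := PowerSeries.inv_mul_cancel q (by rw [hq]; exact one_ne_zero)
  have hode : PowerSeries.derivative ℂ d = (q⁻¹ * r) * d := by
    rw [hd, map_sub]
    linear_combination q⁻¹ * hf - q⁻¹ * hg - (PowerSeries.derivative ℂ f -
      PowerSeries.derivative ℂ g) * hq'
  -- The equation expresses (n + 1) times coefficient n + 1 through the coefficients up to n, so all
  -- of them vanish once the constant one does.
  have hz : ∀ n, PowerSeries.coeff n d = 0 := by
    intro n
    induction n using Nat.strong_induction_on with
    | _ n ih =>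
      cases n with
      | zero => simp [hd, h0]
      | succ n =>
        have h := congrArg (PowerSeries.coeff n) hode
        rw [PowerSeries.coeff_derivative, PowerSeries.coeff_mul, Finset.sum_eq_zero] at h
        · have h2 : (n : ℂ) + 1 ≠ 0 := by exact_mod_cast n.succ_ne_zero
          exact (mul_eq_zero.mp h).resolve_right h2
        · intro p hp
          have := Finset.HasAntidiagonal.mem_antidiagonal.mp hp
          rw [ih p.2 (by omega), mul_zero]
  have : d = 0 := by ext n; simpa using hz n
  exact sub_eq_zero.mp this

open PowerSeries in
/-- Mehler's generating function, as a differential equation. -/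
lemma mehler_ode (s t : ℝ) :
    (1 - X ^ 2) ^ 2 * derivative ℂ
        (mk fun n => ((hermiteFun n s * hermiteFun n t / n.factorial : ℝ) : ℂ)) =
      ((C (t : ℂ) - C (s : ℂ) * X) * (C (s : ℂ) - C (t : ℂ) * X) + X * (1 - X ^ 2)) *
        (mk fun n => ((hermiteFun n s * hermiteFun n t / n.factorial : ℝ) : ℂ)) := by
  set A : PowerSeries ℂ := mk fun n => ((hermiteFun n s * hermiteFun n t / n.factorial : ℝ) : ℂ)
  set B : PowerSeries ℂ :=
    mk fun n => ((hermiteFun (n + 1) s * hermiteFun n t / n.factorial : ℝ) : ℂ)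
  set B' : PowerSeries ℂ :=
    mk fun n => ((hermiteFun n s * hermiteFun (n + 1) t / n.factorial : ℝ) : ℂ)
  -- The recurrences in s and in t give two linear equations between `A` and the shifted series `B`,
  -- `B'`. Eliminating `B'` determines (1 - X²) `B` in terms of `A`.
  have h1 : B + X * B' = C (s : ℂ) * A := by
    ext n
    cases n with
    | zero => simp [A, B, hermiteFun]
    | succ n =>
      simp only [map_add, coeff_succ_X_mul, coeff_C_mul, A, B, B', coeff_mk]
      norm_cast
      have hf : (n.factorial : ℝ) ≠ 0 := by positivity
      simp only [hermiteFun, Nat.factorial_succ]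
      push_cast
      field_simp
      ring
  have h2 : B' + X * B = C (t : ℂ) * A := by
    ext n
    cases n with
    | zero => simp [A, B', hermiteFun]
    | succ n =>
      simp only [map_add, coeff_succ_X_mul, coeff_C_mul, A, B, B', coeff_mk]
      norm_cast
      have hf : (n.factorial : ℝ) ≠ 0 := by positivity
      simp only [hermiteFun, Nat.factorial_succ]
      push_cast
      field_simp
      ring
  -- The n-th coefficient of the derivative is He_{n+1}(s) He_{n+1}(t) / n!; the recurrence is
  -- applied in t, and then in s to the term containing He_{n-1}(t).
  have h3 : derivative ℂ A = C (t : ℂ) * B - C (s : ℂ) * (X * B) + X * derivative ℂ (X * A) := by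
    ext n
    cases n with
    | zero => simp [A, B, hermiteFun, coeff_derivative, mul_comm]
    | succ n =>
      simp only [map_add, map_sub, coeff_succ_X_mul, coeff_C_mul, A, B, coeff_mk,
        coeff_derivative]
      norm_cast
      have hf : (n.factorial : ℝ) ≠ 0 := by positivity
      simp only [hermiteFun, Nat.factorial_succ]
      push_cast
      field_simp
      ring
  have h4 : derivative ℂ (X * A) = A + X * derivative ℂ A := by
    simp [Derivation.leibniz, add_comm, mul_comm]
  rw [h4] at h3
  have h5 : (1 - X ^ 2) * B = (C (s : ℂ) - C (t : ℂ) * X) * A := by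
    linear_combination h1 - X * h2
  linear_combination (1 - X ^ 2) * h3 + (C (t : ℂ) - C (s : ℂ) * X) * h5

/-- The generating function of the second-order correlation functions. -/
noncomputable def corrGenFun (c s t z : ℂ) : ℂ :=
  Complex.exp (c * z ^ 2 + ((s + t) / 2) ^ 2 * (z / (1 + z)) - ((s - t) / 2) ^ 2 * (z / (1 - z)))
    * (1 - z) ^ (-(3 / 2) : ℂ) * (1 + z) ^ (-(1 / 2) : ℂ)

lemma one_sub_mem_slitPlane {z : ℂ} (hz : ‖z‖ < 1) : 1 - z ∈ Complex.slitPlane := by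
  left
  have := (Complex.re_le_norm z).trans_lt hz
  simp only [Complex.sub_re, Complex.one_re]; linarith

lemma one_add_mem_slitPlane {z : ℂ} (hz : ‖z‖ < 1) : 1 + z ∈ Complex.slitPlane := by
  have := one_sub_mem_slitPlane (z := -z) (by simpa using hz)
  simpa using this

/-- In the unit disc 1 - z and 1 + z have positive real part, so the principal powers are
holomorphic there. Writing the derivative as a rational function times the function exposes the
differential equation to be compared with Mehler's. -/
lemma hasDerivAt_corrGenFun (c s t : ℂ) {z : ℂ} (hz : ‖z‖ < 1) :
    HasDerivAt (corrGenFun c s t)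
      ((2 * c * z + ((s + t) / 2) ^ 2 / (1 + z) ^ 2 - ((s - t) / 2) ^ 2 / (1 - z) ^ 2
        + (3 / 2) / (1 - z) - (1 / 2) / (1 + z)) * corrGenFun c s t z) z := by
  have hm := one_sub_mem_slitPlane hz
  have hp := one_add_mem_slitPlane hz
  have hm0 := Complex.slitPlane_ne_zero hm
  have hp0 := Complex.slitPlane_ne_zero hp
  have d1 : HasDerivAt (fun z : ℂ => 1 - z) (-1) z := by simpa using (hasDerivAt_id' z).const_sub 1
  have d2 : HasDerivAt (fun z : ℂ => 1 + z) 1 z := by simpa using (hasDerivAt_id' z).const_add 1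
  have e1 := d1.cpow_const (c := -(3 / 2)) hm
  have e2 := d2.cpow_const (c := -(1 / 2)) hp
  have e3 := ((((hasDerivAt_id' z).pow 2).const_mul c).add
    (((hasDerivAt_id' z).div d2 hp0).const_mul (((s + t) / 2) ^ 2))).sub
    (((hasDerivAt_id' z).div d1 hm0).const_mul (((s - t) / 2) ^ 2))
  refine ((e3.cexp.mul e1).mul e2).congr_deriv ?_
  rw [Complex.cpow_sub _ _ hm0, Complex.cpow_sub _ _ hp0, Complex.cpow_one, Complex.cpow_one]
  simp only [corrGenFun, Pi.mul_apply, Pi.add_apply, Pi.sub_apply, Pi.pow_apply, Pi.div_apply]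
  field_simp
  ring

lemma differentiableOn_corrGenFun (c s t : ℂ) :
    DifferentiableOn ℂ (corrGenFun c s t) (Metric.ball 0 1) := fun z hz =>
  (hasDerivAt_corrGenFun c s t (by simpa using hz)).differentiableAt.differentiableWithinAt

lemma analyticAt_corrGenFun (c s t : ℂ) : AnalyticAt ℂ (corrGenFun c s t) 0 :=
  (differentiableOn_corrGenFun c s t).analyticAt (Metric.ball_mem_nhds 0 one_pos)

open PowerSeries in
lemma derivative_expSqCoeff (c : ℝ) :
    derivative ℂ (mk fun n => (expSqCoeff c n : ℂ)) =
      2 * C (c : ℂ) * X * (mk fun n => (expSqCoeff c n : ℂ)) := by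
  have h : 2 * C (c : ℂ) * X * (mk fun n => (expSqCoeff c n : ℂ)) =
    C (2 * c : ℂ) * (X * (mk fun n => (expSqCoeff c n : ℂ))) := by
    rw [map_mul, show (C (2 : ℂ) : PowerSeries ℂ) = 2 from map_ofNat C 2]; ring
  rw [h]
  ext n
  cases n with
  | zero => simp [coeff_derivative, expSqCoeff]
  | succ n =>
    simp only [coeff_derivative, coeff_C_mul, coeff_succ_X_mul, coeff_mk, expSqCoeff]
    have h2 : (n : ℂ) + 2 ≠ 0 := by exact_mod_cast (n + 1).succ_ne_zero
    push_cast
    field_simp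
    ring

open PowerSeries in
-- Both sides solve the same first-order linear equation with the same constant term. For the left
-- side this is the logarithmic derivative. For the right side one combines Mehler's equation, the
-- factor 1 / (1 - X) that forms partial sums, and the equation of exp(c X²).
lemma taylorAtZero_corrGenFun (c s t : ℝ) :
    taylorAtZero (corrGenFun c s t) = (mk fun n => (expSqCoeff c n : ℂ)) *
      (mk fun n => (kernelSum n (hermiteFun · s) (hermiteFun · t) : ℂ)) := by
  set E : PowerSeries ℂ := mk fun n => (expSqCoeff c n : ℂ) with hE
  set K : PowerSeries ℂ := mk fun n => (kernelSum n (hermiteFun · s) (hermiteFun · t) : ℂ) with hK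
  have hA := mehler_ode s t
  set A : PowerSeries ℂ := mk fun n => ((hermiteFun n s * hermiteFun n t / n.factorial : ℝ) : ℂ)
  have hKA : (1 - X) * K = A := by
    ext n
    cases n with
    | zero => simp [A, K, kernelSum, sub_mul]
    | succ n =>
      rw [sub_mul, one_mul, map_sub, coeff_succ_X_mul]
      simp only [A, K, coeff_mk, kernelSum_succ]
      push_cast; ring
  have hEd : derivative ℂ E = 2 * C (c : ℂ) * X * E := derivative_expSqCoeff c
  have hdA : derivative ℂ A = (1 - X) * derivative ℂ K - K := by
    rw [← hKA, Derivation.leibniz]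
    simp; ring
  -- The coefficients of the equation are polynomials, so that they can be read both as analytic
  -- functions and as power series.
  let pq : Polynomial ℂ := (1 - Polynomial.X ^ 2) ^ 2
  let pr : Polynomial ℂ := 2 * Polynomial.C (c : ℂ) * Polynomial.X * (1 - Polynomial.X ^ 2) ^ 2 +
    (Polynomial.C (t : ℂ) - Polynomial.C (s : ℂ) * Polynomial.X) *
      (Polynomial.C (s : ℂ) - Polynomial.C (t : ℂ) * Polynomial.X) +
    Polynomial.X * (1 - Polynomial.X ^ 2) + (1 - Polynomial.X) * (1 + Polynomial.X) ^ 2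
  have hpq : (pq : PowerSeries ℂ) = (1 - X ^ 2) ^ 2 := by simp [pq]
  have hpr : (pr : PowerSeries ℂ) = 2 * C (c : ℂ) * X * (1 - X ^ 2) ^ 2 +
      (C (t : ℂ) - C (s : ℂ) * X) * (C (s : ℂ) - C (t : ℂ) * X) +
      X * (1 - X ^ 2) + (1 - X) * (1 + X) ^ 2 := by
    have : ((2 : Polynomial ℂ) : PowerSeries ℂ) = 2 := map_ofNat Polynomial.coeToPowerSeries.ringHom 2
    simp [pr, this]
  refine powerSeries_eq_of_linear_ode (q := (pq : PowerSeries ℂ)) (r := (pr : PowerSeries ℂ))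
    ?_ ?_ ?_ ?_
  · simp [hpq]
  · have han := analyticAt_corrGenFun c s t
    rw [← taylorAtZero_deriv, ← taylorAtZero_polynomial, ← taylorAtZero_polynomial,
      ← taylorAtZero_mul _ han.deriv, ← taylorAtZero_mul _ han]
    · refine taylorAtZero_congr ?_
      filter_upwards [Metric.ball_mem_nhds (0 : ℂ) one_pos] with z hz
      have hz' : ‖z‖ < 1 := by simpa using hz
      have hm0 := Complex.slitPlane_ne_zero (one_sub_mem_slitPlane hz')
      have hp0 := Complex.slitPlane_ne_zero (one_add_mem_slitPlane hz')
      rw [(hasDerivAt_corrGenFun c s t hz').deriv]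
      simp only [pq, pr, Polynomial.eval_add, Polynomial.eval_sub, Polynomial.eval_mul,
        Polynomial.eval_pow, Polynomial.eval_one, Polynomial.eval_X, Polynomial.eval_C,
        Polynomial.eval_ofNat]
      rw [← mul_assoc]
      congr 1
      field_simp
      ring
    · exact pr.differentiable.analyticAt 0
    · exact pq.differentiable.analyticAt 0
  · have hne : (1 - X : PowerSeries ℂ) ≠ 0 := by
      intro h
      have := congrArg (coeff 0) h
      simp at this
    rw [hpq, hpr]
    refine mul_left_cancel₀ hne ?_
    rw [hdA, ← hKA] at hA
    rw [Derivation.leibniz, hEd, smul_eq_mul, smul_eq_mul]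
    linear_combination E * hA
  · rw [map_mul]
    simp only [← coeff_zero_eq_constantCoeff_apply, taylorAtZero, E, K, coeff_mk]
    simp [corrGenFun, expSqCoeff, kernelSum, hermiteFun]

/-- The correlation kernel as a Cauchy coefficient. -/
lemma corrKernel_eq_iteratedDeriv (c s t : ℝ) (N : ℕ) :
    (corrKernel c N (hermiteFun · s) (hermiteFun · t) : ℂ) =
      iteratedDeriv N (corrGenFun c s t) 0 := by
  have h := congrArg (PowerSeries.coeff N) (taylorAtZero_corrGenFun c s t)
  rw [PowerSeries.coeff_mul, taylorAtZero, PowerSeries.coeff_mk] at h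
  simp only [PowerSeries.coeff_mk] at h
  have h1 : (N.factorial : ℂ) ≠ 0 := by exact_mod_cast N.factorial_ne_zero
  rw [corrKernel]
  push_cast
  rw [← h]
  field_simp

end GeneratingFunction

/-! ### Laplace transform of powers and Hankel's integral -/

section LaplaceInversion

lemma integrableOn_rpow_mul_exp_neg_mul {s b : ℝ} (hs : -1 < s) (hb : 0 < b) :
    IntegrableOn (fun t : ℝ => t ^ s * Real.exp (-b * t)) (Set.Ioi 0) := by
  simpa using integrableOn_rpow_mul_exp_neg_mul_rpow (p := 1) hs one_pos hb

lemma norm_rpow_mul_cexp {s t : ℝ} (ht : 0 < t) (r : ℂ) :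
    ‖((t ^ s : ℝ) : ℂ) * Complex.exp (-(r * t))‖ = t ^ s * Real.exp (-r.re * t) := by
  rw [norm_mul, Complex.norm_real, Complex.norm_exp, Real.norm_of_nonneg (by positivity)]
  simp

lemma measurable_rpow_mul_cexp (s : ℝ) (r : ℂ) :
    Measurable fun t : ℝ => ((t ^ s : ℝ) : ℂ) * Complex.exp (-(r * t)) := by
  fun_prop

lemma integrableOn_rpow_mul_cexp {s : ℝ} (hs : -1 < s) {r : ℂ} (hr : 0 < r.re) :
    IntegrableOn (fun t : ℝ => ((t ^ s : ℝ) : ℂ) * Complex.exp (-(r * t))) (Set.Ioi 0) := by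
  refine (integrableOn_rpow_mul_exp_neg_mul hs hr).mono'
    (measurable_rpow_mul_cexp s r).aestronglyMeasurable ?_
  refine (ae_restrict_iff' measurableSet_Ioi).mpr (ae_of_all _ fun t ht => ?_)
  rw [norm_rpow_mul_cexp ht]

/-- Differentiation under the integral sign: on the disc of radius `r.re / 2` around `r` the real
part stays above `r.re / 2`, which gives one exponentially decaying majorant. -/
lemma differentiableOn_integral_rpow_mul_cexp {s : ℝ} (hs : -1 < s) :
    DifferentiableOn ℂ (fun r : ℂ => ∫ t in Set.Ioi (0 : ℝ), ((t ^ s : ℝ) : ℂ) *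
      Complex.exp (-(r * t))) {r | 0 < r.re} := by
  intro r hr
  have hr' : 0 < r.re := hr
  have h := hasDerivAt_integral_of_dominated_loc_of_deriv_le
    (μ := volume.restrict (Set.Ioi (0 : ℝ)))
    (F := fun (r : ℂ) (t : ℝ) => ((t ^ s : ℝ) : ℂ) * Complex.exp (-(r * t)))
    (F' := fun (r : ℂ) (t : ℝ) => ((t ^ s : ℝ) : ℂ) * (Complex.exp (-(r * t)) * (-t)))
    (x₀ := r) (s := Metric.ball r (r.re / 2)) (bound := fun t => t ^ (s + 1) *
      Real.exp (-(r.re / 2) * t)) (Metric.ball_mem_nhds r (by positivity))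
    (Eventually.of_forall fun r => (measurable_rpow_mul_cexp s r).aestronglyMeasurable)
    (integrableOn_rpow_mul_cexp hs hr') (by fun_prop) ?_
    (integrableOn_rpow_mul_exp_neg_mul (by linarith) (by positivity)) ?_
  · exact h.2.differentiableAt.differentiableWithinAt
  · refine (ae_restrict_iff' measurableSet_Ioi).mpr (ae_of_all _ fun t ht x hx => ?_)
    have ht' : (0 : ℝ) < t := ht
    rw [← mul_assoc, norm_mul, norm_rpow_mul_cexp ht', norm_neg, Complex.norm_real,
      Real.norm_of_nonneg ht'.le, Real.rpow_add_one ht'.ne']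
    have hx2 : r.re / 2 ≤ x.re := by
      have h1 : ‖x - r‖ < r.re / 2 := by simpa [dist_eq_norm] using hx
      have h2 := (abs_le.mp (Complex.abs_re_le_norm (x - r))).1
      simp only [Complex.sub_re] at h2
      linarith
    have h3 : Real.exp (-x.re * t) ≤ Real.exp (-(r.re / 2) * t) := by
      apply Real.exp_le_exp.mpr; nlinarith
    calc t ^ s * Real.exp (-x.re * t) * t = t ^ s * t * Real.exp (-x.re * t) := by ring
      _ ≤ _ := by gcongr
  · refine ae_of_all _ fun t x _ => ?_
    have h1 : HasDerivAt (fun x : ℂ => -(x * t)) (-t) x := by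
      simpa using ((hasDerivAt_id' x).mul_const (t : ℂ)).fun_neg
    exact (h1.cexp.const_mul _)

/-- The Laplace transform of a power, for complex arguments. -/
lemma integral_rpow_mul_cexp {s : ℝ} (hs : 0 < s) {r : ℂ} (hr : 0 < r.re) :
    ∫ t in Set.Ioi (0 : ℝ), ((t ^ (s - 1) : ℝ) : ℂ) * Complex.exp (-(r * t)) =
      r ^ (-s : ℂ) * Real.Gamma s := by
  have hopen : IsOpen {r : ℂ | 0 < r.re} := isOpen_lt continuous_const Complex.continuous_re
  have hpre : IsPreconnected {r : ℂ | 0 < r.re} := (convex_halfSpace_re_gt 0).isPreconnected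
  have hF := (differentiableOn_integral_rpow_mul_cexp (s := s - 1) (by linarith)).analyticOnNhd hopen
  have hG : DifferentiableOn ℂ (fun r : ℂ => r ^ (-s : ℂ) * Real.Gamma s) {r | 0 < r.re} := by
    intro r hr
    exact (((hasDerivAt_id' r).cpow_const (Or.inl hr)).mul_const _).differentiableAt
      |>.differentiableWithinAt
  have hG' := hG.analyticOnNhd hopen
  -- Identity theorem: on the positive reals the formula is the Gamma integral, and the points 1 +
  -- 1/(n+1) accumulate at 1.
  refine hF.eqOn_of_preconnected_of_frequently_eq hG' hpre (z₀ := 1) (by simp) ?_ hr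
  have hreal : ∀ x : ℝ, 0 < x → (∫ t in Set.Ioi (0 : ℝ), ((t ^ (s - 1) : ℝ) : ℂ) *
      Complex.exp (-((x : ℂ) * t))) = (x : ℂ) ^ (-s : ℂ) * Real.Gamma s := by
    intro x hx
    have h := Real.integral_rpow_mul_exp_neg_mul_Ioi hs hx
    have h2 := congrArg (fun y : ℝ => (y : ℂ)) h
    simp only [← integral_complex_ofReal] at h2
    rw [one_div, Real.inv_rpow hx.le, ← Real.rpow_neg hx.le] at h2
    push_cast at h2
    rw [Complex.ofReal_cpow hx.le] at h2
    push_cast at h2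
    rw [← h2]
  have htend : Tendsto (fun n : ℕ => ((1 + 1 / ((n : ℝ) + 1) : ℝ) : ℂ)) atTop (𝓝[≠] 1) := by
    refine tendsto_nhdsWithin_iff.mpr ⟨?_, Eventually.of_forall fun n => ?_⟩
    · have h1 : Tendsto (fun n : ℕ => (1 + 1 / ((n : ℝ) + 1) : ℝ)) atTop (𝓝 (1 + 0)) :=
        tendsto_const_nhds.add tendsto_one_div_add_atTop_nhds_zero_nat
      have h2 := (Complex.continuous_ofReal.tendsto _).comp h1
      simpa [Function.comp_def] using h2
    · have : (0 : ℝ) < 1 / ((n : ℝ) + 1) := by positivity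
      simp only [Set.mem_compl_iff, Set.mem_singleton_iff]
      intro h
      have := Complex.ofReal_eq_one.mp h
      linarith
  exact htend.frequently (Frequently.of_forall fun n => hreal _ (by positivity))

lemma one_add_mul_I_mem_slitPlane (u : ℝ) : 1 + u * Complex.I ∈ Complex.slitPlane :=
  Or.inl (by simp)

lemma norm_one_add_mul_I (u : ℝ) : ‖1 + u * Complex.I‖ = (1 + u ^ 2) ^ (1 / 2 : ℝ) := by
  rw [← Real.sqrt_eq_rpow, Complex.norm_eq_sqrt_sq_add_sq]
  simp

lemma continuous_one_add_mul_I_cpow (s : ℂ) :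
    Continuous fun u : ℝ => (1 + u * Complex.I) ^ s :=
  Continuous.cpow (by fun_prop) continuous_const one_add_mul_I_mem_slitPlane

lemma integrable_one_add_mul_I_cpow {s : ℝ} (hs : 1 < s) :
    Integrable fun u : ℝ => (1 + u * Complex.I) ^ (-s : ℂ) := by
  have h := integrable_rpow_neg_one_add_norm_sq (E := ℝ) (μ := volume) (r := s) (by simpa using hs)
  refine h.mono' (continuous_one_add_mul_I_cpow _).aestronglyMeasurable (ae_of_all _ fun u => ?_)
  have : ((-s : ℂ)) = ((-s : ℝ) : ℂ) := by push_cast; rfl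
  rw [this, Complex.norm_cpow_real, norm_one_add_mul_I, ← Real.rpow_mul (by positivity),
    Real.norm_eq_abs, sq_abs]
  apply le_of_eq; congr 1; ring

open FourierTransform in
/-- Hankel's integral for the reciprocal Gamma function. -/
lemma integral_cexp_mul_one_add_mul_I_cpow {s a : ℝ} (hs : 1 < s) (ha : 0 < a) :
    ∫ u : ℝ, Complex.exp (a * (1 + u * Complex.I)) * (1 + u * Complex.I) ^ (-s : ℂ) =
      ((2 * Real.pi * (a ^ (s - 1) / Real.Gamma s) : ℝ) : ℂ) := by
  -- The Fourier transform of t^(s-1) e^(-t) on the half-line is Γ(s) (1 + 2πiv)^(-s). It is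
  -- integrable because s > 1, so Fourier inversion applies at the continuity point `a`.
  set f : ℝ → ℂ := (Set.Ioi (0 : ℝ)).indicator
    (fun t => ((t ^ (s - 1) : ℝ) : ℂ) * Complex.exp (-(1 * t))) with hf
  have hfi : Integrable f := by
    rw [hf, integrable_indicator_iff measurableSet_Ioi]
    exact integrableOn_rpow_mul_cexp (by linarith) (by simp)
  have hft : ∀ v : ℝ, 𝓕 f v = (1 + ((2 * Real.pi * v : ℝ) : ℂ) * Complex.I) ^ (-s : ℂ) *
      Real.Gamma s := by
    intro v
    rw [Real.fourier_real_eq_integral_exp_smul, ← integral_rpow_mul_cexp (by linarith) (by simp),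
      ← integral_indicator measurableSet_Ioi]
    congr 1
    ext t
    by_cases ht : t ∈ Set.Ioi (0 : ℝ)
    · simp only [hf, Set.indicator_of_mem ht, smul_eq_mul]
      rw [mul_left_comm, ← Complex.exp_add]
      congr 2
      push_cast; ring
    · simp [hf, Set.indicator_of_notMem ht]
  have hGpos : 0 < Real.Gamma s := Real.Gamma_pos_of_pos (by linarith)
  have hfti : Integrable (𝓕 f) := by
    have h1 := ((integrable_one_add_mul_I_cpow hs).comp_mul_left'
      (R := 2 * Real.pi) (by positivity)).mul_const (Real.Gamma s : ℂ)
    refine h1.congr (ae_of_all _ fun v => ?_)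
    simp only [hft]
  have hcont : ContinuousAt f a := by
    have h1 : ContinuousAt (fun t : ℝ => ((t ^ (s - 1) : ℝ) : ℂ) * Complex.exp (-(1 * t))) a := by
      have : ContinuousAt (fun t : ℝ => t ^ (s - 1)) a :=
        Real.continuousAt_rpow_const _ _ (Or.inl ha.ne')
      fun_prop
    refine h1.congr ?_
    filter_upwards [Ioi_mem_nhds ha] with t ht
    simp [hf, Set.indicator_of_mem ht]
  have hinv := hfi.fourierInv_fourier_eq hfti hcont
  rw [Real.fourierInv_eq'] at hinv
  simp only [hft, smul_eq_mul] at hinv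
  have hfa : f a = ((a ^ (s - 1) * Real.exp (-a) : ℝ) : ℂ) := by
    simp only [hf, Set.indicator_of_mem (show a ∈ Set.Ioi (0 : ℝ) from ha)]
    push_cast; simp
  rw [hfa] at hinv
  set g : ℝ → ℂ := fun u => Complex.exp (a * (1 + u * Complex.I)) *
    (1 + u * Complex.I) ^ (-s : ℂ) with hg
  have hsub : ∫ v : ℝ, g (2 * Real.pi * v) = (((2 * Real.pi)⁻¹ : ℝ) : ℂ) * ∫ u, g u := by
    rw [Measure.integral_comp_mul_left, abs_of_pos (by positivity), Complex.real_smul]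
  have heq : ∀ v : ℝ, Complex.exp (((2 * Real.pi * inner ℝ v a : ℝ) : ℂ) * Complex.I) *
      ((1 + ((2 * Real.pi * v : ℝ) : ℂ) * Complex.I) ^ (-s : ℂ) * Real.Gamma s) =
      ((Real.exp (-a) * Real.Gamma s : ℝ) : ℂ) * g (2 * Real.pi * v) := by
    intro v
    have : Complex.exp (a * (1 + ((2 * Real.pi * v : ℝ) : ℂ) * Complex.I)) =
        Complex.exp a * Complex.exp (((2 * Real.pi * inner ℝ v a : ℝ) : ℂ) * Complex.I) := by
      rw [← Complex.exp_add]; congr 1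
      simp only [Real.inner_apply]; push_cast; ring
    have h2 : Complex.exp (-a) * Complex.exp a = 1 := by rw [← Complex.exp_add]; simp
    simp only [hg]
    rw [this]
    push_cast
    linear_combination (-(Complex.exp ((2 * Real.pi * inner ℝ v a : ℂ) * Complex.I) *
      (1 + (2 * Real.pi * v : ℂ) * Complex.I) ^ (-s : ℂ) * Real.Gamma s)) * h2
  rw [integral_congr_ae (ae_of_all _ heq), integral_const_mul, hsub] at hinv
  have hpi : (Real.pi : ℂ) ≠ 0 := by exact_mod_cast Real.pi_ne_zero
  have hG0 : (Real.Gamma s : ℂ) ≠ 0 := by exact_mod_cast hGpos.ne'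
  have he : Complex.exp (-a) ≠ 0 := Complex.exp_ne_zero _
  push_cast at hinv ⊢
  field_simp at hinv ⊢
  linear_combination hinv

end LaplaceInversion

/-! ### The inverse Laplace transform that produces the sine kernel -/

section LaplaceInversionSeries

lemma hasSum_sinc (y : ℝ) :
    HasSum (fun k : ℕ => (-1) ^ k * y ^ (2 * k) / ((2 * k + 1).factorial : ℝ)) (Real.sinc y) := by
  rcases eq_or_ne y 0 with rfl | hy
  · rw [Real.sinc_zero]
    convert hasSum_ite_eq (0 : ℕ) (1 : ℝ) using 2 with k
    cases k <;> simp
  · rw [Real.sinc_of_ne_zero hy]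
    have h := (Real.hasSum_sin y).div_const y
    refine h.congr_fun fun k => ?_
    rw [pow_succ]
    field_simp

/-- In this form the Gamma factors from Hankel's integral supply the (2k + 1)! of the sinc series.
-/
lemma Gamma_nat_add_three_half (k : ℕ) :
    Real.Gamma (k + 3 / 2) =
      (2 * k + 1).factorial * √Real.pi / (2 ^ (2 * k + 1) * k.factorial) := by
  have h : (k + 3 / 2 : ℝ) = k + 1 + 1 / 2 := by ring
  have h2 : ((2 * k + 1).factorial : ℝ) =
      (2 * k + 1 : ℕ).doubleFactorial * (2 ^ k * k.factorial) := by
    rw [Nat.factorial_eq_mul_doubleFactorial, Nat.doubleFactorial_two_mul]; push_cast; ring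
  rw [h, Real.Gamma_nat_add_one_add_half, h2]
  have : (k.factorial : ℝ) ≠ 0 := by positivity
  field_simp
  ring

lemma one_le_norm_one_add_mul_I (u : ℝ) : 1 ≤ ‖1 + u * Complex.I‖ := by
  have := Complex.abs_re_le_norm (1 + u * Complex.I)
  simpa using this

/-- The inverse Laplace transform of `w ↦ w ^ (-3 / 2) * exp (-c ^ 2 / w)`. -/
lemma integral_cexp_mul_cpow_mul_cexp_inv {a : ℝ} (ha : 0 < a) (c : ℝ) :
    ∫ u : ℝ, Complex.exp (a * (1 + u * Complex.I)) * (1 + u * Complex.I) ^ (-(3 / 2) : ℂ) *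
        Complex.exp (-(c ^ 2 / (1 + u * Complex.I))) =
      ((4 * √Real.pi * √a * Real.sinc (2 * c * √a) : ℝ) : ℂ) := by
  -- Expand exp(-c²/w), w = 1 + iu, in powers of 1/w and integrate termwise; the k-th term is
  -- Hankel's integral with exponent k + 3/2.
  set F : ℕ → ℝ → ℂ := fun k u => (((-(c ^ 2)) ^ k / k.factorial : ℝ) : ℂ) *
    (Complex.exp (a * (1 + u * Complex.I)) *
      (1 + u * Complex.I) ^ (-((k + 3 / 2 : ℝ) : ℂ))) with hF
  have hs : ∀ k : ℕ, (1 : ℝ) < k + 3 / 2 := fun k => by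
    have : (0 : ℝ) ≤ k := k.cast_nonneg
    linarith
  have hbd : Integrable fun u : ℝ => Real.exp a * ‖(1 + u * Complex.I) ^ (-((3 / 2 : ℝ) : ℂ))‖ :=
    (integrable_one_add_mul_I_cpow (s := 3 / 2) (by norm_num)).norm.const_mul _
  have hnorm : ∀ k u, ‖F k u‖ ≤ ((c ^ 2) ^ k / k.factorial) *
      (Real.exp a * ‖(1 + u * Complex.I) ^ (-((3 / 2 : ℝ) : ℂ))‖) := by
    intro k u
    simp only [hF, norm_mul, Complex.norm_real, Complex.norm_exp, norm_div, norm_pow, norm_neg]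
    rw [← Complex.ofReal_neg, ← Complex.ofReal_neg, Complex.norm_cpow_real, Complex.norm_cpow_real]
    have h1 : ((a : ℂ) * (1 + u * Complex.I)).re = a := by simp
    rw [h1]
    -- Since |w| ≥ 1, the extra powers of 1/w only help, and all terms share the integrable majorant
    -- with exponent 3/2.
    have h2 : ‖1 + (u : ℂ) * Complex.I‖ ^ (-((k : ℝ) + 3 / 2)) ≤
        ‖1 + (u : ℂ) * Complex.I‖ ^ (-(3 / 2 : ℝ)) :=
      Real.rpow_le_rpow_of_exponent_le (one_le_norm_one_add_mul_I u) (by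
        have : (0 : ℝ) ≤ k := k.cast_nonneg
        linarith)
    simp only [Real.norm_eq_abs, Nat.abs_cast, sq_abs]
    gcongr
  have hFi : ∀ k, Integrable (F k) := fun k => by
    refine (hbd.const_mul ((c ^ 2) ^ k / k.factorial)).mono' ?_ (ae_of_all _ (hnorm k))
    refine Continuous.aestronglyMeasurable ?_
    exact continuous_const.mul ((by fun_prop : Continuous fun u : ℝ =>
      Complex.exp (a * (1 + u * Complex.I))).mul (continuous_one_add_mul_I_cpow _))
  have hFs : Summable fun k => ∫ u, ‖F k u‖ := by
    refine Summable.of_nonneg_of_le (fun k => integral_nonneg fun u => norm_nonneg _)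
      (fun k => (integral_mono (hFi k).norm (hbd.const_mul _) (hnorm k)).trans_eq
        (integral_const_mul _ _)) ?_
    exact (Real.summable_pow_div_factorial (c ^ 2)).mul_right _
  have h1 := hasSum_integral_of_summable_integral_norm hFi hFs
  have h2 : ∀ u : ℝ, ∑' k, F k u = Complex.exp (a * (1 + u * Complex.I)) *
      (1 + u * Complex.I) ^ (-(3 / 2) : ℂ) * Complex.exp (-(c ^ 2 / (1 + u * Complex.I))) := by
    intro u
    have hw : (1 + u * Complex.I) ≠ 0 :=
      Complex.slitPlane_ne_zero (one_add_mul_I_mem_slitPlane u)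
    have h3 := NormedSpace.expSeries_div_hasSum_exp (-(c ^ 2 / (1 + u * Complex.I)) : ℂ)
    rw [← Complex.exp_eq_exp_ℂ] at h3
    have h4 := h3.mul_left (Complex.exp (a * (1 + u * Complex.I)) *
      (1 + u * Complex.I) ^ (-(3 / 2) : ℂ))
    rw [← h4.tsum_eq]
    congr 1
    ext k
    simp only [hF]
    have h5 : (-((k + 3 / 2 : ℝ) : ℂ)) = -(3 / 2) - k := by push_cast; ring
    rw [h5, Complex.cpow_sub _ _ hw, Complex.cpow_natCast, neg_pow (c ^ 2 / _ : ℂ), div_pow]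
    push_cast
    rw [neg_pow ((c : ℂ) ^ 2)]
    ring
  have h3 : HasSum (fun k => ∫ u, F k u)
      ((4 * √Real.pi * √a * Real.sinc (2 * c * √a) : ℝ) : ℂ) := by
    have h4 : ∀ k : ℕ, ∫ u, F k u = ((4 * √Real.pi * √a * ((-1) ^ k * (2 * c * √a) ^ (2 * k) /
        ((2 * k + 1).factorial : ℝ)) : ℝ) : ℂ) := by
      intro k
      simp only [hF]
      rw [integral_const_mul, integral_cexp_mul_one_add_mul_I_cpow (hs k) ha, ← Complex.ofReal_mul]
      congr 1
      have h5 : (k + 3 / 2 - 1 : ℝ) = k + 1 / 2 := by ring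
      have h6 : ((2 * k + 1).factorial : ℝ) ≠ 0 := by positivity
      have h7 : (k.factorial : ℝ) ≠ 0 := by positivity
      have h8 : √Real.pi ≠ 0 := by positivity
      rw [Gamma_nat_add_three_half, h5, Real.rpow_add ha, Real.rpow_natCast, ← Real.sqrt_eq_rpow,
        mul_pow, mul_pow, pow_mul √a, Real.sq_sqrt ha.le, neg_pow, pow_mul c, pow_mul 2,
        show (2 : ℝ) ^ (2 * k + 1) = (2 ^ 2) ^ k * 2 by rw [pow_succ, pow_mul]]
      have h9 : Real.pi = √Real.pi * √Real.pi := (Real.mul_self_sqrt Real.pi_pos.le).symm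
      nth_rewrite 1 [h9]
      field_simp
      ring
    simp only [h4]
    exact Complex.hasSum_ofReal.mpr ((hasSum_sinc _).mul_left _)
  have h4 := h1.unique h3
  rw [← h4]
  exact integral_congr_ae (ae_of_all _ fun u => (h2 u).symm)

end LaplaceInversionSeries

/-! ### Cauchy's formula and estimates on the circle of integration -/

section Asymptotics

lemma norm_cexp_neg_lt_one {h : ℝ} (hh : 0 < h) (φ : ℝ) :
    ‖Complex.exp (-(h + φ * Complex.I))‖ < 1 := by
  rw [Complex.norm_exp]
  simpa using hh

/-- Cauchy's formula for Taylor coefficients on the circle of radius `exp (-h)`. -/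
lemma iteratedDeriv_eq_intervalIntegral {f : ℂ → ℂ} (hf : DifferentiableOn ℂ f (Metric.ball 0 1))
    (N : ℕ) {h : ℝ} (hh : 0 < h) :
    iteratedDeriv N f 0 = N.factorial / (2 * Real.pi) *
      ∫ φ in (-(Real.pi / 2))..(3 * Real.pi / 2), f (Complex.exp (-(h + φ * Complex.I))) *
        Complex.exp (N * (h + φ * Complex.I)) := by
  set r := Real.exp (-h) with hr
  have hr0 : 0 < r := Real.exp_pos _
  have hr1 : r < 1 := by rw [hr, Real.exp_lt_one_iff]; linarith
  have hcauchy := (hf.mono (Metric.closedBall_subset_ball hr1)).circleIntegral_one_div_sub_center_pow_smul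
    hr0 N
  rw [circleIntegral] at hcauchy
  set g : ℝ → ℂ := fun θ => f (circleMap 0 r θ) * (circleMap 0 r θ)⁻¹ ^ N with hg
  have hg1 : ∀ θ : ℝ, deriv (circleMap 0 r) θ • ((1 / (circleMap 0 r θ - 0) ^ (N + 1)) •
      f (circleMap 0 r θ)) = Complex.I * g θ := by
    intro θ
    have hne : circleMap 0 r θ ≠ 0 := circleMap_ne_center hr0.ne'
    rw [deriv_circleMap]
    simp only [hg, smul_eq_mul, sub_zero, pow_succ, inv_pow]
    field_simp
  simp only [hg1] at hcauchy
  rw [intervalIntegral.integral_const_mul] at hcauchy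
  have hper : Function.Periodic g (2 * Real.pi) := by
    intro θ
    simp only [hg, periodic_circleMap (0 : ℂ) r θ]
  -- The period is moved so that, after the reflection θ = -φ, the angles 0 and π of the two
  -- singularities are the midpoints of the arcs |φ| ≤ π/2 and |φ - π| ≤ π/2.
  have hshift : ∫ θ in (0 : ℝ)..2 * Real.pi, g θ =
      ∫ θ in (-(3 * Real.pi / 2))..(Real.pi / 2), g θ := by
    have := hper.intervalIntegral_add_eq 0 (-(3 * Real.pi / 2))
    rw [zero_add] at this
    rw [this]; congr 1; ring
  have hneg : ∫ θ in (-(3 * Real.pi / 2))..(Real.pi / 2), g θ =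
      ∫ φ in (-(Real.pi / 2))..(3 * Real.pi / 2), g (-φ) := by
    rw [intervalIntegral.integral_comp_neg, neg_neg]
  have hgφ : ∀ φ : ℝ, g (-φ) = f (Complex.exp (-(h + φ * Complex.I))) *
        Complex.exp (N * (h + φ * Complex.I)) := by
    intro φ
    have : circleMap 0 r (-φ) = Complex.exp (-(h + φ * Complex.I)) := by
      rw [circleMap_zero, hr, Complex.ofReal_exp, ← Complex.exp_add]
      congr 1; push_cast; ring
    simp only [hg, this]
    rw [← Complex.exp_neg, neg_neg, Complex.exp_nat_mul]
  rw [hshift, hneg] at hcauchy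
  simp only [hgφ, smul_eq_mul] at hcauchy
  have hI : Complex.I ≠ 0 := Complex.I_ne_zero
  have hpi : (Real.pi : ℂ) ≠ 0 := by exact_mod_cast Real.pi_ne_zero
  have hN : (N.factorial : ℂ) ≠ 0 := by exact_mod_cast N.factorial_ne_zero
  have h2 : Complex.I * (∫ φ in (-(Real.pi / 2))..(3 * Real.pi / 2),
      f (Complex.exp (-(h + φ * Complex.I))) * Complex.exp (N * (h + φ * Complex.I))) =
      Complex.I * (2 * Real.pi / N.factorial * iteratedDeriv N f 0) := by
    rw [hcauchy]; ring
  rw [mul_left_cancel₀ hI h2]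
  field_simp

/-- The Möbius map z / (1 + z) sends the unit disc to the half-plane Re < 1/2. -/
lemma re_div_one_add_le {z : ℂ} (hz : ‖z‖ < 1) : (z / (1 + z)).re ≤ 1 / 2 := by
  have hp0 := Complex.slitPlane_ne_zero (one_add_mem_slitPlane hz)
  have h1 : z / (1 + z) = 1 - (1 + z)⁻¹ := by field_simp; ring
  have hsq : 0 < Complex.normSq (1 + z) := Complex.normSq_pos.mpr hp0
  have h2 : z.re ^ 2 + z.im ^ 2 < 1 := by
    have := Complex.sq_norm z
    rw [Complex.normSq_apply] at this
    nlinarith [norm_nonneg z]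
  rw [h1, Complex.sub_re, Complex.inv_re, Complex.one_re, sub_le_comm, le_div_iff₀ hsq,
    Complex.normSq_apply]
  simp only [Complex.add_re, Complex.add_im, Complex.one_re, Complex.one_im]
  nlinarith

/-- The half-plane bound is applied at z and at -z, since -z / (1 - z) is the same map at -z. The
exponential is thereby bounded independently of z, so only the two algebraic singularities remain to
be controlled. -/
lemma norm_corrGenFun_le (c σ δ : ℝ) {z : ℂ} (hz : ‖z‖ < 1) :
    ‖corrGenFun c ((σ + δ : ℝ) : ℂ) ((σ - δ : ℝ) : ℂ) z‖ ≤
      Real.exp (|c| + σ ^ 2 / 2 + δ ^ 2 / 2) * ‖1 - z‖ ^ (-(3 / 2) : ℝ) *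
        ‖1 + z‖ ^ (-(1 / 2) : ℝ) := by
  have e1 : (-(3 / 2) : ℂ) = ((-(3 / 2) : ℝ) : ℂ) := by push_cast; rfl
  have e2 : (-(1 / 2) : ℂ) = ((-(1 / 2) : ℝ) : ℂ) := by push_cast; rfl
  rw [corrGenFun, norm_mul, norm_mul, e1, e2, Complex.norm_cpow_real, Complex.norm_cpow_real,
    Complex.norm_exp]
  gcongr
  have s1 : ((((σ + δ : ℝ) : ℂ) + ((σ - δ : ℝ) : ℂ)) / 2) ^ 2 = ((σ ^ 2 : ℝ) : ℂ) := by
    push_cast; ring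
  have s2 : ((((σ + δ : ℝ) : ℂ) - ((σ - δ : ℝ) : ℂ)) / 2) ^ 2 = ((δ ^ 2 : ℝ) : ℂ) := by
    push_cast; ring
  rw [s1, s2, Complex.sub_re, Complex.add_re, Complex.re_ofReal_mul (σ ^ 2),
    Complex.re_ofReal_mul (δ ^ 2)]
  have h1 : ((c : ℂ) * z ^ 2).re ≤ |c| := by
    refine (Complex.re_le_norm _).trans ?_
    rw [norm_mul, norm_pow, Complex.norm_real, Real.norm_eq_abs]
    have : ‖z‖ ^ 2 ≤ 1 := pow_le_one₀ (norm_nonneg _) hz.le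
    nlinarith [abs_nonneg c]
  have h2 := re_div_one_add_le hz
  have h3 := re_div_one_add_le (z := -z) (by simpa using hz)
  have h4 : -z / (1 + -z) = -(z / (1 - z)) := by rw [← sub_eq_add_neg, neg_div]
  rw [h4, Complex.neg_re] at h3
  nlinarith [sq_nonneg σ, sq_nonneg δ]

/-- With r = e^(-h), the square of the right side is (1 - r)² + 2r(1 - cos φ). The bounds 1 - r ≥
h/2, r ≥ 1/3 and 1 - cos φ ≥ φ²/5 make it at least h²/4 + 2φ²/15, which exceeds (h² + φ²)/9. -/
lemma norm_one_sub_cexp_ge {h φ : ℝ} (hh : 0 < h) (h1 : h ≤ 1) (hφ : |φ| ≤ Real.pi) :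
    ‖(h : ℂ) + φ * Complex.I‖ / 3 ≤ ‖1 - Complex.exp (-(h + φ * Complex.I))‖ := by
  have hsq : (‖(h : ℂ) + φ * Complex.I‖ / 3) ^ 2 ≤
      ‖1 - Complex.exp (-(h + φ * Complex.I))‖ ^ 2 := by
    rw [div_pow, Complex.sq_norm, Complex.sq_norm, Complex.normSq_apply, Complex.normSq_apply]
    have hre : (Complex.exp (-(h + φ * Complex.I))).re = Real.exp (-h) * Real.cos φ := by
      rw [Complex.exp_re]; simp
    have him : (Complex.exp (-(h + φ * Complex.I))).im = -(Real.exp (-h) * Real.sin φ) := by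
      rw [Complex.exp_im]; simp
    simp only [Complex.sub_re, Complex.sub_im, Complex.one_re, Complex.one_im, hre, him]
    have hc : Real.cos φ ≤ 1 - φ ^ 2 / 5 := by
      have hpi : Real.pi ^ 2 ≤ 10 := by nlinarith [Real.pi_pos, Real.pi_lt_d2]
      have h5 : 1 / 5 ≤ 2 / Real.pi ^ 2 := by
        rw [div_le_div_iff₀ (by norm_num) (by positivity)]; linarith
      have h6 := Real.cos_le_one_sub_mul_cos_sq hφ
      nlinarith [mul_le_mul_of_nonneg_right h5 (sq_nonneg φ)]
    set r := Real.exp (-h) with hr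
    have hr3 : 1 / 3 ≤ r := by
      have h2 : Real.exp (-1) ≤ r := Real.exp_le_exp.mpr (by linarith)
      have h3 : Real.exp 1 < 3 := Real.exp_one_lt_three
      have h4 : Real.exp (-1) * Real.exp 1 = 1 := by rw [← Real.exp_add]; simp
      nlinarith [Real.exp_pos (-1)]
    have hr2 : h / 2 ≤ 1 - r := by
      have h2 : h + 1 ≤ Real.exp h := Real.add_one_le_exp h
      have h4 : r * Real.exp h = 1 := by rw [hr, ← Real.exp_add]; simp
      have h5 : r * (h + 1) ≤ 1 := (mul_le_mul_of_nonneg_left h2 (Real.exp_pos _).le).trans h4.le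
      nlinarith
    have hsc := Real.sin_sq_add_cos_sq φ
    have key : (1 - r * Real.cos φ) ^ 2 + (r * Real.sin φ) ^ 2 =
        (1 - r) ^ 2 + 2 * r * (1 - Real.cos φ) := by
      linear_combination r ^ 2 * hsc
    have k1 : (h / 2) ^ 2 ≤ (1 - r) ^ 2 := by gcongr
    have k2 : 2 * (1 / 3) * (φ ^ 2 / 5) ≤ 2 * r * (1 - Real.cos φ) := by
      gcongr; linarith
    simp
    nlinarith [sq_nonneg φ, sq_nonneg h]
  exact (pow_le_pow_iff_left₀ (by positivity) (norm_nonneg _) two_ne_zero).mp hsq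

end Asymptotics

/-! ### The bulk scaling: uniform bound and pointwise limit of the integrand -/

section Asymptotics

lemma ofReal_mul_cpow {r : ℝ} (hr : 0 < r) {z : ℂ} (hz : z ≠ 0) (s : ℂ) :
    ((r : ℂ) * z) ^ s = (r : ℂ) ^ s * z ^ s := by
  have hr' : (r : ℂ) ≠ 0 := by exact_mod_cast hr.ne'
  rw [Complex.cpow_def_of_ne_zero (mul_ne_zero hr' hz), Complex.cpow_def_of_ne_zero hr',
    Complex.cpow_def_of_ne_zero hz, Complex.log_ofReal_mul hr hz, ← Complex.exp_add, add_mul,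
    Complex.ofReal_log hr.le]

/-- The integrand of Cauchy's formula for the correlation functions in the bulk scaling. -/
noncomputable def bulkIntegrand (c ξ p d : ℝ) (N : ℕ) (φ : ℝ) : ℂ :=
  corrGenFun c (((√N * ξ + p / √N) + d / √N : ℝ) : ℂ) (((√N * ξ + p / √N) - d / √N : ℝ) : ℂ)
      (Complex.exp (-(((N : ℝ)⁻¹ : ℝ) + φ * Complex.I))) *
    Complex.exp (N * (((N : ℝ)⁻¹ : ℝ) + φ * Complex.I))

lemma continuous_bulkIntegrand (c ξ p d : ℝ) {N : ℕ} (hN : 0 < N) :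
    Continuous (bulkIntegrand c ξ p d N) := by
  have hpos : (0 : ℝ) < (N : ℝ)⁻¹ := by positivity
  refine Continuous.mul ?_ (by fun_prop)
  refine (differentiableOn_corrGenFun _ _ _).continuousOn.comp_continuous (by fun_prop) fun φ => ?_
  simpa using norm_cexp_neg_lt_one hpos φ

/-- With σ = √N ξ + p/√N, the exponent σ²/2 equals N ξ²/2 plus a bounded remainder, and the Gaussian
prefactor removes the growing part. The radius exp(-1/N) makes the factor from z^(-N) have modulus
e, the 1 in the constant. -/
lemma norm_bulkIntegrand_le (c ξ p d : ℝ) {N : ℕ} (hN : 0 < N) (φ : ℝ) :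
    Real.exp (-(N * ξ ^ 2 / 2)) * ‖bulkIntegrand c ξ p d N φ‖ ≤
      Real.exp (|c| + |ξ * p| + p ^ 2 + d ^ 2 + 1) *
        (‖1 - Complex.exp (-(((N : ℝ)⁻¹ : ℝ) + φ * Complex.I))‖ ^ (-(3 / 2) : ℝ) *
        ‖1 + Complex.exp (-(((N : ℝ)⁻¹ : ℝ) + φ * Complex.I))‖ ^ (-(1 / 2) : ℝ)) := by
  have hN0 : (0 : ℝ) < N := by exact_mod_cast hN
  have hN1 : (1 : ℝ) ≤ N := by exact_mod_cast hN
  have hpos : (0 : ℝ) < (N : ℝ)⁻¹ := by positivity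
  have h1 := norm_corrGenFun_le c (√N * ξ + p / √N) (d / √N) (norm_cexp_neg_lt_one hpos φ)
  have h2 : ‖Complex.exp (N * (((N : ℝ)⁻¹ : ℝ) + φ * Complex.I))‖ = Real.exp 1 := by
    rw [Complex.norm_exp]
    have hne : (N : ℂ) ≠ 0 := by exact_mod_cast hN.ne'
    congr 1
    simp [mul_add, hne]
  rw [bulkIntegrand, norm_mul, h2]
  set A := ‖1 - Complex.exp (-(((N : ℝ)⁻¹ : ℝ) + φ * Complex.I))‖ ^ (-(3 / 2) : ℝ)
  set B := ‖1 + Complex.exp (-(((N : ℝ)⁻¹ : ℝ) + φ * Complex.I))‖ ^ (-(1 / 2) : ℝ)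
  have hs : √(N : ℝ) ^ 2 = N := Real.sq_sqrt hN0.le
  have hs0 : √(N : ℝ) ≠ 0 := by positivity
  have e1 : (√N * ξ + p / √N) ^ 2 = N * ξ ^ 2 + 2 * (ξ * p) + p ^ 2 / N := by
    field_simp
    rw [hs]
    ring
  have e2 : (d / √N) ^ 2 = d ^ 2 / N := by rw [div_pow, hs]
  have e3 : p ^ 2 / N ≤ p ^ 2 := div_le_self (sq_nonneg _) hN1
  have e4 : d ^ 2 / N ≤ d ^ 2 := div_le_self (sq_nonneg _) hN1
  calc _ ≤ Real.exp (-(N * ξ ^ 2 / 2)) *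
        (Real.exp (|c| + (√N * ξ + p / √N) ^ 2 / 2 + (d / √N) ^ 2 / 2) * A * B * Real.exp 1) := by
        gcongr
    _ = Real.exp (-(N * ξ ^ 2 / 2) + (|c| + (√N * ξ + p / √N) ^ 2 / 2 + (d / √N) ^ 2 / 2) + 1) *
        (A * B) := by
        rw [Real.exp_add _ 1, Real.exp_add (-(N * ξ ^ 2 / 2))]; ring
    _ ≤ _ := by
        refine mul_le_mul_of_nonneg_right (Real.exp_le_exp.mpr ?_) (mul_nonneg
          (Real.rpow_nonneg (norm_nonneg _) _) (Real.rpow_nonneg (norm_nonneg _) _))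
        rw [e1, e2]
        nlinarith [le_abs_self (ξ * p), sq_nonneg p, sq_nonneg d]

lemma tendsto_natCast_mul_one_sub_cexp (w : ℂ) :
    Tendsto (fun N : ℕ => (N : ℂ) * (1 - Complex.exp (-(w / N)))) atTop (𝓝 w) := by
  have h1 : HasDerivAt (fun t : ℝ => 1 - Complex.exp (-(t * w))) w 0 := by
    have h2 : HasDerivAt (fun t : ℝ => (t : ℂ)) 1 0 := Complex.ofRealCLM.hasDerivAt
    have := ((h2.mul_const w).fun_neg.cexp).const_sub 1
    simpa using this
  rw [hasDerivAt_iff_tendsto_slope_zero] at h1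
  have h3 : Tendsto (fun N : ℕ => (N : ℝ)⁻¹) atTop (𝓝[≠] 0) := by
    refine tendsto_nhdsWithin_iff.mpr ⟨tendsto_inv_atTop_nhds_zero_nat, ?_⟩
    filter_upwards [eventually_gt_atTop 0] with N hN
    have : (N : ℝ) ≠ 0 := by exact_mod_cast hN.ne'
    simpa using this
  refine (h1.comp h3).congr fun N => ?_
  simp [div_eq_mul_inv, mul_comm]

/-- Put w = 1 + iu, x = e^(-w/N) and q = N(1 - x), so x → 1 and q → w. The identity x/(1+x) = 1/2 -
(1-x)/(2(1+x)) turns N ξ² x/(1+x) - N ξ²/2 into -ξ² q/(2(1+x)), with limit -ξ² w/4. The term in d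
becomes -d² x/q, with limit -d²/w. Finally N^(-3/2) (1-x)^(-3/2) = q^(-3/2), and (1+x)^(-1/2) tends
to 1/√2. -/
lemma tendsto_bulkIntegrand (c ξ p d u : ℝ) :
    Tendsto (fun N : ℕ => ((Real.exp (-(N * ξ ^ 2 / 2)) : ℝ) : ℂ) * (N : ℂ) ^ (-(3 / 2) : ℂ) *
        bulkIntegrand c ξ p d N (u / N)) atTop
      (𝓝 (((Real.exp c * Real.exp (ξ * p) * (√2)⁻¹ : ℝ) : ℂ) *
        (Complex.exp (((1 - ξ ^ 2 / 4 : ℝ) : ℂ) * (1 + u * Complex.I)) *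
          (1 + u * Complex.I) ^ (-(3 / 2) : ℂ) *
          Complex.exp (-(d ^ 2 / (1 + u * Complex.I)))))) := by
  set w : ℂ := 1 + u * Complex.I with hw
  have hwsl : w ∈ Complex.slitPlane := one_add_mul_I_mem_slitPlane u
  have hw0 : w ≠ 0 := Complex.slitPlane_ne_zero hwsl
  set x : ℕ → ℂ := fun N => Complex.exp (-(w / N)) with hx
  set q : ℕ → ℂ := fun N => N * (1 - x N) with hq
  have hql : Tendsto q atTop (𝓝 w) := tendsto_natCast_mul_one_sub_cexp w
  have hinv : Tendsto (fun N : ℕ => ((N : ℂ))⁻¹) atTop (𝓝 0) := tendsto_inv_atTop_nhds_zero_nat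
  have hxl : Tendsto x atTop (𝓝 1) := by
    have : Tendsto (fun N : ℕ => Complex.exp (-(w * (N : ℂ)⁻¹))) atTop
        (𝓝 (Complex.exp (-(w * 0)))) := (Complex.continuous_exp.tendsto _).comp
          ((hinv.const_mul w).neg)
    simpa [hx, div_eq_mul_inv] using this
  have hE : Tendsto (fun N : ℕ => c * x N ^ 2 + ((2 * (ξ * p) + p ^ 2 * (N : ℂ)⁻¹) *
      (x N / (1 + x N)) - ξ ^ 2 * (q N / (2 * (1 + x N)))) - d ^ 2 * (x N / q N) + w) atTop
      (𝓝 (c * 1 ^ 2 + ((2 * (ξ * p) + p ^ 2 * 0) *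
      (1 / (1 + 1)) - ξ ^ 2 * (w / (2 * (1 + 1)))) - d ^ 2 * (1 / w) + w)) := by
    have h11 : Tendsto (fun N => 1 + x N) atTop (𝓝 (1 + 1)) := tendsto_const_nhds.add hxl
    have h2 : (1 + 1 : ℂ) ≠ 0 := by norm_num
    refine ((((hxl.pow 2).const_mul _).add (((tendsto_const_nhds.add (hinv.const_mul _)).mul
      (hxl.div h11 h2)).sub ((hql.div (h11.const_mul 2) (by norm_num)).const_mul _))).sub
      ((hxl.div hql hw0).const_mul _)).add tendsto_const_nhds
  have hP : Tendsto (fun N : ℕ => q N ^ (-(3 / 2) : ℂ)) atTop (𝓝 (w ^ (-(3 / 2) : ℂ))) :=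
    hql.cpow tendsto_const_nhds hwsl
  have hP2 : Tendsto (fun N : ℕ => (1 + x N) ^ (-(1 / 2) : ℂ)) atTop
      (𝓝 ((1 + 1) ^ (-(1 / 2) : ℂ))) :=
    (tendsto_const_nhds.add hxl).cpow tendsto_const_nhds (by left; norm_num)
  have hmain := (((Complex.continuous_exp.tendsto _).comp hE).mul hP).mul hP2
  have hlim : Complex.exp (c * 1 ^ 2 + ((2 * (ξ * p) + p ^ 2 * 0) *
      (1 / (1 + 1)) - ξ ^ 2 * (w / (2 * (1 + 1)))) - d ^ 2 * (1 / w) + w) *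
      w ^ (-(3 / 2) : ℂ) * (1 + 1) ^ (-(1 / 2) : ℂ) =
      ((Real.exp c * Real.exp (ξ * p) * (√2)⁻¹ : ℝ) : ℂ) *
        (Complex.exp (((1 - ξ ^ 2 / 4 : ℝ) : ℂ) * w) * w ^ (-(3 / 2) : ℂ) *
          Complex.exp (-(d ^ 2 / w))) := by
    have h2 : ((1 : ℂ) + 1) ^ (-(1 / 2) : ℂ) = (((√2)⁻¹ : ℝ) : ℂ) := by
      have e2 : (-(1 / 2) : ℂ) = ((-(1 / 2) : ℝ) : ℂ) := by push_cast; rfl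
      rw [e2, show (1 + 1 : ℂ) = ((2 : ℝ) : ℂ) by push_cast; norm_num,
        ← Complex.ofReal_cpow (by norm_num), Real.rpow_neg (by norm_num), Real.sqrt_eq_rpow]
    rw [h2]
    push_cast
    have h3 : (c * 1 ^ 2 + ((2 * (ξ * p) + p ^ 2 * 0) *
      (1 / (1 + 1)) - ξ ^ 2 * (w / (2 * (1 + 1)))) - d ^ 2 * (1 / w) + w : ℂ) =
      c + ξ * p + (1 - ξ ^ 2 / 4) * w + (-(d ^ 2 / w)) := by ring
    rw [h3, Complex.exp_add, Complex.exp_add, Complex.exp_add]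
    ring
  rw [← hlim]
  refine hmain.congr' ?_
  filter_upwards [eventually_gt_atTop 0] with N hN
  have hN0 : (0 : ℝ) < N := by exact_mod_cast hN
  have hNc : (N : ℂ) ≠ 0 := by exact_mod_cast hN.ne'
  have hs : ((√(N : ℝ) : ℝ) : ℂ) ^ 2 = N := by
    rw [← Complex.ofReal_pow, Real.sq_sqrt hN0.le]; simp
  have hs0 : ((√(N : ℝ) : ℝ) : ℂ) ≠ 0 := by
    have : √(N : ℝ) ≠ 0 := by positivity
    exact_mod_cast this
  have harg : (((N : ℝ)⁻¹ : ℝ) : ℂ) + ((u / N : ℝ) : ℂ) * Complex.I = w / N := by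
    rw [hw]; push_cast; field_simp
  have hlt : ‖x N‖ < 1 := by
    have := norm_cexp_neg_lt_one (inv_pos.mpr hN0) (u / N)
    rwa [harg] at this
  have hm0 := Complex.slitPlane_ne_zero (one_sub_mem_slitPlane hlt)
  have hp0 := Complex.slitPlane_ne_zero (one_add_mem_slitPlane hlt)
  have hq1 : q N ^ (-(3 / 2) : ℂ) = (N : ℂ) ^ (-(3 / 2) : ℂ) * (1 - x N) ^ (-(3 / 2) : ℂ) := by
    have := ofReal_mul_cpow hN0 hm0 (-(3 / 2))
    simpa [hq] using this
  have hexp : ∀ A : ℂ, Complex.exp (c * x N ^ 2 + ((2 * (ξ * p) + p ^ 2 * (N : ℂ)⁻¹) *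
      (x N / (1 + x N)) - ξ ^ 2 * (q N / (2 * (1 + x N)))) - d ^ 2 * (x N / q N) + w) * A =
      ((Real.exp (-(N * ξ ^ 2 / 2)) : ℝ) : ℂ) * Complex.exp (c * x N ^ 2 +
        (((((√N * ξ + p / √N) + d / √N : ℝ) : ℂ) + (((√N * ξ + p / √N) - d / √N : ℝ) : ℂ)) / 2) ^ 2 *
          (x N / (1 + x N)) -
        (((((√N * ξ + p / √N) + d / √N : ℝ) : ℂ) - (((√N * ξ + p / √N) - d / √N : ℝ) : ℂ)) / 2) ^ 2 *
          (x N / (1 - x N))) * Complex.exp (N * (w / N)) * A := by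
    intro A
    rw [Complex.ofReal_exp, ← Complex.exp_add, ← Complex.exp_add]
    congr 2
    have s1 : (((((√N * ξ + p / √N) + d / √N : ℝ) : ℂ) +
        (((√N * ξ + p / √N) - d / √N : ℝ) : ℂ)) / 2) ^ 2 =
        N * ξ ^ 2 + 2 * (ξ * p) + p ^ 2 * (N : ℂ)⁻¹ := by
      push_cast
      rw [← hs]
      field_simp
      ring
    have s2 : (((((√N * ξ + p / √N) + d / √N : ℝ) : ℂ) -
        (((√N * ξ + p / √N) - d / √N : ℝ) : ℂ)) / 2) ^ 2 = d ^ 2 * (N : ℂ)⁻¹ := by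
      push_cast
      rw [← hs]
      field_simp
      ring
    rw [s1, s2, mul_div_cancel₀ _ hNc]
    simp only [hq]
    push_cast
    field_simp
    ring
  simp only [Function.comp_apply]
  rw [mul_assoc, hexp, bulkIntegrand, harg, hq1, corrGenFun]
  simp only [hx]
  ring

end Asymptotics

/-! ### The arcs near 1 and near -1 -/

section Asymptotics

/-- Substitute φ = u/N and use dominated convergence. On this arc |1 + z| ≥ 1 and |1 - z| ≥ |1 + iu|
/ (3N), so a multiple of |1 + iu|^(-3/2) dominates. The condition |ξ| < 2 makes the Laplace variable
1 - ξ²/4 positive. -/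
lemma tendsto_integral_bulkIntegrand_near (c ξ p d : ℝ) (hξ : ξ ∈ Set.Ioo (-2 : ℝ) 2) :
    Tendsto (fun N : ℕ => ((Real.exp (-(N * ξ ^ 2 / 2)) : ℝ) : ℂ) * (((√N)⁻¹ : ℝ) : ℂ) *
        ∫ φ in (-(Real.pi / 2))..(Real.pi / 2), bulkIntegrand c ξ p d N φ) atTop
      (𝓝 (((Real.exp c * Real.exp (ξ * p) * (√2)⁻¹ *
        (4 * √Real.pi * √(1 - ξ ^ 2 / 4) * Real.sinc (2 * d * √(1 - ξ ^ 2 / 4))) : ℝ) : ℂ))) := by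
  have ha : 0 < 1 - ξ ^ 2 / 4 := by nlinarith [hξ.1, hξ.2]
  set S : ℕ → Set ℝ := fun N => Set.Ioc (-(Real.pi / 2) * N) (Real.pi / 2 * N) with hS
  set F : ℕ → ℝ → ℂ := fun N => (S N).indicator fun u =>
    ((Real.exp (-(N * ξ ^ 2 / 2)) : ℝ) : ℂ) * (N : ℂ) ^ (-(3 / 2) : ℂ) *
      bulkIntegrand c ξ p d N (u / N) with hF
  set K := Real.exp (|c| + |ξ * p| + p ^ 2 + d ^ 2 + 1) with hK
  have hdct : Tendsto (fun N => ∫ u, F N u) atTop (𝓝 (∫ u : ℝ,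
      ((Real.exp c * Real.exp (ξ * p) * (√2)⁻¹ : ℝ) : ℂ) *
        (Complex.exp (((1 - ξ ^ 2 / 4 : ℝ) : ℂ) * (1 + u * Complex.I)) *
          (1 + u * Complex.I) ^ (-(3 / 2) : ℂ) *
          Complex.exp (-(d ^ 2 / (1 + u * Complex.I)))))) := by
    refine tendsto_integral_filter_of_dominated_convergence
      (fun u : ℝ => K * 3 ^ (3 / 2 : ℝ) * ‖(1 + u * Complex.I) ^ (-((3 / 2 : ℝ) : ℂ))‖)
      ?_ ?_ ?_ ?_
    · filter_upwards [eventually_gt_atTop 0] with N hN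
      refine AEStronglyMeasurable.indicator ?_ measurableSet_Ioc
      refine Continuous.aestronglyMeasurable ?_
      exact continuous_const.mul ((continuous_bulkIntegrand c ξ p d hN).comp
        (continuous_id.div_const _))
    · filter_upwards [eventually_gt_atTop 0] with N hN
      refine ae_of_all _ fun u => ?_
      have hN0 : (0 : ℝ) < N := by exact_mod_cast hN
      by_cases hu : u ∈ S N
      · simp only [hF, Set.indicator_of_mem hu]
        have hφ : |u / N| ≤ Real.pi / 2 := by
          rw [abs_le, le_div_iff₀ hN0, div_le_iff₀ hN0]
          exact ⟨hu.1.le, hu.2⟩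
        have hφ' : |u / N| ≤ Real.pi := by linarith [Real.pi_pos]
        have h1 := norm_bulkIntegrand_le c ξ p d hN (u / N)
        have h2 := norm_one_sub_cexp_ge (inv_pos.mpr hN0) (inv_le_one_of_one_le₀
          (by exact_mod_cast hN)) hφ'
        set x := Complex.exp (-(((N : ℝ)⁻¹ : ℝ) + ((u / N : ℝ) : ℂ) * Complex.I)) with hx
        have h3 : 1 ≤ ‖1 + x‖ := by
          have hre : 0 ≤ x.re := by
            rw [hx, Complex.exp_re]
            have : 0 ≤ Real.cos (u / N) :=
              Real.cos_nonneg_of_mem_Icc ⟨(abs_le.mp hφ).1, (abs_le.mp hφ).2⟩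
            have h5 : (-((((N : ℝ)⁻¹ : ℝ) : ℂ) + ((u / N : ℝ) : ℂ) * Complex.I)).im = -(u / N) := by
              simp [-Complex.ofReal_div]
            rw [h5, Real.cos_neg]
            positivity
          calc (1 : ℝ) ≤ (1 + x).re := by simpa using hre
            _ ≤ _ := Complex.re_le_norm _
        have h4 : ‖1 + x‖ ^ (-(1 / 2) : ℝ) ≤ 1 :=
          Real.rpow_le_one_of_one_le_of_nonpos h3 (by norm_num)
        have hnw : ‖(((N : ℝ)⁻¹ : ℝ) : ℂ) + ((u / N : ℝ) : ℂ) * Complex.I‖ =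
            (N : ℝ)⁻¹ * ‖1 + (u : ℂ) * Complex.I‖ := by
          rw [show (((N : ℝ)⁻¹ : ℝ) : ℂ) + ((u / N : ℝ) : ℂ) * Complex.I =
            (((N : ℝ)⁻¹ : ℝ) : ℂ) * (1 + (u : ℂ) * Complex.I) by push_cast; field_simp,
            norm_mul, Complex.norm_real, Real.norm_of_nonneg (by positivity)]
        have hw1 := one_le_norm_one_add_mul_I u
        have h5 : ‖1 - x‖ ^ (-(3 / 2) : ℝ) ≤
            ((N : ℝ)⁻¹ * ‖1 + (u : ℂ) * Complex.I‖ / 3) ^ (-(3 / 2) : ℝ) := by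
          rw [hnw] at h2
          exact Real.rpow_le_rpow_of_nonpos (by positivity) h2 (by norm_num)
        have h6 : ((N : ℝ)⁻¹ * ‖1 + (u : ℂ) * Complex.I‖ / 3) ^ (-(3 / 2) : ℝ) =
            (N : ℝ) ^ (3 / 2 : ℝ) * ‖1 + (u : ℂ) * Complex.I‖ ^ (-(3 / 2) : ℝ) *
              3 ^ (3 / 2 : ℝ) := by
          rw [Real.div_rpow (by positivity) (by norm_num), Real.mul_rpow (by positivity)
            (by positivity), Real.rpow_neg (by norm_num : (0 : ℝ) ≤ 3),
            Real.inv_rpow (by positivity), Real.rpow_neg (by positivity), inv_inv, div_inv_eq_mul]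
        have h7 : ‖(N : ℂ) ^ (-(3 / 2) : ℂ)‖ = (N : ℝ) ^ (-(3 / 2) : ℝ) := by
          rw [show (-(3 / 2) : ℂ) = ((-(3 / 2) : ℝ) : ℂ) by push_cast; rfl,
            Complex.norm_cpow_real, Complex.norm_natCast]
        have h8 : (N : ℝ) ^ (-(3 / 2) : ℝ) * (N : ℝ) ^ (3 / 2 : ℝ) = 1 := by
          rw [← Real.rpow_add hN0]; simp
        rw [norm_mul, norm_mul, h7, Complex.norm_real, Real.norm_of_nonneg (Real.exp_pos _).le,
          ← Complex.ofReal_neg, Complex.norm_cpow_real]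
        calc _ = (N : ℝ) ^ (-(3 / 2) : ℝ) * (Real.exp (-(N * ξ ^ 2 / 2)) *
              ‖bulkIntegrand c ξ p d N (u / N)‖) := by ring
          _ ≤ (N : ℝ) ^ (-(3 / 2) : ℝ) * (K * (((N : ℝ) ^ (3 / 2 : ℝ) *
              ‖1 + (u : ℂ) * Complex.I‖ ^ (-(3 / 2) : ℝ) * 3 ^ (3 / 2 : ℝ)) * 1)) := by
            rw [← h6]
            refine mul_le_mul_of_nonneg_left (h1.trans ?_) (by positivity)
            gcongr
          _ = ((N : ℝ) ^ (-(3 / 2) : ℝ) * (N : ℝ) ^ (3 / 2 : ℝ)) * (K * 3 ^ (3 / 2 : ℝ) *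
              ‖1 + (u : ℂ) * Complex.I‖ ^ (-(3 / 2) : ℝ)) := by ring
          _ = _ := by rw [h8, one_mul]
      · simp only [hF, Set.indicator_of_notMem hu, norm_zero]
        positivity
    · exact (integrable_one_add_mul_I_cpow (s := 3 / 2) (by norm_num)).norm.const_mul _
    · refine ae_of_all _ fun u => (tendsto_bulkIntegrand c ξ p d u).congr' ?_
      filter_upwards [eventually_gt_atTop ⌈|u|⌉₊] with N hN
      have hN' : |u| < N := Nat.lt_of_ceil_lt hN
      have hpi : 1 ≤ Real.pi / 2 := by linarith [Real.pi_gt_three]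
      have hmem : u ∈ S N := by
        have h1 := abs_lt.mp hN'
        have h0 : (0 : ℝ) ≤ N := Nat.cast_nonneg N
        constructor <;> nlinarith
      simp only [hF, Set.indicator_of_mem hmem]
  rw [integral_const_mul, integral_cexp_mul_cpow_mul_cexp_inv ha, ← Complex.ofReal_mul] at hdct
  refine hdct.congr' ?_
  filter_upwards [eventually_gt_atTop 0] with N hN
  have hN0 : (0 : ℝ) < N := by exact_mod_cast hN
  have hNc : (N : ℂ) ≠ 0 := by exact_mod_cast hN.ne'
  have hpi := Real.pi_pos
  simp only [hF]
  rw [integral_indicator measurableSet_Ioc, ← intervalIntegral.integral_of_le (by nlinarith),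
    intervalIntegral.integral_const_mul]
  have hsub := intervalIntegral.integral_comp_div (a := -(Real.pi / 2) * N) (b := Real.pi / 2 * N)
    (bulkIntegrand c ξ p d N) hN0.ne'
  rw [mul_div_cancel_right₀ _ hN0.ne', mul_div_cancel_right₀ _ hN0.ne'] at hsub
  rw [hsub, Complex.real_smul, mul_assoc, mul_assoc]
  congr 1
  rw [← mul_assoc]
  congr 1
  have h1 : (N : ℂ) ^ (-(3 / 2) : ℂ) = (((N : ℝ) ^ (-(3 / 2) : ℝ) : ℝ) : ℂ) := by
    rw [Complex.ofReal_cpow hN0.le]; push_cast; rfl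
  rw [h1, ← Complex.ofReal_mul, Real.sqrt_eq_rpow, ← Real.rpow_neg hN0.le]
  -- The power N^(-3/2) from the singularity and the Jacobian N of φ = u/N combine to N^(-1/2).
  congr 1
  nth_rewrite 2 [← Real.rpow_one (N : ℝ)]
  rw [← Real.rpow_add hN0]
  norm_num

/-- On this arc |1 - z| ≥ 1, and |1 + z| ≥ |φ - π| / 3 by the same estimate as at z = 1, shifted by
π. The integral, with its Gaussian prefactor, is therefore bounded independently of N by that of a
multiple of |φ - π|^(-1/2), and the remaining prefactor N^(-1/2) sends it to 0. -/
lemma tendsto_integral_bulkIntegrand_far (c ξ p d : ℝ) :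
    Tendsto (fun N : ℕ => ((Real.exp (-(N * ξ ^ 2 / 2)) : ℝ) : ℂ) * (((√N)⁻¹ : ℝ) : ℂ) *
        ∫ φ in (Real.pi / 2)..(3 * Real.pi / 2), bulkIntegrand c ξ p d N φ) atTop (𝓝 0) := by
  set K := Real.exp (|c| + |ξ * p| + p ^ 2 + d ^ 2 + 1) with hK
  -- The majorant is the norm of a complex power, equal to |φ - π|^(-1/2) away from π on both sides,
  -- because complex powers come with an integrability criterion across 0.
  set g : ℝ → ℝ := fun φ => K * (3 ^ (1 / 2 : ℝ) *
    ‖((φ - Real.pi : ℝ) : ℂ) ^ ((-(1 / 2) : ℝ) : ℂ)‖) with hg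
  have hgi : IntervalIntegrable g volume (Real.pi / 2) (3 * Real.pi / 2) := by
    have h1 := (intervalIntegral.intervalIntegrable_cpow' (a := Real.pi / 2 - Real.pi)
      (b := 3 * Real.pi / 2 - Real.pi) (r := ((-(1 / 2) : ℝ) : ℂ))
      (by rw [Complex.ofReal_re]; norm_num)).norm.comp_sub_right Real.pi
    rw [sub_add_cancel, sub_add_cancel] at h1
    exact (h1.const_mul _).const_mul _
  have hbound : ∀ N : ℕ, 0 < N → ‖((Real.exp (-(N * ξ ^ 2 / 2)) : ℝ) : ℂ) *
      (((√N)⁻¹ : ℝ) : ℂ) * ∫ φ in (Real.pi / 2)..(3 * Real.pi / 2), bulkIntegrand c ξ p d N φ‖ ≤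
      (√N)⁻¹ * ∫ φ in (Real.pi / 2)..(3 * Real.pi / 2), g φ := by
    intro N hN
    have hN0 : (0 : ℝ) < N := by exact_mod_cast hN
    have hpi := Real.pi_pos
    rw [mul_comm ((Real.exp _ : ℝ) : ℂ), mul_assoc, norm_mul, Complex.norm_real,
      Real.norm_of_nonneg (by positivity), ← intervalIntegral.integral_const_mul]
    refine mul_le_mul_of_nonneg_left ?_ (by positivity)
    refine intervalIntegral.norm_integral_le_of_norm_le (by linarith) ?_ hgi
    have hne : ∀ᵐ φ : ℝ, φ ≠ Real.pi := by simp [ae_iff]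
    filter_upwards [hne] with φ hφπ hφ
    rw [norm_mul, Complex.norm_real, Real.norm_of_nonneg (Real.exp_pos _).le]
    refine (norm_bulkIntegrand_le c ξ p d hN φ).trans ?_
    simp only [hg]
    refine mul_le_mul_of_nonneg_left ?_ (Real.exp_pos _).le
    have hx : Complex.exp (-(((N : ℝ)⁻¹ : ℝ) + (φ : ℂ) * Complex.I)) =
        -Complex.exp (-(((N : ℝ)⁻¹ : ℝ) + ((φ - Real.pi : ℝ) : ℂ) * Complex.I)) := by
      have : -((((N : ℝ)⁻¹ : ℝ) : ℂ) + (φ : ℂ) * Complex.I) =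
          -((((N : ℝ)⁻¹ : ℝ) : ℂ) + ((φ - Real.pi : ℝ) : ℂ) * Complex.I) - Real.pi * Complex.I := by
        push_cast; ring
      rw [this, Complex.exp_sub, Complex.exp_pi_mul_I]
      ring
    have hψ : |φ - Real.pi| ≤ Real.pi / 2 := by
      rw [abs_le]; constructor <;> linarith [hφ.1, hφ.2]
    have h2 := norm_one_sub_cexp_ge (inv_pos.mpr hN0) (inv_le_one_of_one_le₀
          (by exact_mod_cast hN)) (hψ.trans (by linarith))
    rw [hx, sub_neg_eq_add, ← sub_eq_add_neg]
    set x := Complex.exp (-(((N : ℝ)⁻¹ : ℝ) + ((φ - Real.pi : ℝ) : ℂ) * Complex.I)) with hxdef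
    have h3 : 1 ≤ ‖1 + x‖ := by
      have hre : 0 ≤ x.re := by
        rw [hxdef, Complex.exp_re]
        have : 0 ≤ Real.cos (φ - Real.pi) :=
          Real.cos_nonneg_of_mem_Icc ⟨(abs_le.mp hψ).1, (abs_le.mp hψ).2⟩
        have h5 : (-((((N : ℝ)⁻¹ : ℝ) : ℂ) + ((φ - Real.pi : ℝ) : ℂ) * Complex.I)).im =
            -(φ - Real.pi) := by
          simp [-Complex.ofReal_sub]
        rw [h5, Real.cos_neg]
        positivity
      calc (1 : ℝ) ≤ (1 + x).re := by simpa using hre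
        _ ≤ _ := Complex.re_le_norm _
    have h4 : ‖1 + x‖ ^ (-(3 / 2) : ℝ) ≤ 1 :=
      Real.rpow_le_one_of_one_le_of_nonpos h3 (by norm_num)
    have hpos : 0 < |φ - Real.pi| := abs_pos.mpr (sub_ne_zero.mpr hφπ)
    have h6 : |φ - Real.pi| / 3 ≤ ‖1 - x‖ := by
      refine le_trans ?_ h2
      gcongr
      have := Complex.abs_im_le_norm ((((N : ℝ)⁻¹ : ℝ) : ℂ) + ((φ - Real.pi : ℝ) : ℂ) * Complex.I)
      simpa [-Complex.ofReal_sub] using this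
    have h7 : ‖1 - x‖ ^ (-(1 / 2) : ℝ) ≤ (|φ - Real.pi| / 3) ^ (-(1 / 2) : ℝ) :=
      Real.rpow_le_rpow_of_nonpos (by positivity) h6 (by norm_num)
    have h8 : (|φ - Real.pi| / 3) ^ (-(1 / 2) : ℝ) = 3 ^ (1 / 2 : ℝ) *
        |φ - Real.pi| ^ (-(1 / 2) : ℝ) := by
      rw [Real.div_rpow (by positivity) (by norm_num), Real.rpow_neg (by norm_num : (0 : ℝ) ≤ 3),
        div_inv_eq_mul, mul_comm]
    rw [Complex.norm_cpow_real, Complex.norm_real, Real.norm_eq_abs, ← h8]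
    calc _ ≤ 1 * (|φ - Real.pi| / 3) ^ (-(1 / 2) : ℝ) := by gcongr
      _ = _ := one_mul _
  rw [tendsto_zero_iff_norm_tendsto_zero]
  refine squeeze_zero' (Eventually.of_forall fun N => norm_nonneg _)
    ((eventually_gt_atTop 0).mono fun N hN => hbound N hN) ?_
  have h1 : Tendsto (fun N : ℕ => (√(N : ℝ))⁻¹) atTop (𝓝 0) :=
    (Real.tendsto_sqrt_atTop.comp tendsto_natCast_atTop_atTop).inv_tendsto_atTop
  simpa using h1.mul_const (∫ φ in (Real.pi / 2)..(3 * Real.pi / 2), g φ)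

lemma tendsto_iteratedDeriv_corrGenFun (c ξ p d : ℝ) (hξ : ξ ∈ Set.Ioo (-2 : ℝ) 2) :
    Tendsto (fun N : ℕ => ((√(1 / (2 * Real.pi * N)) * (1 / (N.factorial : ℝ)) *
          Real.exp (-(N * ξ ^ 2 / 2)) : ℝ) : ℂ) *
        iteratedDeriv N (corrGenFun c (((√N * ξ + p / √N) + d / √N : ℝ) : ℂ)
          (((√N * ξ + p / √N) - d / √N : ℝ) : ℂ)) 0) atTop
      (𝓝 ((Real.exp c * Real.exp (ξ * p) * (√(1 - ξ ^ 2 / 4) / Real.pi) *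
        Real.sinc (2 * d * √(1 - ξ ^ 2 / 4)) : ℝ) : ℂ)) := by
  have h := ((tendsto_integral_bulkIntegrand_near c ξ p d hξ).add
    (tendsto_integral_bulkIntegrand_far c ξ p d)).const_mul
    ((((√(2 * Real.pi))⁻¹ * (2 * Real.pi)⁻¹ : ℝ) : ℂ))
  have hpi := Real.pi_pos
  have hlim : (((√(2 * Real.pi))⁻¹ * (2 * Real.pi)⁻¹ : ℝ) : ℂ) *
      (((Real.exp c * Real.exp (ξ * p) * (√2)⁻¹ *
        (4 * √Real.pi * √(1 - ξ ^ 2 / 4) * Real.sinc (2 * d * √(1 - ξ ^ 2 / 4))) : ℝ) : ℂ) + 0) =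
      ((Real.exp c * Real.exp (ξ * p) * (√(1 - ξ ^ 2 / 4) / Real.pi) *
        Real.sinc (2 * d * √(1 - ξ ^ 2 / 4)) : ℝ) : ℂ) := by
    rw [add_zero, ← Complex.ofReal_mul, Real.sqrt_mul (by norm_num)]
    congr 1
    have h2 : √(2 : ℝ) ^ 2 = 2 := Real.sq_sqrt (by norm_num)
    have h3 : √(2 : ℝ) ≠ 0 := by positivity
    have h4 : √Real.pi ≠ 0 := by positivity
    field_simp
    rw [h2]
    ring
  rw [hlim] at h
  refine h.congr' ?_
  filter_upwards [eventually_gt_atTop 0] with N hN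
  have hN0 : (0 : ℝ) < N := by exact_mod_cast hN
  have hcont := continuous_bulkIntegrand c ξ p d hN
  rw [iteratedDeriv_eq_intervalIntegral (differentiableOn_corrGenFun _ _ _) N (inv_pos.mpr hN0),
    ← mul_add, intervalIntegral.integral_add_adjacent_intervals (hcont.intervalIntegrable _ _)
      (hcont.intervalIntegrable _ _)]
  change _ = _ * (_ * ∫ φ in (-(Real.pi / 2))..(3 * Real.pi / 2), bulkIntegrand c ξ p d N φ)
  rw [← mul_assoc, ← mul_assoc, ← mul_assoc]
  congr 1
  rw [one_div, Real.sqrt_inv, Real.sqrt_mul (x := 2 * Real.pi) (by positivity) (N : ℝ)]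
  have hf : (N.factorial : ℂ) ≠ 0 := by exact_mod_cast N.factorial_ne_zero
  have hpc : (Real.pi : ℂ) ≠ 0 := by exact_mod_cast hpi.ne'
  push_cast
  field_simp

end Asymptotics

/-! ### Matrix entries and the σ-algebras they generate -/

section Entries

/-- The assumptions on the common distribution of the entries. -/
structure WignerMoments (Q : Measure ℝ) (b : ℝ) : Prop where
  integrable_pow_four : Integrable (fun x : ℝ => x ^ 4) Q
  mean : ∫ x, x ∂Q = 0
  second : ∫ x, x ^ 2 ∂Q = 1 / 2
  fourth : ∫ x, x ^ 4 ∂Q = b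

/-- Index set of the independent real random variables. -/
abbrev EntryIndex : Type := ℕ ⊕ (UpperIndex ⊕ UpperIndex)

/-- The position in the matrix (on or above the diagonal) where a variable occurs. -/
def entryPosition : EntryIndex → ℕ × ℕ
  | Sum.inl i => (i, i)
  | Sum.inr (Sum.inl p) => p.1
  | Sum.inr (Sum.inr p) => p.1

variable {Ω : Type*}

/-- The independent real random variables. -/
noncomputable def entryVar (Xd : ℕ → Ω → ℝ) (Xre Xim : UpperIndex → Ω → ℝ) :
    EntryIndex → Ω → ℝ :=
  Sum.elim (fun i ω => Xd i ω / √2) (Sum.elim Xre Xim)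

/-- The `σ`-algebra generated by the variables at a set of positions. -/
@[reducible] noncomputable def entrySigma (Xd : ℕ → Ω → ℝ) (Xre Xim : UpperIndex → Ω → ℝ)
    (S : Set (ℕ × ℕ)) : MeasurableSpace Ω :=
  ⨆ e ∈ entryPosition ⁻¹' S, MeasurableSpace.comap (entryVar Xd Xre Xim e) inferInstance

/-- The entries of the infinite matrix. -/
noncomputable def wignerEntry (Xd : ℕ → Ω → ℝ) (Xre Xim : UpperIndex → Ω → ℝ) (i j : ℕ) (ω : Ω) :
    ℂ :=
  if h : i < j then
    (Xre ⟨(i, j), h⟩ ω : ℂ) + Complex.I * (Xim ⟨(i, j), h⟩ ω : ℂ)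
  else if h : j < i then
    (Xre ⟨(j, i), h⟩ ω : ℂ) - Complex.I * (Xim ⟨(j, i), h⟩ ω : ℂ)
  else (Xd i ω : ℂ)

variable {Xd : ℕ → Ω → ℝ} {Xre Xim : UpperIndex → Ω → ℝ}

lemma wignerMatrix_apply (N : ℕ) (ω : Ω) (i j : Fin N) :
    wignerMatrix Xd Xre Xim N ω i j = wignerEntry Xd Xre Xim i j ω := rfl

lemma wignerEntry_self (i : ℕ) (ω : Ω) : wignerEntry Xd Xre Xim i i ω = Xd i ω := by
  simp [wignerEntry]

lemma wignerEntry_conj (i j : ℕ) (ω : Ω) :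
    wignerEntry Xd Xre Xim j i ω = star (wignerEntry Xd Xre Xim i j ω) := by
  unfold wignerEntry
  rcases lt_trichotomy i j with h | h | h
  · simp [h, h.not_gt, sub_eq_add_neg]
  · subst h; simp
  · simp [h, h.not_gt]

lemma norm_wignerEntry_comm (i j : ℕ) (ω : Ω) :
    ‖wignerEntry Xd Xre Xim j i ω‖ = ‖wignerEntry Xd Xre Xim i j ω‖ := by
  rw [wignerEntry_conj, norm_star]

lemma measurable_entryVar_entrySigma {S : Set (ℕ × ℕ)} {e : EntryIndex}
    (he : entryPosition e ∈ S) :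
    Measurable[entrySigma Xd Xre Xim S] (entryVar Xd Xre Xim e) :=
  Measurable.mono (comap_measurable _)
    (le_iSup₂_of_le (f := fun e (_ : e ∈ entryPosition ⁻¹' S) =>
      MeasurableSpace.comap (entryVar Xd Xre Xim e) inferInstance) e he le_rfl) le_rfl

lemma measurable_wignerEntry_of_le {S : Set (ℕ × ℕ)} {i j : ℕ} (hij : i ≤ j) (he : (i, j) ∈ S) :
    Measurable[entrySigma Xd Xre Xim S] (wignerEntry Xd Xre Xim i j) := by
  let _ := entrySigma Xd Xre Xim S
  rcases hij.lt_or_eq with h | h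
  · have h1 : Measurable (Xre ⟨(i, j), h⟩) :=
      measurable_entryVar_entrySigma (Xd := Xd) (Xre := Xre) (Xim := Xim)
        (e := Sum.inr (Sum.inl ⟨(i, j), h⟩)) he
    have h2 : Measurable (Xim ⟨(i, j), h⟩) :=
      measurable_entryVar_entrySigma (Xd := Xd) (Xre := Xre) (Xim := Xim)
        (e := Sum.inr (Sum.inr ⟨(i, j), h⟩)) he
    have : wignerEntry Xd Xre Xim i j = fun ω =>
        (Xre ⟨(i, j), h⟩ ω : ℂ) + Complex.I * (Xim ⟨(i, j), h⟩ ω : ℂ) := by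
      ext ω; simp [wignerEntry, h]
    rw [this]
    fun_prop
  · subst h
    have h1 : Measurable (fun ω => Xd i ω / √2) :=
      measurable_entryVar_entrySigma (Xd := Xd) (Xre := Xre) (Xim := Xim)
        (e := Sum.inl i) he
    have : wignerEntry Xd Xre Xim i i = fun ω => ((Xd i ω / √2 * √2 : ℝ) : ℂ) := by
      ext ω
      have : √(2 : ℝ) ≠ 0 := by positivity
      rw [wignerEntry_self, div_mul_cancel₀ _ this]
    rw [this]
    fun_prop

lemma measurable_wignerEntry {S : Set (ℕ × ℕ)} {i j : ℕ} (he : (min i j, max i j) ∈ S) :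
    Measurable[entrySigma Xd Xre Xim S] (wignerEntry Xd Xre Xim i j) := by
  rcases le_total i j with h | h
  · rw [min_eq_left h, max_eq_right h] at he
    exact measurable_wignerEntry_of_le h he
  · rw [min_eq_right h, max_eq_left h] at he
    have h1 := measurable_wignerEntry_of_le (Xd := Xd) (Xre := Xre) (Xim := Xim) h he
    have : wignerEntry Xd Xre Xim i j = fun ω => star (wignerEntry Xd Xre Xim j i ω) := by
      ext ω; exact wignerEntry_conj _ _ _
    rw [this]
    exact continuous_star.measurable.comp h1

lemma wignerEntry_eq_re_add_im {i j : ℕ} (h : i < j) (ω : Ω) :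
    wignerEntry Xd Xre Xim i j ω = (entryVar Xd Xre Xim (Sum.inr (Sum.inl ⟨(i, j), h⟩)) ω : ℂ) +
      Complex.I * (entryVar Xd Xre Xim (Sum.inr (Sum.inr ⟨(i, j), h⟩)) ω : ℂ) := by
  simp [wignerEntry, h, entryVar]

lemma wignerEntry_self_eq (i : ℕ) (ω : Ω) :
    wignerEntry Xd Xre Xim i i ω = ((√2 * entryVar Xd Xre Xim (Sum.inl i) ω : ℝ) : ℂ) := by
  have : √(2 : ℝ) ≠ 0 := by positivity
  rw [wignerEntry_self, entryVar, Sum.elim_inl, mul_div_cancel₀ _ this]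

lemma measurable_entryVar [MeasurableSpace Ω] {P : Measure Ω} {Q : Measure ℝ}
    (hX : IsWignerFamily P Q Xd Xre Xim) (e : EntryIndex) :
    Measurable (entryVar Xd Xre Xim e) := by
  rcases e with i | p | p
  · exact (hX.measurable_diag i).div_const _
  · exact hX.measurable_re p
  · exact hX.measurable_im p

lemma map_entryVar [MeasurableSpace Ω] {P : Measure Ω} {Q : Measure ℝ}
    (hX : IsWignerFamily P Q Xd Xre Xim) (e : EntryIndex) :
    P.map (entryVar Xd Xre Xim e) = Q := by
  rcases e with i | p | p
  · exact hX.law_diag i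
  · exact hX.law_re p
  · exact hX.law_im p

variable [mΩ : MeasurableSpace Ω] {P : Measure Ω} {Q : Measure ℝ}

lemma entrySigma_le (hX : IsWignerFamily P Q Xd Xre Xim) (S : Set (ℕ × ℕ)) :
    entrySigma Xd Xre Xim S ≤ mΩ :=
  iSup₂_le fun e _ => (measurable_entryVar hX e).comap_le

/-- Disjoint sets of positions involve disjoint sets of the independent variables. The two conjugate
entries (i, j) and (j, i), and their real and imaginary parts, share one position, so independence
questions reduce to comparing sets of positions. -/
lemma indepFun_of_measurable_entrySigma (hX : IsWignerFamily P Q Xd Xre Xim)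
    {S T : Set (ℕ × ℕ)} (hST : Disjoint S T) {β γ : Type*} [MeasurableSpace β] [MeasurableSpace γ]
    {f : Ω → β} {g : Ω → γ} (hf : Measurable[entrySigma Xd Xre Xim S] f)
    (hg : Measurable[entrySigma Xd Xre Xim T] g) : IndepFun f g P := by
  have h : Indep (entrySigma Xd Xre Xim S) (entrySigma Xd Xre Xim T) P :=
    indep_iSup_of_disjoint (fun e => (measurable_entryVar hX e).comap_le) hX.indep
      (hST.preimage _)
  rw [IndepFun_iff_Indep]
  exact indep_of_indep_of_le_left (indep_of_indep_of_le_right h hg.comap_le) hf.comap_le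

lemma integral_mul_of_measurable_entrySigma (hX : IsWignerFamily P Q Xd Xre Xim)
    {S T : Set (ℕ × ℕ)} (hST : Disjoint S T) {f g : Ω → ℂ}
    (hf : Measurable[entrySigma Xd Xre Xim S] f) (hg : Measurable[entrySigma Xd Xre Xim T] g) :
    ∫ ω, f ω * g ω ∂P = (∫ ω, f ω ∂P) * ∫ ω, g ω ∂P :=
  (indepFun_of_measurable_entrySigma hX hST hf hg).integral_fun_mul_eq_mul_integral
    (hf.mono (entrySigma_le hX S) le_rfl).aestronglyMeasurable
    (hg.mono (entrySigma_le hX T) le_rfl).aestronglyMeasurable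

lemma memLp_entryVar {b : ℝ} (hQ : WignerMoments Q b) (hX : IsWignerFamily P Q Xd Xre Xim)
    (e : EntryIndex) : MemLp (entryVar Xd Xre Xim e) 4 P := by
  have h1 : MemLp (fun x : ℝ => x) 4 Q := by
    rw [← integrable_norm_rpow_iff (by fun_prop) (by norm_num) (by norm_num)]
    refine hQ.integrable_pow_four.congr (ae_of_all _ fun x => ?_)
    have : (4 : ENNReal).toReal = ((4 : ℕ) : ℝ) := by norm_num
    simp only [this, Real.rpow_natCast, Real.norm_eq_abs]
    exact (Even.pow_abs ⟨2, rfl⟩ x).symm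
  rw [← map_entryVar hX e, memLp_map_measure_iff (by fun_prop)
    (measurable_entryVar hX e).aemeasurable] at h1
  exact h1

lemma integral_comp_entryVar (hX : IsWignerFamily P Q Xd Xre Xim) (e : EntryIndex)
    {f : ℝ → ℝ} (hf : Measurable f) : ∫ ω, f (entryVar Xd Xre Xim e ω) ∂P = ∫ x, f x ∂Q := by
  rw [← map_entryVar hX e, integral_map (measurable_entryVar hX e).aemeasurable
    hf.aestronglyMeasurable]

lemma memLp_wignerEntry_of_le {b : ℝ} (hQ : WignerMoments Q b)
    (hX : IsWignerFamily P Q Xd Xre Xim) {i j : ℕ} (hij : i ≤ j) :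
    MemLp (wignerEntry Xd Xre Xim i j) 4 P := by
  rcases hij.lt_or_eq with h | h
  · refine MemLp.ae_eq (ae_of_all _ fun ω => (wignerEntry_eq_re_add_im h ω).symm) ?_
    have h1 := MemLp.ofReal (K := ℂ) (memLp_entryVar hQ hX (Sum.inr (Sum.inl ⟨(i, j), h⟩)))
    have h2 := MemLp.ofReal (K := ℂ) (memLp_entryVar hQ hX (Sum.inr (Sum.inr ⟨(i, j), h⟩)))
    exact h1.add (h2.const_mul Complex.I)
  · subst h
    refine MemLp.ae_eq (ae_of_all _ fun ω => (wignerEntry_self_eq i ω).symm) ?_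
    exact MemLp.ofReal (K := ℂ) ((memLp_entryVar hQ hX _).const_mul _)

lemma integrable_entryVar_pow [IsProbabilityMeasure P] {b : ℝ} (hQ : WignerMoments Q b)
    (hX : IsWignerFamily P Q Xd Xre Xim) (e : EntryIndex) {k : ℕ} (hk : k ≤ 4) :
    Integrable (fun ω => entryVar Xd Xre Xim e ω ^ k) P := by
  have h1 : MemLp (entryVar Xd Xre Xim e) (k : ℕ) P :=
    (memLp_entryVar hQ hX e).mono_exponent (by exact_mod_cast hk)
  have h2 := h1.integrable_norm_pow'
  refine (integrable_norm_iff
    ((measurable_entryVar hX e).pow_const k).aestronglyMeasurable).mp ?_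
  simpa [norm_pow] using h2

end Entries

/-! ### Mixed moments of the entries up to order four -/

section Moments

variable {Ω : Type*} {Xd : ℕ → Ω → ℝ} {Xre Xim : UpperIndex → Ω → ℝ}

lemma star_mul_self_wignerEntry {i j : ℕ} (h : i < j) (ω : Ω) :
    wignerEntry Xd Xre Xim j i ω * wignerEntry Xd Xre Xim i j ω =
      ((entryVar Xd Xre Xim (Sum.inr (Sum.inl ⟨(i, j), h⟩)) ω ^ 2 +
        entryVar Xd Xre Xim (Sum.inr (Sum.inr ⟨(i, j), h⟩)) ω ^ 2 : ℝ) : ℂ) := by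
  rw [wignerEntry_conj i j, wignerEntry_eq_re_add_im h]
  simp
  linear_combination -(entryVar Xd Xre Xim (Sum.inr (Sum.inr ⟨(i, j), h⟩)) ω : ℂ) ^ 2 *
    Complex.I_sq

variable [mΩ : MeasurableSpace Ω] {P : Measure Ω} {Q : Measure ℝ} {b : ℝ}

lemma integral_wignerEntry_self (hQ : WignerMoments Q b) (hX : IsWignerFamily P Q Xd Xre Xim)
    (i : ℕ) : ∫ ω, wignerEntry Xd Xre Xim i i ω ∂P = 0 := by
  have h1 := integral_comp_entryVar hX (Sum.inl i) measurable_id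
  simp only [id] at h1
  rw [hQ.mean] at h1
  simp only [wignerEntry_self_eq]
  rw [integral_complex_ofReal, integral_const_mul, h1]
  simp

lemma integral_wignerEntry_self_sq (hQ : WignerMoments Q b) (hX : IsWignerFamily P Q Xd Xre Xim)
    (i : ℕ) : ∫ ω, wignerEntry Xd Xre Xim i i ω * wignerEntry Xd Xre Xim i i ω ∂P = 1 := by
  have h1 := integral_comp_entryVar hX (Sum.inl i) (measurable_id.pow_const 2)
  simp only [id] at h1
  rw [hQ.second] at h1
  have hexp : ∀ ω, wignerEntry Xd Xre Xim i i ω * wignerEntry Xd Xre Xim i i ω =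
      ((2 * entryVar Xd Xre Xim (Sum.inl i) ω ^ 2 : ℝ) : ℂ) := by
    intro ω
    rw [wignerEntry_self_eq, ← Complex.ofReal_mul]
    congr 1
    have : √(2 : ℝ) ^ 2 = 2 := Real.sq_sqrt (by norm_num)
    linear_combination entryVar Xd Xre Xim (Sum.inl i) ω ^ 2 * this
  simp only [hexp]
  rw [integral_complex_ofReal, integral_const_mul, h1]
  norm_num

lemma integral_entryVar_mul_entryVar (hX : IsWignerFamily P Q Xd Xre Xim)
    {e e' : EntryIndex} (he : e ≠ e') {f g : ℝ → ℝ} (hf : Measurable f) (hg : Measurable g) :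
    ∫ ω, f (entryVar Xd Xre Xim e ω) * g (entryVar Xd Xre Xim e' ω) ∂P =
      (∫ x, f x ∂Q) * ∫ x, g x ∂Q := by
  have h : IndepFun (entryVar Xd Xre Xim e) (entryVar Xd Xre Xim e') P := hX.indep.indepFun he
  have hmul := (h.comp hf hg).integral_fun_mul_eq_mul_integral
    (hf.comp (measurable_entryVar hX e)).aestronglyMeasurable
    (hg.comp (measurable_entryVar hX e')).aestronglyMeasurable
  simp only [Function.comp_apply] at hmul
  rw [hmul, integral_comp_entryVar hX e hf, integral_comp_entryVar hX e' hg]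

variable [IsProbabilityMeasure P]

lemma integrable_entryVar_mul_entryVar (hQ : WignerMoments Q b)
    (hX : IsWignerFamily P Q Xd Xre Xim) {e e' : EntryIndex} (he : e ≠ e') {k l : ℕ}
    (hk : k ≤ 4) (hl : l ≤ 4) :
    Integrable (fun ω => entryVar Xd Xre Xim e ω ^ k * entryVar Xd Xre Xim e' ω ^ l) P := by
  have h : IndepFun (entryVar Xd Xre Xim e) (entryVar Xd Xre Xim e') P := hX.indep.indepFun he
  exact (h.comp (measurable_id.pow_const k) (measurable_id.pow_const l)).integrable_mul
    (integrable_entryVar_pow hQ hX e hk) (integrable_entryVar_pow hQ hX e' hl)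

lemma integral_wignerEntry (hQ : WignerMoments Q b) (hX : IsWignerFamily P Q Xd Xre Xim)
    {i j : ℕ} (h : i < j) : ∫ ω, wignerEntry Xd Xre Xim i j ω ∂P = 0 := by
  set e : EntryIndex := Sum.inr (Sum.inl ⟨(i, j), h⟩) with he
  set e' : EntryIndex := Sum.inr (Sum.inr ⟨(i, j), h⟩) with he'
  have h1 := integral_comp_entryVar hX e measurable_id
  have h2 := integral_comp_entryVar hX e' measurable_id
  have i1 := integrable_entryVar_pow hQ hX e (k := 1) (by norm_num)
  have i2 := integrable_entryVar_pow hQ hX e' (k := 1) (by norm_num)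
  simp only [pow_one, id] at h1 h2 i1 i2
  rw [hQ.mean] at h1 h2
  simp only [wignerEntry_eq_re_add_im h]
  rw [integral_add i1.ofReal (i2.ofReal.const_mul _), integral_const_mul, integral_complex_ofReal,
    integral_complex_ofReal, h1, h2]
  simp

/-- The real and imaginary parts have equal variances, which cancel, and are uncorrelated. -/
lemma integral_wignerEntry_sq (hQ : WignerMoments Q b) (hX : IsWignerFamily P Q Xd Xre Xim)
    {i j : ℕ} (h : i < j) :
    ∫ ω, wignerEntry Xd Xre Xim i j ω * wignerEntry Xd Xre Xim i j ω ∂P = 0 := by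
  set e : EntryIndex := Sum.inr (Sum.inl ⟨(i, j), h⟩) with he
  set e' : EntryIndex := Sum.inr (Sum.inr ⟨(i, j), h⟩) with he'
  have hne : e ≠ e' := by simp [he, he']
  have h1 := integral_comp_entryVar hX e (measurable_id.pow_const 2)
  have h2 := integral_comp_entryVar hX e' (measurable_id.pow_const 2)
  have h3 := integral_entryVar_mul_entryVar hX hne measurable_id measurable_id
  have i1 := integrable_entryVar_pow hQ hX e (k := 2) (by norm_num)
  have i2 := integrable_entryVar_pow hQ hX e' (k := 2) (by norm_num)
  have i3 := integrable_entryVar_mul_entryVar hQ hX hne (k := 1) (l := 1) (by norm_num)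
    (by norm_num)
  simp only [pow_one, id] at h1 h2 h3 i3
  rw [hQ.second] at h1 h2
  rw [hQ.mean] at h3
  have hexp : ∀ ω, wignerEntry Xd Xre Xim i j ω * wignerEntry Xd Xre Xim i j ω =
      ((entryVar Xd Xre Xim e ω ^ 2 - entryVar Xd Xre Xim e' ω ^ 2 : ℝ) : ℂ) +
      2 * Complex.I * ((entryVar Xd Xre Xim e ω * entryVar Xd Xre Xim e' ω : ℝ) : ℂ) := by
    intro ω
    rw [wignerEntry_eq_re_add_im h]
    push_cast
    linear_combination (entryVar Xd Xre Xim e' ω : ℂ) ^ 2 * Complex.I_sq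
  simp only [hexp]
  rw [integral_add (i1.sub i2).ofReal (i3.ofReal.const_mul _), integral_const_mul,
    integral_complex_ofReal, integral_complex_ofReal, h3, integral_sub i1 i2, h1, h2]
  simp

lemma integral_normSq_wignerEntry (hQ : WignerMoments Q b) (hX : IsWignerFamily P Q Xd Xre Xim)
    {i j : ℕ} (h : i < j) :
    ∫ ω, wignerEntry Xd Xre Xim j i ω * wignerEntry Xd Xre Xim i j ω ∂P = 1 := by
  simp only [star_mul_self_wignerEntry h]
  set e : EntryIndex := Sum.inr (Sum.inl ⟨(i, j), h⟩) with he
  set e' : EntryIndex := Sum.inr (Sum.inr ⟨(i, j), h⟩) with he'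
  have h1 := integral_comp_entryVar hX e (measurable_id.pow_const 2)
  have h2 := integral_comp_entryVar hX e' (measurable_id.pow_const 2)
  have i1 := integrable_entryVar_pow hQ hX e (k := 2) (by norm_num)
  have i2 := integrable_entryVar_pow hQ hX e' (k := 2) (by norm_num)
  simp only [id] at h1 h2
  rw [hQ.second] at h1 h2
  rw [integral_complex_ofReal, integral_add i1 i2, h1, h2]
  norm_num

/-- The two fourth powers give 2b and the cross term 2 · (1/2)². Written as 2 + 2(b - 3/4), the
value exhibits the deviation from the complex Gaussian. -/
lemma integral_normSq_wignerEntry_sq (hQ : WignerMoments Q b)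
    (hX : IsWignerFamily P Q Xd Xre Xim) {i j : ℕ} (h : i < j) :
    ∫ ω, wignerEntry Xd Xre Xim j i ω * wignerEntry Xd Xre Xim i j ω *
      (wignerEntry Xd Xre Xim j i ω * wignerEntry Xd Xre Xim i j ω) ∂P =
      ((2 * b + 1 / 2 : ℝ) : ℂ) := by
  simp only [star_mul_self_wignerEntry h, ← Complex.ofReal_mul]
  set e : EntryIndex := Sum.inr (Sum.inl ⟨(i, j), h⟩) with he
  set e' : EntryIndex := Sum.inr (Sum.inr ⟨(i, j), h⟩) with he'
  have hne : e ≠ e' := by simp [he, he']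
  have h1 := integral_comp_entryVar hX e (measurable_id.pow_const 4)
  have h2 := integral_comp_entryVar hX e' (measurable_id.pow_const 4)
  have h3 := integral_entryVar_mul_entryVar hX hne (measurable_id.pow_const 2)
    (measurable_id.pow_const 2)
  have i1 := integrable_entryVar_pow hQ hX e (k := 4) (by norm_num)
  have i2 := integrable_entryVar_pow hQ hX e' (k := 4) (by norm_num)
  have i3 := integrable_entryVar_mul_entryVar hQ hX hne (k := 2) (l := 2) (by norm_num)
    (by norm_num)
  simp only [id] at h1 h2 h3
  rw [hQ.fourth] at h1 h2
  rw [hQ.second] at h3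
  have hexp : ∀ ω, (entryVar Xd Xre Xim e ω ^ 2 + entryVar Xd Xre Xim e' ω ^ 2) *
      (entryVar Xd Xre Xim e ω ^ 2 + entryVar Xd Xre Xim e' ω ^ 2) =
      (entryVar Xd Xre Xim e ω ^ 4 + entryVar Xd Xre Xim e' ω ^ 4) +
      2 * (entryVar Xd Xre Xim e ω ^ 2 * entryVar Xd Xre Xim e' ω ^ 2) := by
    intro ω; ring
  simp only [hexp]
  have i12 : Integrable (fun ω => entryVar Xd Xre Xim e ω ^ 4 + entryVar Xd Xre Xim e' ω ^ 4) P :=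
    i1.add i2
  rw [integral_complex_ofReal, integral_add i12 (i3.const_mul _), integral_add i1 i2,
    integral_const_mul, h1, h2, h3]
  congr 1; ring

lemma integral_star_wignerEntry (hQ : WignerMoments Q b) (hX : IsWignerFamily P Q Xd Xre Xim)
    {i j : ℕ} (h : i < j) : ∫ ω, wignerEntry Xd Xre Xim j i ω ∂P = 0 := by
  have h1 : ∀ ω, wignerEntry Xd Xre Xim j i ω =
      (starRingEnd ℂ) (wignerEntry Xd Xre Xim i j ω) := fun ω => wignerEntry_conj i j ω
  simp only [h1]
  rw [integral_conj, integral_wignerEntry hQ hX h, map_zero]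

/-- A product with an isolated off-diagonal factor has mean zero. -/
lemma integral_mul_wignerEntry_eq_zero (hQ : WignerMoments Q b)
    (hX : IsWignerFamily P Q Xd Xre Xim) {i j : ℕ} (h : i < j) {f : Ω → ℂ}
    (hf : Measurable[entrySigma Xd Xre Xim {(i, j)}ᶜ] f) :
    ∫ ω, f ω * wignerEntry Xd Xre Xim i j ω ∂P = 0 := by
  rw [integral_mul_of_measurable_entrySigma hX disjoint_compl_left hf
    (measurable_wignerEntry_of_le h.le rfl), integral_wignerEntry hQ hX h, mul_zero]

lemma integral_mul_star_wignerEntry_eq_zero (hQ : WignerMoments Q b)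
    (hX : IsWignerFamily P Q Xd Xre Xim) {i j : ℕ} (h : i < j) {f : Ω → ℂ}
    (hf : Measurable[entrySigma Xd Xre Xim {(i, j)}ᶜ] f) :
    ∫ ω, f ω * wignerEntry Xd Xre Xim j i ω ∂P = 0 := by
  rw [integral_mul_of_measurable_entrySigma hX disjoint_compl_left hf
    (measurable_wignerEntry (by rw [min_eq_right h.le, max_eq_left h.le]; rfl)),
    integral_star_wignerEntry hQ hX h, mul_zero]

/-- The second mixed moments of a row of a Wigner matrix. -/
lemma integral_row_two (hQ : WignerMoments Q b) (hX : IsWignerFamily P Q Xd Xre Xim)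
    {N : ℕ} (i j : Fin N) :
    ∫ ω, wignerEntry Xd Xre Xim N i ω * wignerEntry Xd Xre Xim j N ω ∂P =
      if i = j then 1 else 0 := by
  split_ifs with hij
  · subst hij
    exact integral_normSq_wignerEntry hQ hX i.2
  · refine integral_mul_wignerEntry_eq_zero hQ hX j.2 (measurable_wignerEntry ?_)
    rw [min_eq_right i.2.le, max_eq_left i.2.le]
    simpa [Fin.ext_iff] using hij

/-- The fourth mixed moments of a row of a Wigner matrix. -/
lemma integral_row_four (hQ : WignerMoments Q b) (hX : IsWignerFamily P Q Xd Xre Xim)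
    {N : ℕ} (i j k l : Fin N) :
    ∫ ω, wignerEntry Xd Xre Xim N i ω * wignerEntry Xd Xre Xim j N ω *
        (wignerEntry Xd Xre Xim N k ω * wignerEntry Xd Xre Xim l N ω) ∂P =
      (if i = j ∧ k = l then 1 else 0) + (if i = l ∧ j = k then 1 else 0) +
      (if i = j ∧ k = l ∧ i = k then ((2 * (b - 3 / 4) : ℝ) : ℂ) else 0) := by
  have m1 : ∀ i m : Fin N, i ≠ m → Measurable[entrySigma Xd Xre Xim {((m : ℕ), N)}ᶜ]
      (wignerEntry Xd Xre Xim N i) := fun i m h => measurable_wignerEntry (by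
    rw [min_eq_right i.2.le, max_eq_left i.2.le]; simpa [Fin.ext_iff] using h)
  have m2 : ∀ i m : Fin N, i ≠ m → Measurable[entrySigma Xd Xre Xim {((m : ℕ), N)}ᶜ]
      (wignerEntry Xd Xre Xim i N) := fun i m h => measurable_wignerEntry_of_le i.2.le (by
    simpa [Fin.ext_iff] using h)
  have n1 : ∀ m : Fin N, Measurable[entrySigma Xd Xre Xim {((m : ℕ), N)}]
      (wignerEntry Xd Xre Xim N m) := fun m => measurable_wignerEntry (by
    rw [min_eq_right m.2.le, max_eq_left m.2.le]; rfl)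
  have n2 : ∀ m : Fin N, Measurable[entrySigma Xd Xre Xim {((m : ℕ), N)}]
      (wignerEntry Xd Xre Xim m N) := fun m => measurable_wignerEntry_of_le m.2.le rfl
  -- the four positions in which an index can be isolated
  have z1 : i ≠ j → i ≠ k → i ≠ l → ∫ ω, wignerEntry Xd Xre Xim N i ω *
      wignerEntry Xd Xre Xim j N ω *
        (wignerEntry Xd Xre Xim N k ω * wignerEntry Xd Xre Xim l N ω) ∂P = 0 := by
    intro h1 h2 h3
    rw [← integral_mul_star_wignerEntry_eq_zero hQ hX i.2
      ((m2 j i h1.symm).mul ((m1 k i h2.symm).mul (m2 l i h3.symm)))]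
    congr 1; ext ω; simp only [Pi.mul_apply]; ring
  have z2 : j ≠ i → j ≠ k → j ≠ l → ∫ ω, wignerEntry Xd Xre Xim N i ω *
      wignerEntry Xd Xre Xim j N ω *
        (wignerEntry Xd Xre Xim N k ω * wignerEntry Xd Xre Xim l N ω) ∂P = 0 := by
    intro h1 h2 h3
    rw [← integral_mul_wignerEntry_eq_zero hQ hX j.2
      ((m1 i j h1.symm).mul ((m1 k j h2.symm).mul (m2 l j h3.symm)))]
    congr 1; ext ω; simp only [Pi.mul_apply]; ring
  have z3 : k ≠ i → k ≠ j → k ≠ l → ∫ ω, wignerEntry Xd Xre Xim N i ω *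
      wignerEntry Xd Xre Xim j N ω *
        (wignerEntry Xd Xre Xim N k ω * wignerEntry Xd Xre Xim l N ω) ∂P = 0 := by
    intro h1 h2 h3
    rw [← integral_mul_star_wignerEntry_eq_zero hQ hX k.2
      ((m1 i k h1.symm).mul ((m2 j k h2.symm).mul (m2 l k h3.symm)))]
    congr 1; ext ω; simp only [Pi.mul_apply]; ring
  have z4 : l ≠ i → l ≠ j → l ≠ k → ∫ ω, wignerEntry Xd Xre Xim N i ω *
      wignerEntry Xd Xre Xim j N ω *
        (wignerEntry Xd Xre Xim N k ω * wignerEntry Xd Xre Xim l N ω) ∂P = 0 := by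
    intro h1 h2 h3
    rw [← integral_mul_wignerEntry_eq_zero hQ hX l.2
      ((m1 i l h1.symm).mul ((m2 j l h2.symm).mul (m1 k l h3.symm)))]
    congr 1; ext ω; simp only [Pi.mul_apply]; ring
  -- An index distinct from the other three kills the expectation, so only pairings remain. The
  -- pairing i = k, j = l with i ≠ j vanishes because E X_ij² = 0. When all indices agree, the two
  -- other pairings both count and give 2, so the last indicator has to supply 2(b - 3/4).
  by_cases hij : i = j
  · subst hij
    by_cases hkl : k = l
    · subst hkl
      by_cases hik : i = k
      · subst hik
        rw [integral_normSq_wignerEntry_sq hQ hX i.2]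
        simp
        ring
      · have hmul := integral_mul_of_measurable_entrySigma hX disjoint_compl_left
          ((m1 i k hik).mul (m2 i k hik)) ((n1 k).mul (n2 k))
        simp only [Pi.mul_apply, integral_normSq_wignerEntry hQ hX i.2,
          integral_normSq_wignerEntry hQ hX k.2] at hmul
        rw [hmul]
        simp [hik]
    · have hz : ¬(i = l ∧ i = k) := fun h => hkl (h.2.symm.trans h.1)
      simp only [hkl, hz, and_false, false_and, if_false, add_zero]
      by_cases hli : l = i
      · exact z3 (fun h => hkl (h.trans hli.symm)) (fun h => hkl (h.trans hli.symm)) hkl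
      · exact z4 hli hli (fun h => hkl h.symm)
  · simp only [hij, false_and, if_false, zero_add, add_zero]
    by_cases hil : i = l
    · subst hil
      by_cases hjk : j = k
      · subst hjk
        have hmul := integral_mul_of_measurable_entrySigma hX disjoint_compl_left
          ((m1 i j hij).mul (m2 i j hij)) ((n1 j).mul (n2 j))
        simp only [Pi.mul_apply, integral_normSq_wignerEntry hQ hX i.2,
          integral_normSq_wignerEntry hQ hX j.2] at hmul
        simp only [and_self, if_true]
        rw [← mul_one (1 : ℂ), ← hmul]
        congr 1; ext ω; ring
      · simp only [hjk, and_false, if_false]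
        exact z2 (fun h => hij h.symm) hjk (fun h => hij h.symm)
    · simp only [hil, false_and, if_false]
      by_cases hik : i = k
      · subst hik
        by_cases hjl : j = l
        · subst hjl
          have hmul := integral_mul_of_measurable_entrySigma hX disjoint_compl_left
            ((m1 i j hij).mul (m1 i j hij)) ((n2 j).mul (n2 j))
          simp only [Pi.mul_apply, integral_wignerEntry_sq hQ hX j.2, mul_zero] at hmul
          rw [← hmul]
          congr 1; ext ω; ring
        · exact z2 (fun h => hij h.symm) (fun h => hij h.symm) hjl
      · exact z1 hij hik hil

end Moments

/-! ### Entrywise bounds for determinants and adjugates -/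

section DeterminantBounds

variable {n : Type*} [Fintype n] [DecidableEq n]

/-- In each Leibniz term every index occurs once as a row and once as a column, so the term is at
most the product of the squares. -/
lemma norm_det_le_factorial_mul_prod_sq {M : Matrix n n ℂ} {r : n → ℝ}
    (h : ∀ i j, ‖M i j‖ ≤ r i * r j) :
    ‖M.det‖ ≤ (Fintype.card n).factorial * ∏ i, r i ^ 2 := by
  rw [Matrix.det_apply]
  have hterm : ∀ σ : Equiv.Perm n, ‖Equiv.Perm.sign σ • ∏ i, M (σ i) i‖ ≤ ∏ i, r i ^ 2 := by
    intro σ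
    have hsign : ‖Equiv.Perm.sign σ • ∏ i, M (σ i) i‖ = ‖∏ i, M (σ i) i‖ := by
      rcases Int.units_eq_one_or (Equiv.Perm.sign σ) with h | h <;> simp [h]
    rw [hsign, norm_prod]
    calc ∏ i, ‖M (σ i) i‖ ≤ ∏ i, r (σ i) * r i :=
          Finset.prod_le_prod (fun _ _ => norm_nonneg _) fun i _ => h _ _
      _ = ∏ i, r i ^ 2 := by
          rw [Finset.prod_mul_distrib, Equiv.prod_comp σ r, ← Finset.prod_mul_distrib]
          simp only [sq]
  calc ‖∑ σ : Equiv.Perm n, Equiv.Perm.sign σ • ∏ i, M (σ i) i‖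
      ≤ ∑ σ : Equiv.Perm n, ‖Equiv.Perm.sign σ • ∏ i, M (σ i) i‖ := norm_sum_le _ _
    _ ≤ ∑ _σ : Equiv.Perm n, ∏ i, r i ^ 2 := Finset.sum_le_sum fun σ _ => hterm σ
    _ = _ := by rw [Finset.sum_const, Finset.card_univ, Fintype.card_perm, nsmul_eq_mul]

/-- A cofactor is a determinant with one row replaced by a unit vector, and `1 ≤ r i` keeps the
entry bound valid on that row. -/
lemma norm_adjugate_le_factorial_mul_prod_sq {M : Matrix n n ℂ} {r : n → ℝ} (hr : ∀ i, 1 ≤ r i)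
    (h : ∀ i j, ‖M i j‖ ≤ r i * r j) (k l : n) :
    ‖M.adjugate k l‖ ≤ (Fintype.card n).factorial * ∏ i, r i ^ 2 := by
  rw [Matrix.adjugate_apply]
  refine norm_det_le_factorial_mul_prod_sq fun i j => ?_
  rw [Matrix.updateRow_apply]
  split_ifs with hi
  · refine le_trans ?_ (one_le_mul_of_one_le_of_one_le (hr i) (hr j))
    rw [Pi.single_apply]
    split_ifs <;> simp
  · exact h i j

end DeterminantBounds

/-! ### Square integrability of determinants and adjugates -/

section Domination

variable {Ω : Type*}

/-- The matrix `X_N - s`. -/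
noncomputable def shiftedWigner (Xd : ℕ → Ω → ℝ) (Xre Xim : UpperIndex → Ω → ℝ) (N : ℕ) (s : ℝ)
    (ω : Ω) : Matrix (Fin N) (Fin N) ℂ :=
  wignerMatrix Xd Xre Xim N ω - (s : ℂ) • (1 : Matrix (Fin N) (Fin N) ℂ)

/-- A bound for the entries in row `k` of a Wigner matrix up to the diagonal. -/
noncomputable def rowBound (Xd : ℕ → Ω → ℝ) (Xre Xim : UpperIndex → Ω → ℝ) (K : ℝ) (k : ℕ)
    (ω : Ω) : ℝ :=
  K + ∑ i ∈ Finset.range (k + 1), ‖wignerEntry Xd Xre Xim i k ω‖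

variable {Xd : ℕ → Ω → ℝ} {Xre Xim : UpperIndex → Ω → ℝ}

lemma shiftedWigner_apply (N : ℕ) (s : ℝ) (ω : Ω) (i j : Fin N) :
    shiftedWigner Xd Xre Xim N s ω i j =
      wignerEntry Xd Xre Xim i j ω - if i = j then (s : ℂ) else 0 := by
  simp [shiftedWigner, wignerMatrix_apply, Matrix.one_apply]

lemma le_rowBound {K : ℝ} (k : ℕ) (ω : Ω) : K ≤ rowBound Xd Xre Xim K k ω :=
  le_add_of_nonneg_right (Finset.sum_nonneg fun _ _ => norm_nonneg _)

lemma norm_wignerEntry_add_le_rowBound {K : ℝ} {i k : ℕ} (h : i ≤ k) (ω : Ω) :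
    ‖wignerEntry Xd Xre Xim i k ω‖ + K ≤ rowBound Xd Xre Xim K k ω := by
  rw [rowBound, add_comm]
  gcongr
  exact Finset.single_le_sum (f := fun i => ‖wignerEntry Xd Xre Xim i k ω‖)
    (fun _ _ => norm_nonneg _) (Finset.mem_range.mpr (Nat.lt_succ_of_le h))

/-- The factor with the larger index already contains the entry and `K`; the other factor is at
least 1. The product form is what the determinant bound requires. -/
lemma norm_shiftedWigner_le {K : ℝ} (hK : 1 ≤ K) {s : ℝ} (hs : |s| ≤ K) (N : ℕ) (ω : Ω)
    (i j : Fin N) : ‖shiftedWigner Xd Xre Xim N s ω i j‖ ≤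
      rowBound Xd Xre Xim K i ω * rowBound Xd Xre Xim K j ω := by
  have h1 : ∀ k, 1 ≤ rowBound Xd Xre Xim K k ω := fun k => hK.trans (le_rowBound k ω)
  have hsum : ∀ i j : ℕ, i ≤ j → ‖wignerEntry Xd Xre Xim i j ω‖ + K ≤
      rowBound Xd Xre Xim K i ω * rowBound Xd Xre Xim K j ω := fun i j h =>
    (norm_wignerEntry_add_le_rowBound h ω).trans
      (le_mul_of_one_le_left (zero_le_one.trans (h1 j)) (h1 i))
  have hsum' : ‖wignerEntry Xd Xre Xim i j ω‖ + K ≤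
      rowBound Xd Xre Xim K i ω * rowBound Xd Xre Xim K j ω := by
    rcases le_total (i : ℕ) (j : ℕ) with h | h
    · exact hsum i j h
    · rw [norm_wignerEntry_comm, mul_comm]
      exact hsum j i h
  rw [shiftedWigner_apply]
  have hite : ‖if i = j then (s : ℂ) else 0‖ ≤ K := by
    split_ifs
    · simpa using hs
    · simpa using zero_le_one.trans hK
  exact (norm_sub_le _ _).trans ((add_le_add le_rfl hite).trans hsum')

lemma norm_det_shiftedWigner_le {K : ℝ} (hK : 1 ≤ K) {s : ℝ} (hs : |s| ≤ K) (N : ℕ) (ω : Ω) :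
    ‖(shiftedWigner Xd Xre Xim N s ω).det‖ ≤
      N.factorial * ∏ k ∈ Finset.range N, rowBound Xd Xre Xim K k ω ^ 2 := by
  have h := norm_det_le_factorial_mul_prod_sq (M := shiftedWigner Xd Xre Xim N s ω)
    (r := fun i => rowBound Xd Xre Xim K i ω) fun i j => norm_shiftedWigner_le hK hs N ω i j
  rwa [Fintype.card_fin, Fin.prod_univ_eq_prod_range
    (fun k => rowBound Xd Xre Xim K k ω ^ 2)] at h

lemma norm_adjugate_shiftedWigner_le {K : ℝ} (hK : 1 ≤ K) {s : ℝ} (hs : |s| ≤ K) (N : ℕ) (ω : Ω)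
    (i j : Fin N) : ‖(shiftedWigner Xd Xre Xim N s ω).adjugate i j‖ ≤
      N.factorial * ∏ k ∈ Finset.range N, rowBound Xd Xre Xim K k ω ^ 2 := by
  have h := norm_adjugate_le_factorial_mul_prod_sq (M := shiftedWigner Xd Xre Xim N s ω)
    (r := fun i => rowBound Xd Xre Xim K i ω) (fun i => hK.trans (le_rowBound _ ω))
    (fun i j => norm_shiftedWigner_le hK hs N ω i j) i j
  rwa [Fintype.card_fin, Fin.prod_univ_eq_prod_range
    (fun k => rowBound Xd Xre Xim K k ω ^ 2)] at h

lemma measurable_rowBound (K : ℝ) (k : ℕ) :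
    Measurable[entrySigma Xd Xre Xim {p | p.2 = k}] (rowBound Xd Xre Xim K k) := by
  let _ := entrySigma Xd Xre Xim {p | p.2 = k}
  have h : Measurable fun ω => ∑ i ∈ Finset.range (k + 1), ‖wignerEntry Xd Xre Xim i k ω‖ := by
    refine Finset.measurable_fun_sum _ fun i hi => ?_
    have hik : (i, k) ∈ {p : ℕ × ℕ | p.2 = k} := rfl
    exact (measurable_wignerEntry_of_le (Xd := Xd) (Xre := Xre) (Xim := Xim)
      (Nat.lt_succ_iff.mp (Finset.mem_range.mp hi)) hik).norm
  exact h.const_add K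

lemma measurable_det_shiftedWigner (N : ℕ) (s : ℝ) :
    Measurable[entrySigma Xd Xre Xim {p | p.2 < N}]
      fun ω => (shiftedWigner Xd Xre Xim N s ω).det := by
  let _ := entrySigma Xd Xre Xim {p | p.2 < N}
  have hentry : ∀ i j, Measurable fun ω => shiftedWigner Xd Xre Xim N s ω i j := by
    intro i j
    simp only [shiftedWigner_apply]
    exact (measurable_wignerEntry (max_lt i.2 j.2 : max (i : ℕ) j < N)).sub_const _
  simp only [Matrix.det_apply]
  exact Finset.measurable_fun_sum _ fun σ _ =>
    (Finset.measurable_fun_prod _ fun i _ => hentry _ _).const_smul _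

lemma measurable_adjugate_shiftedWigner (N : ℕ) (s : ℝ) (i j : Fin N) :
    Measurable[entrySigma Xd Xre Xim {p | p.2 < N}]
      fun ω => (shiftedWigner Xd Xre Xim N s ω).adjugate i j := by
  let _ := entrySigma Xd Xre Xim {p | p.2 < N}
  have hentry : ∀ k l, Measurable fun ω =>
      (shiftedWigner Xd Xre Xim N s ω).updateRow j (Pi.single i 1) k l := by
    intro k l
    simp only [Matrix.updateRow_apply]
    split_ifs
    · exact measurable_const
    · simp only [shiftedWigner_apply]
      exact (measurable_wignerEntry (max_lt k.2 l.2 : max (k : ℕ) l < N)).sub_const _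
  simp only [Matrix.adjugate_apply, Matrix.det_apply]
  exact Finset.measurable_fun_sum _ fun σ _ =>
    (Finset.measurable_fun_prod _ fun i _ => hentry _ _).const_smul _

variable [mΩ : MeasurableSpace Ω] {P : Measure Ω} [IsProbabilityMeasure P] {Q : Measure ℝ} {b : ℝ}

lemma integrable_rowBound_pow_four (hQ : WignerMoments Q b) (hX : IsWignerFamily P Q Xd Xre Xim)
    {K : ℝ} (hK : 0 ≤ K) (k : ℕ) :
    Integrable (fun ω => rowBound Xd Xre Xim K k ω ^ 4) P := by
  have h : MemLp (rowBound Xd Xre Xim K k) (4 : ℕ) P := by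
    refine (memLp_const K).add (memLp_finsetSum _ fun i hi => ?_)
    exact_mod_cast (memLp_wignerEntry_of_le hQ hX
      (Nat.lt_succ_iff.mp (Finset.mem_range.mp hi))).norm
  refine h.integrable_norm_pow'.congr (ae_of_all _ fun ω => ?_)
  simp only [Real.norm_of_nonneg (hK.trans (le_rowBound k ω))]

/-- The bounds for different k involve disjoint positions (i, k), i ≤ k, hence are independent.
Therefore fourth moments of the single entries suffice for determinants of any size to be square
integrable. -/
lemma integrable_prod_rowBound_pow_four (hQ : WignerMoments Q b)
    (hX : IsWignerFamily P Q Xd Xre Xim) {K : ℝ} (hK : 0 ≤ K) (N : ℕ) :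
    Integrable (fun ω => ∏ k ∈ Finset.range N, rowBound Xd Xre Xim K k ω ^ 4) P := by
  induction N with
  | zero => simp
  | succ N ih =>
    simp only [Finset.prod_range_succ]
    refine IndepFun.integrable_mul (indepFun_of_measurable_entrySigma hX
      (S := {p | p.2 < N}) (T := {p | p.2 = N}) ?_ ?_ ?_) ih
      (integrable_rowBound_pow_four hQ hX hK N)
    · exact Set.disjoint_left.mpr fun p h1 h2 => (h1.trans_eq h2.symm).false
    · let _ := entrySigma Xd Xre Xim {p | p.2 < N}
      refine Finset.measurable_fun_prod _ fun k hk => Measurable.pow_const ?_ 4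
      refine (measurable_rowBound K k).mono (iSup₂_mono' fun e he => ⟨e, ?_, le_rfl⟩) le_rfl
      exact (he : (entryPosition e).2 = k).trans_lt (Finset.mem_range.mp hk)
    · let _ := entrySigma Xd Xre Xim {p | p.2 = N}
      exact (measurable_rowBound K N).pow_const 4

lemma memLp_prod_rowBound_sq (hQ : WignerMoments Q b) (hX : IsWignerFamily P Q Xd Xre Xim)
    {K : ℝ} (hK : 0 ≤ K) (N : ℕ) :
    MemLp (fun ω => ∏ k ∈ Finset.range N, rowBound Xd Xre Xim K k ω ^ 2) 2 P := by
  rw [memLp_two_iff_integrable_sq]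
  · refine (integrable_prod_rowBound_pow_four hQ hX hK N).congr (ae_of_all _ fun ω => ?_)
    simp only [← Finset.prod_pow, ← pow_mul]
  · exact (Finset.measurable_fun_prod _ fun k _ => ((measurable_rowBound K k).mono
      (entrySigma_le hX _) le_rfl).pow_const 2).aestronglyMeasurable

lemma memLp_det_shiftedWigner (hQ : WignerMoments Q b) (hX : IsWignerFamily P Q Xd Xre Xim)
    (N : ℕ) (s : ℝ) : MemLp (fun ω => (shiftedWigner Xd Xre Xim N s ω).det) 2 P :=
  ((memLp_prod_rowBound_sq hQ hX (zero_le_one.trans (le_max_left 1 |s|)) N).const_mul _).mono'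
    ((measurable_det_shiftedWigner N s).mono (entrySigma_le hX _) le_rfl).aestronglyMeasurable
    (ae_of_all _ fun ω => norm_det_shiftedWigner_le (le_max_left _ _) (le_max_right _ _) N ω)

lemma memLp_adjugate_shiftedWigner (hQ : WignerMoments Q b) (hX : IsWignerFamily P Q Xd Xre Xim)
    (N : ℕ) (s : ℝ) (i j : Fin N) :
    MemLp (fun ω => (shiftedWigner Xd Xre Xim N s ω).adjugate i j) 2 P :=
  ((memLp_prod_rowBound_sq hQ hX (zero_le_one.trans (le_max_left 1 |s|)) N).const_mul _).mono'
    ((measurable_adjugate_shiftedWigner N s i j).mono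
      (entrySigma_le hX _) le_rfl).aestronglyMeasurable
    (ae_of_all _ fun ω => norm_adjugate_shiftedWigner_le (le_max_left _ _) (le_max_right _ _)
      N ω i j)

lemma integrable_charProd (hQ : WignerMoments Q b) (hX : IsWignerFamily P Q Xd Xre Xim)
    (N : ℕ) (s t : ℝ) : Integrable (charProd Xd Xre Xim N s t) P :=
  (memLp_det_shiftedWigner hQ hX N s).integrable_mul (memLp_det_shiftedWigner hQ hX N t)

end Domination

/-! ### Differentiation under the expectation -/

section Differentiation

variable {Ω : Type*} {Xd : ℕ → Ω → ℝ} {Xre Xim : UpperIndex → Ω → ℝ}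
  [mΩ : MeasurableSpace Ω] {P : Measure Ω} [IsProbabilityMeasure P] {Q : Measure ℝ} {b : ℝ}

lemma memLp_trace_adjugate_shiftedWigner (hQ : WignerMoments Q b)
    (hX : IsWignerFamily P Q Xd Xre Xim) (N : ℕ) (s : ℝ) :
    MemLp (fun ω => (shiftedWigner Xd Xre Xim N s ω).adjugate.trace) 2 P :=
  memLp_finsetSum _ fun i _ => memLp_adjugate_shiftedWigner hQ hX N s i i

/-- Differentiation of an expectation containing a characteristic polynomial. -/
lemma hasDerivAt_integral_det_shiftedWigner_mul (hQ : WignerMoments Q b)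
    (hX : IsWignerFamily P Q Xd Xre Xim) (N : ℕ) (s : ℝ) {g : Ω → ℂ} (hg : MemLp g 2 P) :
    HasDerivAt (fun s => ∫ ω, (shiftedWigner Xd Xre Xim N s ω).det * g ω ∂P)
      (-∫ ω, (shiftedWigner Xd Xre Xim N s ω).adjugate.trace * g ω ∂P) s := by
  -- This value bounds |x| on the whole unit ball around `s`, so that one majorant serves all the
  -- parameters.
  set K : ℝ := |s| + 1
  have hK : 1 ≤ K := le_add_of_nonneg_left (abs_nonneg s)
  have hbound : ∀ x ∈ Metric.ball s 1, |x| ≤ K := by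
    intro x hx
    rw [Metric.mem_ball, Real.dist_eq] at hx
    have := abs_sub_abs_le_abs_sub x s
    simp only [K]
    linarith
  have h := hasDerivAt_integral_of_dominated_loc_of_deriv_le (μ := P) (𝕜 := ℝ)
    (F := fun s ω => (shiftedWigner Xd Xre Xim N s ω).det * g ω)
    (F' := fun s ω => -(shiftedWigner Xd Xre Xim N s ω).adjugate.trace * g ω)
    (bound := fun ω => (N * (N.factorial *
      ∏ k ∈ Finset.range N, rowBound Xd Xre Xim K k ω ^ 2)) * ‖g ω‖)
    (Metric.ball_mem_nhds s one_pos)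
    (Eventually.of_forall fun x =>
      (memLp_det_shiftedWigner hQ hX N x).aestronglyMeasurable.mul hg.aestronglyMeasurable)
    ((memLp_det_shiftedWigner hQ hX N s).integrable_mul hg)
    ((memLp_trace_adjugate_shiftedWigner hQ hX N s).aestronglyMeasurable.neg.mul
      hg.aestronglyMeasurable)
    (ae_of_all _ fun ω x hx => ?_)
    ((((memLp_prod_rowBound_sq hQ hX (zero_le_one.trans hK) N).const_mul _).const_mul
      _).integrable_mul hg.norm)
    (ae_of_all _ fun ω x hx => (hasDerivAt_det_sub_smul_one _ x).mul_const (g ω))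
  · have h2 := h.2
    simp only [neg_mul, integral_neg] at h2
    exact h2
  · rw [norm_mul, norm_neg]
    gcongr
    refine (norm_sum_le _ _).trans ((Finset.sum_le_sum fun i _ =>
      norm_adjugate_shiftedWigner_le hK (hbound x hx) N ω i i).trans_eq ?_)
    rw [Finset.sum_const, Finset.card_univ, Fintype.card_fin, nsmul_eq_mul]

end Differentiation

/-! ### Moments involving the last diagonal entry -/

section Recursion

variable {Ω : Type*} {Xd : ℕ → Ω → ℝ} {Xre Xim : UpperIndex → Ω → ℝ}
  [mΩ : MeasurableSpace Ω] {P : Measure Ω} {Q : Measure ℝ} {b : ℝ}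

lemma memLp_wignerEntry (hQ : WignerMoments Q b) (hX : IsWignerFamily P Q Xd Xre Xim)
    (i j : ℕ) : MemLp (wignerEntry Xd Xre Xim i j) 4 P := by
  rcases le_total i j with h | h
  · exact memLp_wignerEntry_of_le hQ hX h
  · exact (memLp_wignerEntry_of_le hQ hX h).star.ae_eq
      (ae_of_all _ fun ω => (wignerEntry_conj j i ω).symm)

lemma memLp_wignerEntry_mul (hQ : WignerMoments Q b) (hX : IsWignerFamily P Q Xd Xre Xim)
    (i j k l : ℕ) :
    MemLp (fun ω => wignerEntry Xd Xre Xim i j ω * wignerEntry Xd Xre Xim k l ω) 2 P := by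
  have : ENNReal.HolderTriple 4 4 2 := ⟨by
    rw [← two_mul, show (4 : ENNReal) = 2 * 2 by norm_num,
      ENNReal.mul_inv (Or.inl (by norm_num)) (Or.inl (by norm_num)), ← mul_assoc,
      ENNReal.mul_inv_cancel (by norm_num) (by norm_num), one_mul]⟩
  exact (memLp_wignerEntry hQ hX k l).mul (memLp_wignerEntry hQ hX i j)

variable [IsProbabilityMeasure P]

lemma memLp_wignerEntry_sub (hQ : WignerMoments Q b) (hX : IsWignerFamily P Q Xd Xre Xim)
    (i j : ℕ) (s : ℝ) : MemLp (fun ω => wignerEntry Xd Xre Xim i j ω - s) 2 P :=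
  ((memLp_wignerEntry hQ hX i j).mono_exponent (by norm_num)).sub (memLp_const _)

lemma integral_wignerEntry_self_sub (hQ : WignerMoments Q b) (hX : IsWignerFamily P Q Xd Xre Xim)
    (N : ℕ) (s : ℝ) : ∫ ω, (wignerEntry Xd Xre Xim N N ω - s) ∂P = -s := by
  rw [integral_sub ((memLp_wignerEntry hQ hX N N).integrable (by norm_num)) (integrable_const _),
    integral_wignerEntry_self hQ hX]
  simp

lemma integral_wignerEntry_self_sub_mul (hQ : WignerMoments Q b)
    (hX : IsWignerFamily P Q Xd Xre Xim) (N : ℕ) (s t : ℝ) :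
    ∫ ω, (wignerEntry Xd Xre Xim N N ω - s) * (wignerEntry Xd Xre Xim N N ω - t) ∂P =
      1 + s * t := by
  have i1 : Integrable (fun ω => wignerEntry Xd Xre Xim N N ω * wignerEntry Xd Xre Xim N N ω) P :=
    (memLp_wignerEntry_mul hQ hX N N N N).integrable (by norm_num)
  have i2 : Integrable (fun ω => (t : ℂ) * (wignerEntry Xd Xre Xim N N ω - s)) P :=
    ((memLp_wignerEntry_sub hQ hX N N s).integrable (by norm_num)).const_mul _
  have i3 : Integrable (fun ω => (s : ℂ) * wignerEntry Xd Xre Xim N N ω) P :=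
    ((memLp_wignerEntry hQ hX N N).integrable (by norm_num)).const_mul _
  have i13 : Integrable (fun ω => wignerEntry Xd Xre Xim N N ω * wignerEntry Xd Xre Xim N N ω -
    s * wignerEntry Xd Xre Xim N N ω) P := i1.sub i3
  have hexp : ∀ ω, (wignerEntry Xd Xre Xim N N ω - s) * (wignerEntry Xd Xre Xim N N ω - t) =
      wignerEntry Xd Xre Xim N N ω * wignerEntry Xd Xre Xim N N ω -
        s * wignerEntry Xd Xre Xim N N ω - t * (wignerEntry Xd Xre Xim N N ω - s) := by
    intro ω; ring
  simp only [hexp]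
  rw [integral_sub i13 i2, integral_sub i1 i3, integral_const_mul, integral_const_mul,
    integral_wignerEntry_self_sub hQ hX, integral_wignerEntry_self hQ hX,
    integral_wignerEntry_self_sq hQ hX]
  ring

lemma integral_wignerEntry_self_sub_mul_row (hQ : WignerMoments Q b)
    (hX : IsWignerFamily P Q Xd Xre Xim) {N : ℕ} (s : ℝ) (i j : Fin N) :
    ∫ ω, (wignerEntry Xd Xre Xim N N ω - s) *
        (wignerEntry Xd Xre Xim N i ω * wignerEntry Xd Xre Xim j N ω) ∂P =
      -s * if i = j then 1 else 0 := by
  have h1 : ∀ i : Fin N, (min N (i : ℕ), max N (i : ℕ)) ∈ ({(N, N)} : Set (ℕ × ℕ))ᶜ := by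
    intro i
    rw [min_eq_right i.2.le, max_eq_left i.2.le]
    simpa using i.2.ne
  have h2 : ∀ i : Fin N, (min (i : ℕ) N, max (i : ℕ) N) ∈ ({(N, N)} : Set (ℕ × ℕ))ᶜ := by
    intro i
    rw [min_comm, max_comm]
    exact h1 i
  have hm : Measurable[entrySigma Xd Xre Xim {(N, N)}]
      (fun ω => wignerEntry Xd Xre Xim N N ω - s) := by
    have m0 := measurable_wignerEntry_of_le (Xd := Xd) (Xre := Xre) (Xim := Xim)
      (le_refl N) (Set.mem_singleton (N, N))
    exact m0.sub_const _
  have hm2 : Measurable[entrySigma Xd Xre Xim {(N, N)}ᶜ]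
      (fun ω => wignerEntry Xd Xre Xim N i ω * wignerEntry Xd Xre Xim j N ω) := by
    have m1 := measurable_wignerEntry (Xd := Xd) (Xre := Xre) (Xim := Xim) (h1 i)
    have m2 := measurable_wignerEntry (Xd := Xd) (Xre := Xre) (Xim := Xim) (h2 j)
    exact m1.mul m2
  have hmul := integral_mul_of_measurable_entrySigma hX disjoint_compl_right hm hm2
  rw [hmul, integral_wignerEntry_self_sub hQ hX, integral_row_two hQ hX]

end Recursion

/-! ### The recursion obtained by averaging over the last row and column -/

section Recursion

variable {Ω : Type*} {Xd : ℕ → Ω → ℝ} {Xre Xim : UpperIndex → Ω → ℝ}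

lemma det_shiftedWigner_succ (N : ℕ) (s : ℝ) (ω : Ω) :
    (shiftedWigner Xd Xre Xim (N + 1) s ω).det =
      (wignerEntry Xd Xre Xim N N ω - s) * (shiftedWigner Xd Xre Xim N s ω).det -
      ∑ e : Fin N × Fin N, (wignerEntry Xd Xre Xim N e.1 ω * wignerEntry Xd Xre Xim e.2 N ω) *
        (shiftedWigner Xd Xre Xim N s ω).adjugate e.1 e.2 := by
  have hsub : (shiftedWigner Xd Xre Xim (N + 1) s ω).submatrix Fin.castSucc Fin.castSucc =
      shiftedWigner Xd Xre Xim N s ω := by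
    ext i j
    rw [Matrix.submatrix_apply, shiftedWigner_apply, shiftedWigner_apply]
    simp
  rw [det_eq_last_sub_sum_adjugate, hsub, Fintype.sum_prod_type]
  simp only [shiftedWigner_apply, Fin.val_last, if_true, Fin.val_castSucc,
    (Fin.castSucc_lt_last _).ne, (Fin.castSucc_lt_last _).ne', if_false, sub_zero]

variable [mΩ : MeasurableSpace Ω] {P : Measure Ω} {Q : Measure ℝ} {b : ℝ}

lemma integrable_and_integral_mul (hX : IsWignerFamily P Q Xd Xre Xim) {N : ℕ} {u v : Ω → ℂ}
    (hu : Measurable[entrySigma Xd Xre Xim {p | p.2 = N}] u) (hui : Integrable u P)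
    (hv : Measurable[entrySigma Xd Xre Xim {p | p.2 < N}] v) (hvi : Integrable v P) :
    Integrable (fun ω => u ω * v ω) P ∧
      ∫ ω, u ω * v ω ∂P = (∫ ω, u ω ∂P) * ∫ ω, v ω ∂P := by
  have hd : Disjoint {p : ℕ × ℕ | p.2 = N} {p | p.2 < N} :=
    Set.disjoint_left.mpr fun p h1 h2 => (h2.trans_eq h1.symm).false
  exact ⟨(indepFun_of_measurable_entrySigma hX hd hu hv).integrable_mul hui hvi,
    integral_mul_of_measurable_entrySigma hX hd hu hv⟩

variable [IsProbabilityMeasure P]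

/-- The effect of adding a row and a column on the correlation function. -/
lemma integral_charProd_succ (hQ : WignerMoments Q b) (hX : IsWignerFamily P Q Xd Xre Xim)
    (N : ℕ) (s t : ℝ) :
    ∫ ω, charProd Xd Xre Xim (N + 1) s t ω ∂P =
      (1 + s * t) * ∫ ω, (shiftedWigner Xd Xre Xim N s ω).det *
          (shiftedWigner Xd Xre Xim N t ω).det ∂P +
      s * ∫ ω, (shiftedWigner Xd Xre Xim N s ω).det *
          (shiftedWigner Xd Xre Xim N t ω).adjugate.trace ∂P +
      t * ∫ ω, (shiftedWigner Xd Xre Xim N s ω).adjugate.trace *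
          (shiftedWigner Xd Xre Xim N t ω).det ∂P +
      ∫ ω, (shiftedWigner Xd Xre Xim N s ω).adjugate.trace *
          (shiftedWigner Xd Xre Xim N t ω).adjugate.trace ∂P +
      ∫ ω, ((shiftedWigner Xd Xre Xim N s ω).adjugate *
          (shiftedWigner Xd Xre Xim N t ω).adjugate).trace ∂P +
      ((2 * (b - 3 / 4) : ℝ) : ℂ) * ∑ i, ∫ ω, (shiftedWigner Xd Xre Xim N s ω).adjugate i i *
          (shiftedWigner Xd Xre Xim N t ω).adjugate i i ∂P := by
  set a : Ω → ℂ := fun ω => (shiftedWigner Xd Xre Xim N s ω).det with ha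
  set a' : Ω → ℂ := fun ω => (shiftedWigner Xd Xre Xim N t ω).det with ha'
  set p : Fin N × Fin N → Ω → ℂ := fun e ω =>
    (shiftedWigner Xd Xre Xim N s ω).adjugate e.1 e.2 with hp
  set q : Fin N × Fin N → Ω → ℂ := fun e ω =>
    (shiftedWigner Xd Xre Xim N t ω).adjugate e.1 e.2 with hq
  set x : Fin N × Fin N → Ω → ℂ := fun e ω =>
    wignerEntry Xd Xre Xim N e.1 ω * wignerEntry Xd Xre Xim e.2 N ω with hx
  set d : ℝ → Ω → ℂ := fun s ω => wignerEntry Xd Xre Xim N N ω - s with hd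
  have la : MemLp a 2 P := memLp_det_shiftedWigner hQ hX N s
  have la' : MemLp a' 2 P := memLp_det_shiftedWigner hQ hX N t
  have lp : ∀ e, MemLp (p e) 2 P := fun e => memLp_adjugate_shiftedWigner hQ hX N s _ _
  have lq : ∀ e, MemLp (q e) 2 P := fun e => memLp_adjugate_shiftedWigner hQ hX N t _ _
  have lx : ∀ e, MemLp (x e) 2 P := fun e => memLp_wignerEntry_mul hQ hX _ _ _ _
  have ld : ∀ s, MemLp (d s) 2 P := fun s => memLp_wignerEntry_sub hQ hX N N s
  have ma : Measurable[entrySigma Xd Xre Xim {p | p.2 < N}] a := measurable_det_shiftedWigner N s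
  have ma' : Measurable[entrySigma Xd Xre Xim {p | p.2 < N}] a' :=
    measurable_det_shiftedWigner N t
  have mp : ∀ e, Measurable[entrySigma Xd Xre Xim {p | p.2 < N}] (p e) := fun e =>
    measurable_adjugate_shiftedWigner N s _ _
  have mq : ∀ e, Measurable[entrySigma Xd Xre Xim {p | p.2 < N}] (q e) := fun e =>
    measurable_adjugate_shiftedWigner N t _ _
  have mx : ∀ e, Measurable[entrySigma Xd Xre Xim {p | p.2 = N}] (x e) := by
    intro e
    have h1 : (min N (e.1 : ℕ), max N (e.1 : ℕ)) ∈ {p : ℕ × ℕ | p.2 = N} := max_eq_left e.1.2.le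
    have h2 : (min (e.2 : ℕ) N, max (e.2 : ℕ) N) ∈ {p : ℕ × ℕ | p.2 = N} := max_eq_right e.2.2.le
    have m1 := measurable_wignerEntry (Xd := Xd) (Xre := Xre) (Xim := Xim) h1
    have m2 := measurable_wignerEntry (Xd := Xd) (Xre := Xre) (Xim := Xim) h2
    exact m1.mul m2
  have md : ∀ s, Measurable[entrySigma Xd Xre Xim {p | p.2 = N}] (d s) := by
    intro s
    have h : (N, N) ∈ {p : ℕ × ℕ | p.2 = N} := rfl
    have m0 := measurable_wignerEntry_of_le (Xd := Xd) (Xre := Xre) (Xim := Xim) (le_refl N) h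
    exact m0.sub_const _
  -- Each type of term in the product of the two expansions is a factor from the last row and column
  -- times a factor from the N × N minor. Independence splits its expectation.
  have t1 := integrable_and_integral_mul hX ((md s).mul (md t)) ((ld s).integrable_mul (ld t))
    (ma.mul ma') (la.integrable_mul la')
  have t2 := fun e => integrable_and_integral_mul hX ((md s).mul (mx e))
    ((ld s).integrable_mul (lx e)) (ma.mul (mq e)) (la.integrable_mul (lq e))
  have t3 := fun e => integrable_and_integral_mul hX ((md t).mul (mx e))
    ((ld t).integrable_mul (lx e)) ((mp e).mul ma') ((lp e).integrable_mul la')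
  have t4 := fun e e' => integrable_and_integral_mul hX ((mx e).mul (mx e'))
    ((lx e).integrable_mul (lx e')) ((mp e).mul (mq e')) ((lp e).integrable_mul (lq e'))
  simp only [Pi.mul_apply] at t1 t2 t3 t4
  have iaq : ∀ e, Integrable (fun ω => a ω * q e ω) P := fun e => la.integrable_mul (lq e)
  have ipa : ∀ e, Integrable (fun ω => p e ω * a' ω) P := fun e => (lp e).integrable_mul la'
  have ipq : ∀ e e', Integrable (fun ω => p e ω * q e' ω) P := fun e e' =>
    (lp e).integrable_mul (lq e')
  have trp : ∀ ω, (shiftedWigner Xd Xre Xim N s ω).adjugate.trace = ∑ i, p (i, i) ω :=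
    fun _ => rfl
  have trq : ∀ ω, (shiftedWigner Xd Xre Xim N t ω).adjugate.trace = ∑ i, q (i, i) ω :=
    fun _ => rfl
  have trpq : ∀ ω, ((shiftedWigner Xd Xre Xim N s ω).adjugate *
      (shiftedWigner Xd Xre Xim N t ω).adjugate).trace =
      ∑ i, ∑ j, p (i, j) ω * q (j, i) ω := fun ω => by
    simp only [Matrix.trace, Matrix.diag_apply, Matrix.mul_apply, hp, hq]
  have hexp : ∀ ω, charProd Xd Xre Xim (N + 1) s t ω =
      d s ω * d t ω * (a ω * a' ω) - ∑ e, d s ω * x e ω * (a ω * q e ω) -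
        ∑ e, d t ω * x e ω * (p e ω * a' ω) +
        ∑ e, ∑ e', x e ω * x e' ω * (p e ω * q e' ω) := by
    intro ω
    have h : charProd Xd Xre Xim (N + 1) s t ω =
        (d s ω * a ω - ∑ e, x e ω * p e ω) * (d t ω * a' ω - ∑ e, x e ω * q e ω) :=
      congrArg₂ (· * ·) (det_shiftedWigner_succ N s ω) (det_shiftedWigner_succ N t ω)
    rw [h, sub_mul, mul_sub, mul_sub, Finset.sum_mul_sum, Finset.mul_sum, Finset.sum_mul]
    have e2 : ∑ e, d s ω * a ω * (x e ω * q e ω) = ∑ e, d s ω * x e ω * (a ω * q e ω) :=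
      Finset.sum_congr rfl fun e _ => by ring
    have e3 : ∑ e, x e ω * p e ω * (d t ω * a' ω) = ∑ e, d t ω * x e ω * (p e ω * a' ω) :=
      Finset.sum_congr rfl fun e _ => by ring
    have e4 : ∑ e, ∑ e', x e ω * p e ω * (x e' ω * q e' ω) =
        ∑ e, ∑ e', x e ω * x e' ω * (p e ω * q e' ω) :=
      Finset.sum_congr rfl fun e _ => Finset.sum_congr rfl fun e' _ => by ring
    rw [e2, e3, e4]
    ring
  have i2 : Integrable (fun ω => ∑ e, d s ω * x e ω * (a ω * q e ω)) P :=
    integrable_finsetSum _ fun e _ => (t2 e).1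
  have i3 : Integrable (fun ω => ∑ e, d t ω * x e ω * (p e ω * a' ω)) P :=
    integrable_finsetSum _ fun e _ => (t3 e).1
  have i4 : ∀ e, Integrable (fun ω => ∑ e', x e ω * x e' ω * (p e ω * q e' ω)) P := fun e =>
    integrable_finsetSum _ fun e' _ => (t4 e e').1
  have i5 : Integrable (fun ω => ∑ e, ∑ e', x e ω * x e' ω * (p e ω * q e' ω)) P :=
    integrable_finsetSum _ fun e _ => i4 e
  have i12 : Integrable (fun ω => d s ω * d t ω * (a ω * a' ω) -
    ∑ e, d s ω * x e ω * (a ω * q e ω)) P := t1.1.sub i2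
  have i123 : Integrable (fun ω => d s ω * d t ω * (a ω * a' ω) -
    ∑ e, d s ω * x e ω * (a ω * q e ω) - ∑ e, d t ω * x e ω * (p e ω * a' ω)) P := i12.sub i3
  have v2 : ∑ e, ∫ ω, d s ω * x e ω * (a ω * q e ω) ∂P =
      -(s * ∫ ω, a ω * (shiftedWigner Xd Xre Xim N t ω).adjugate.trace ∂P) := by
    simp only [trq, Finset.mul_sum]
    rw [integral_finsetSum _ fun i _ => iaq (i, i), Finset.mul_sum,
      ← Finset.sum_neg_distrib, Fintype.sum_prod_type]
    refine Finset.sum_congr rfl fun i _ => ?_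
    rw [Finset.sum_eq_single i]
    · rw [(t2 (i, i)).2, integral_wignerEntry_self_sub_mul_row hQ hX]
      simp [hq]
    · intro j _ hj
      rw [(t2 (i, j)).2, integral_wignerEntry_self_sub_mul_row hQ hX, if_neg hj.symm]
      simp
    · simp
  have v3 : ∑ e, ∫ ω, d t ω * x e ω * (p e ω * a' ω) ∂P =
      -(t * ∫ ω, (shiftedWigner Xd Xre Xim N s ω).adjugate.trace * a' ω ∂P) := by
    simp only [trp, Finset.sum_mul]
    rw [integral_finsetSum _ fun i _ => ipa (i, i), Finset.mul_sum,
      ← Finset.sum_neg_distrib, Fintype.sum_prod_type]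
    refine Finset.sum_congr rfl fun i _ => ?_
    rw [Finset.sum_eq_single i]
    · rw [(t3 (i, i)).2, integral_wignerEntry_self_sub_mul_row hQ hX]
      simp [hp]
    · intro j _ hj
      rw [(t3 (i, j)).2, integral_wignerEntry_self_sub_mul_row hQ hX, if_neg hj.symm]
      simp
    · simp
  have v4 : ∑ e, ∑ e', ∫ ω, x e ω * x e' ω * (p e ω * q e' ω) ∂P =
      ∫ ω, (shiftedWigner Xd Xre Xim N s ω).adjugate.trace *
          (shiftedWigner Xd Xre Xim N t ω).adjugate.trace ∂P +
      ∫ ω, ((shiftedWigner Xd Xre Xim N s ω).adjugate *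
          (shiftedWigner Xd Xre Xim N t ω).adjugate).trace ∂P +
      ((2 * (b - 3 / 4) : ℝ) : ℂ) * ∑ i, ∫ ω, p (i, i) ω * q (i, i) ω ∂P := by
    have w1 : ∫ ω, (shiftedWigner Xd Xre Xim N s ω).adjugate.trace *
        (shiftedWigner Xd Xre Xim N t ω).adjugate.trace ∂P =
        ∑ i, ∑ k, ∫ ω, p (i, i) ω * q (k, k) ω ∂P := by
      simp only [trp, trq, Finset.sum_mul_sum]
      rw [integral_finsetSum _ fun i _ => integrable_finsetSum _ fun k _ => ipq (i, i) (k, k)]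
      exact Finset.sum_congr rfl fun i _ => integral_finsetSum _ fun k _ => ipq (i, i) (k, k)
    have w2 : ∫ ω, ((shiftedWigner Xd Xre Xim N s ω).adjugate *
          (shiftedWigner Xd Xre Xim N t ω).adjugate).trace ∂P =
        ∑ i, ∑ j, ∫ ω, p (i, j) ω * q (j, i) ω ∂P := by
      simp only [trpq]
      rw [integral_finsetSum _ fun i _ => integrable_finsetSum _ fun k _ => ipq (i, k) (k, i)]
      exact Finset.sum_congr rfl fun i _ => integral_finsetSum _ fun k _ => ipq (i, k) (k, i)
    -- The three indicators give, in order, the product of the two traces, the trace of the product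
    -- of the adjugates, and the diagonal cofactors with the excess fourth moment.
    have hmom : ∀ e e', ∫ ω, x e ω * x e' ω ∂P =
        (if e.1 = e.2 ∧ e'.1 = e'.2 then 1 else 0) +
        (if e.1 = e'.2 ∧ e.2 = e'.1 then 1 else 0) +
        (if e.1 = e.2 ∧ e'.1 = e'.2 ∧ e.1 = e'.1 then ((2 * (b - 3 / 4) : ℝ) : ℂ) else 0) :=
      fun e e' => integral_row_four hQ hX _ _ _ _
    simp only [(t4 _ _).2, hmom, add_mul, Finset.sum_add_distrib, w1, w2,
      Fintype.sum_prod_type, ite_mul, one_mul, zero_mul, ite_and, Finset.mul_sum]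
    congr 1
    · congr 1
      · simp
      · simp
    · simp
  simp only [hexp]
  rw [integral_add i123 i5, integral_sub i12 i3, integral_sub t1.1 i2, t1.2,
    integral_wignerEntry_self_sub_mul hQ hX, integral_finsetSum _ fun e _ => (t2 e).1,
    integral_finsetSum _ fun e _ => (t3 e).1, integral_finsetSum _ fun e _ => i4 e,
    Finset.sum_congr rfl fun e _ => integral_finsetSum _ fun e' _ => (t4 e e').1, v2, v3, v4]
  ring

end Recursion

/-! ### Principal minors are again Wigner matrices -/

section Subfamily

variable {Ω : Type*} {Xd : ℕ → Ω → ℝ} {Xre Xim : UpperIndex → Ω → ℝ}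

/-- The action of a strictly increasing map on the positions above the diagonal. -/
def upperIndexMap {e : ℕ → ℕ} (he : StrictMono e) (p : UpperIndex) : UpperIndex :=
  ⟨(e p.1.1, e p.1.2), he p.2⟩

lemma injective_upperIndexMap {e : ℕ → ℕ} (he : StrictMono e) :
    Function.Injective (upperIndexMap he) := by
  rintro ⟨⟨a, b⟩, h⟩ ⟨⟨a', b'⟩, h'⟩ heq
  simp only [upperIndexMap, Subtype.mk.injEq, Prod.mk.injEq] at heq
  simp [he.injective heq.1, he.injective heq.2]

lemma wignerEntry_comp_strictMono {e : ℕ → ℕ} (he : StrictMono e) (i j : ℕ) (ω : Ω) :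
    wignerEntry (fun k => Xd (e k)) (fun p => Xre (upperIndexMap he p))
      (fun p => Xim (upperIndexMap he p)) i j ω = wignerEntry Xd Xre Xim (e i) (e j) ω := by
  simp only [wignerEntry, upperIndexMap, he.lt_iff_lt]

/-- Monotonicity keeps positions above the diagonal there, and injectivity preserves independence.
This lets the induction hypothesis be used for principal minors. -/
lemma IsWignerFamily.comp_strictMono [MeasurableSpace Ω] {P : Measure Ω} {Q : Measure ℝ}
    (hX : IsWignerFamily P Q Xd Xre Xim) {e : ℕ → ℕ} (he : StrictMono e) :
    IsWignerFamily P Q (fun k => Xd (e k)) (fun p => Xre (upperIndexMap he p))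
      (fun p => Xim (upperIndexMap he p)) where
  measurable_diag i := hX.measurable_diag _
  measurable_re p := hX.measurable_re _
  measurable_im p := hX.measurable_im _
  law_diag i := hX.law_diag _
  law_re p := hX.law_re _
  law_im p := hX.law_im _
  indep := by
    have h := hX.indep.precomp (g := Sum.map e (Sum.map (upperIndexMap he) (upperIndexMap he)))
      (he.injective.sumMap
        ((injective_upperIndexMap he).sumMap (injective_upperIndexMap he)))
    convert h using 1
    ext x
    rcases x with i | p | p <;> rfl

/-- The map omitting the value `i`. -/
def skipAt (i k : ℕ) : ℕ := if k < i then k else k + 1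

lemma strictMono_skipAt (i : ℕ) : StrictMono (skipAt i) := by
  intro a b hab
  unfold skipAt
  split_ifs <;> omega

/-- A diagonal cofactor carries the sign (-1)^(2i) = 1 and deletes one index from both rows and
columns. -/
lemma adjugate_shiftedWigner_self (N : ℕ) (s : ℝ) (i : Fin (N + 1)) (ω : Ω) :
    (shiftedWigner Xd Xre Xim (N + 1) s ω).adjugate i i =
      (shiftedWigner (fun k => Xd (skipAt i k))
        (fun p => Xre (upperIndexMap (strictMono_skipAt i) p))
        (fun p => Xim (upperIndexMap (strictMono_skipAt i) p)) N s ω).det := by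
  rw [Matrix.adjugate_fin_succ_eq_det_submatrix, (Even.add_self (i : ℕ)).neg_one_pow, one_mul]
  congr 1
  have hval : ∀ k : Fin N, (i.succAbove k : ℕ) = skipAt i k := by
    intro k
    simp only [Fin.succAbove, skipAt, Fin.lt_def, Fin.val_castSucc]
    split_ifs <;> simp
  ext k l
  rw [Matrix.submatrix_apply, shiftedWigner_apply, shiftedWigner_apply,
    wignerEntry_comp_strictMono, hval, hval]
  simp only [Fin.succAbove_right_inj]

end Subfamily

/-! ### The exact formula for the correlation function -/

section CorrelationFormula

variable {Ω : Type*} [mΩ : MeasurableSpace Ω] {P : Measure Ω} [IsProbabilityMeasure P]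
  {Q : Measure ℝ} {b : ℝ}

lemma hasDerivAt_integral_charProd_left {Xd : ℕ → Ω → ℝ} {Xre Xim : UpperIndex → Ω → ℝ}
    (hQ : WignerMoments Q b) (hX : IsWignerFamily P Q Xd Xre Xim) (N : ℕ) (s t : ℝ) :
    HasDerivAt (fun s => ∫ ω, charProd Xd Xre Xim N s t ω ∂P)
      (-∫ ω, (shiftedWigner Xd Xre Xim N s ω).adjugate.trace *
        (shiftedWigner Xd Xre Xim N t ω).det ∂P) s :=
  hasDerivAt_integral_det_shiftedWigner_mul hQ hX N s (memLp_det_shiftedWigner hQ hX N t)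

/-- The correlation functions of the characteristic polynomials of Wigner matrices in terms of
Hermite polynomials. -/
theorem integral_charProd_eq_corrKernel (hQ : WignerMoments Q b) (N : ℕ) :
    ∀ {Xd : ℕ → Ω → ℝ} {Xre Xim : UpperIndex → Ω → ℝ}, IsWignerFamily P Q Xd Xre Xim →
      ∀ s t : ℝ, ∫ ω, charProd Xd Xre Xim N s t ω ∂P =
        (corrKernel (b - 3 / 4) N (hermiteFun · s) (hermiteFun · t) : ℂ) := by
  -- The step to N + 1 uses size N for the given family and size N - 1 for its subfamilies, hence
  -- strong induction with the family quantified inside.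
  induction N using Nat.strong_induction_on with
  | _ N ih =>
  intro Xd Xre Xim hX s t
  rcases N with _ | N
  · simp [charProd, corrKernel, kernelSum, expSqCoeff, hermiteFun]
  set c := b - 3 / 4 with hc
  have hN := fun s t => ih N N.lt_succ_self hX s t
  -- The induction hypothesis holds for all s and t, so both sides can be differentiated: each trace
  -- of an adjugate corresponds to minus a partial derivative of the kernel.
  have hD1 : ∀ s t, ∫ ω, (shiftedWigner Xd Xre Xim N s ω).adjugate.trace *
      (shiftedWigner Xd Xre Xim N t ω).det ∂P =
      -(corrKernel c N (hermiteFunDeriv · s) (hermiteFun · t) : ℂ) := by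
    intro s t
    have h1 := hasDerivAt_integral_charProd_left hQ hX N s t
    simp only [hN] at h1
    rw [← h1.unique (hasDerivAt_corrKernel_left c N _ s).ofReal_comp, neg_neg]
  have hD2 : ∀ s t, ∫ ω, (shiftedWigner Xd Xre Xim N s ω).det *
      (shiftedWigner Xd Xre Xim N t ω).adjugate.trace ∂P =
      -(corrKernel c N (hermiteFun · s) (hermiteFunDeriv · t) : ℂ) := by
    intro s t
    rw [corrKernel_comm, ← hD1 t s]
    simp only [mul_comm]
  have hD12 : ∀ s t, ∫ ω, (shiftedWigner Xd Xre Xim N s ω).adjugate.trace *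
      (shiftedWigner Xd Xre Xim N t ω).adjugate.trace ∂P =
      (corrKernel c N (hermiteFunDeriv · s) (hermiteFunDeriv · t) : ℂ) := by
    intro s t
    have h1 := hasDerivAt_integral_det_shiftedWigner_mul hQ hX N s
      (memLp_trace_adjugate_shiftedWigner hQ hX N t)
    simp only [hD2] at h1
    have h2 := (hasDerivAt_corrKernel_left c N (hermiteFunDeriv · t) s).ofReal_comp.fun_neg
    exact neg_injective (h1.unique h2)
  have htr : ∀ s t : ℝ, ((s : ℂ) - t) * ∫ ω, ((shiftedWigner Xd Xre Xim N s ω).adjugate *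
      (shiftedWigner Xd Xre Xim N t ω).adjugate).trace ∂P =
      corrKernel c N (hermiteFun · s) (hermiteFunDeriv · t) -
        corrKernel c N (hermiteFunDeriv · s) (hermiteFun · t) := by
    intro s t
    have i1 : Integrable (fun ω => (shiftedWigner Xd Xre Xim N s ω).adjugate.trace *
        (shiftedWigner Xd Xre Xim N t ω).det) P :=
      (memLp_trace_adjugate_shiftedWigner hQ hX N s).integrable_mul
        (memLp_det_shiftedWigner hQ hX N t)
    have i2 : Integrable (fun ω => (shiftedWigner Xd Xre Xim N s ω).det *
        (shiftedWigner Xd Xre Xim N t ω).adjugate.trace) P :=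
      (memLp_det_shiftedWigner hQ hX N s).integrable_mul
        (memLp_trace_adjugate_shiftedWigner hQ hX N t)
    rw [← integral_const_mul]
    have hpt : ∀ ω, ((s : ℂ) - t) * ((shiftedWigner Xd Xre Xim N s ω).adjugate *
        (shiftedWigner Xd Xre Xim N t ω).adjugate).trace =
        (shiftedWigner Xd Xre Xim N s ω).adjugate.trace *
          (shiftedWigner Xd Xre Xim N t ω).det -
        (shiftedWigner Xd Xre Xim N s ω).det *
          (shiftedWigner Xd Xre Xim N t ω).adjugate.trace :=
      fun ω => sub_mul_trace_adjugate_mul_adjugate _ _ _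
    simp only [hpt]
    rw [integral_sub i1 i2, hD1, hD2]
    ring
  have hminor : ∀ s t, ∑ i, ∫ ω, (shiftedWigner Xd Xre Xim N s ω).adjugate i i *
      (shiftedWigner Xd Xre Xim N t ω).adjugate i i ∂P =
      N * (corrKernel c (N - 1) (hermiteFun · s) (hermiteFun · t) : ℂ) := by
    intro s t
    rcases N with _ | M
    · simp
    · simp only [adjugate_shiftedWigner_self]
      refine (Finset.sum_congr rfl fun (i : Fin (M + 1)) _ =>
        ih M (by omega) (hX.comp_strictMono (strictMono_skipAt i)) s t).trans ?_
      simp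
  have hmul : ∀ s t : ℝ, ((s : ℂ) - t) * ∫ ω, charProd Xd Xre Xim (N + 1) s t ω ∂P =
      (s - t) * corrKernel c (N + 1) (hermiteFun · s) (hermiteFun · t) := by
    intro s t
    have hrec := congrArg ((↑) : ℝ → ℂ) (corrKernel_hermiteFun_recursion c N s t)
    push_cast at hrec
    rw [← hrec, integral_charProd_succ hQ hX, hminor, hD1, hD2, hD12, ← hc]
    have h0 := hN s t
    change ∫ ω, (shiftedWigner Xd Xre Xim N s ω).det *
      (shiftedWigner Xd Xre Xim N t ω).det ∂P = _ at h0
    rw [h0]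
    push_cast
    linear_combination htr s t
  -- The recursion was proved only after multiplication by s - t; continuity in s recovers the point
  -- s = t.
  have hext : (fun s => ∫ ω, charProd Xd Xre Xim (N + 1) s t ω ∂P) =
      fun s => (corrKernel c (N + 1) (hermiteFun · s) (hermiteFun · t) : ℂ) := by
    refine Continuous.ext_on (dense_compl_singleton t) ?_ ?_ fun x hx => ?_
    · exact continuous_iff_continuousAt.mpr fun x =>
        (hasDerivAt_integral_charProd_left hQ hX (N + 1) x t).continuousAt
    · exact continuous_iff_continuousAt.mpr fun x =>
        (hasDerivAt_corrKernel_left c (N + 1) _ x).ofReal_comp.continuousAt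
    · refine mul_left_cancel₀ (sub_ne_zero.mpr ?_) (hmul x t)
      exact_mod_cast hx
  exact congrFun hext s

end CorrelationFormula

/-! ### Conclusion: translation to the local scale -/

theorem theorem1 {Ω : Type*} [MeasurableSpace Ω] (P : Measure Ω) [IsProbabilityMeasure P]
    (Q : Measure ℝ) [IsProbabilityMeasure Q]
    (hQ4 : Integrable (fun x : ℝ => x ^ 4) Q)
    (hQ1 : ∫ x, x ∂Q = 0)
    (hQ2 : ∫ x, x ^ 2 ∂Q = 1 / 2)
    (b : ℝ) (hb : b = ∫ x, x ^ 4 ∂Q)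
    (Xd : ℕ → Ω → ℝ) (Xre Xim : UpperIndex → Ω → ℝ)
    (hX : IsWignerFamily P Q Xd Xre Xim)
    (ξ : ℝ) (hξ : ξ ∈ Set.Ioo (-2 : ℝ) 2) (μ ν : ℝ) :
    (∀ (N : ℕ) (s t : ℝ), Integrable (charProd Xd Xre Xim N s t) P) ∧
    Tendsto
      (fun N : ℕ =>
        ((√(1 / (2 * Real.pi * N)) * (1 / (N.factorial : ℝ)) * Real.exp (-(N * ξ ^ 2 / 2)) : ℝ) : ℂ)
          * corrFun P Xd Xre Xim N
              (√(N : ℝ) * ξ + μ / (√(N : ℝ) * semicircleDensity ξ))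
              (√(N : ℝ) * ξ + ν / (√(N : ℝ) * semicircleDensity ξ)))
      atTop
      (𝓝 ((Real.exp (b - 3 / 4) * Real.exp (ξ * (μ + ν) / (2 * semicircleDensity ξ))
            * semicircleDensity ξ * Real.sinc (Real.pi * (μ - ν)) : ℝ) : ℂ)) := by
  have hQ : WignerMoments Q b := ⟨hQ4, hQ1, hQ2, hb.symm⟩
  refine ⟨integrable_charProd hQ hX, ?_⟩
  set ρ := semicircleDensity ξ with hρ
  have hrad : 0 < 4 - ξ ^ 2 := by nlinarith [hξ.1, hξ.2]
  have hρpos : 0 < ρ := by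
    rw [hρ, semicircleDensity]
    have := Real.pi_pos
    positivity
  have hsqrt : √(1 - ξ ^ 2 / 4) = Real.pi * ρ := by
    have h2 : 1 - ξ ^ 2 / 4 = (1 / 2) ^ 2 * (4 - ξ ^ 2) := by ring
    rw [h2, Real.sqrt_mul (by positivity), Real.sqrt_sq (by norm_num), hρ, semicircleDensity]
    field_simp
  -- The two spectral parameters are written as midpoint plus and minus half-difference. As √(1 -
  -- ξ²/4) = πρ, the prefactor √(1 - ξ²/4)/π is ρ and the argument of sinc becomes π(μ - ν).
  have h := tendsto_iteratedDeriv_corrGenFun (b - 3 / 4) ξ ((μ + ν) / (2 * ρ))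
    ((μ - ν) / (2 * ρ)) hξ
  rw [hsqrt] at h
  have e1 : ξ * ((μ + ν) / (2 * ρ)) = ξ * (μ + ν) / (2 * ρ) := by ring
  have e2 : Real.pi * ρ / Real.pi = ρ := by field_simp
  have e3 : 2 * ((μ - ν) / (2 * ρ)) * (Real.pi * ρ) = Real.pi * (μ - ν) := by field_simp
  rw [e1, e2, e3] at h
  refine h.congr fun N => ?_
  have a1 : √(N : ℝ) * ξ + (μ + ν) / (2 * ρ) / √N + (μ - ν) / (2 * ρ) / √N =
      √(N : ℝ) * ξ + μ / (√(N : ℝ) * ρ) := by ring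
  have a2 : √(N : ℝ) * ξ + (μ + ν) / (2 * ρ) / √N - (μ - ν) / (2 * ρ) / √N =
      √(N : ℝ) * ξ + ν / (√(N : ℝ) * ρ) := by ring
  rw [a1, a2, ← corrKernel_eq_iteratedDeriv, corrFun, integral_charProd_eq_corrKernel hQ N hX]
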